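/- Setting. For $\delta>0$, $\operatorname{Im}\tau>0$ let $\mathcal L=\delta^{-1}(\mathbb Z+\tau\mathbb Z)\subset\mathbb R^2$, with fundamental cell $\Omega$. For an integer $n\ge 1$ let $b=2\pi n/|\Omega|$, $a_b(x)=\frac b2(-x_2,x_1)$, $\chi_s(x)=\frac b2\, s\wedge x+c_s$, with constants $c_s$ ($s\in\mathcal L$) such that $\chi_{s+t}(x)-\chi_s(x+t)-\chi_t(x)\in 2\pi\mathbb Z$. Let $\mathfrak h$ be the space of $f\in L^2_{loc}(\mathbb R^2;\mathbb C)$ with $e^{-i\chi_s(x)}f(x+s)=f(x)$ for all $s\in\mathcal L$, with the norm of $L^2(\Omega)$, and $\mathfrak h^*$ the space of the complex conjugates of its elements; $\bar A:=\mathcal C A\,\mathcal C$ with $\mathcal C$ the complex conjugation. Let $-\Delta_{a_b}=-(\nabla-ia_b)^2$, as a self-adjoint operator on $\mathfrak h$. The pair potential is $v(x-y)$ with $v:\mathbb R^2\to\mathbb R$ measurable, bounded, even and $\mathcal L$-periodic; $\int v:=\int_\Omega v$; $v^\sharp$ multiplies the integral kernel $\alpha(x,y)$ of an operator $\alpha$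 by $v(x-y)$. Let $\mu\in\mathbb R$ be the chemical potential and $T>0$ the temperature. Normal state (exchange term dropped). $\Gamma_{Tb}=\begin{pmatrix}\gamma&0\\0&1-\bar\gamma\end{pmatrix}$ on $\mathfrak h\times\mathfrak h^*$, where the trace class operator $\gamma=\gamma_{Tb}$ solves $\gamma=(e^{2h_{Tb}/T}+1)^{-1}$, $h_{Tb}=-\Delta_{a_b}-\mu+\xi$, and $\xi=v*d_\gamma=(\int v)\,\mathrm{Tr}\,\gamma/|\Omega|$ is the constant direct self-interaction potential of the magnetically translation invariant $\gamma$ (its density $d_\gamma$ is constant). On Hilbert-Schmidt operators $\alpha:\mathfrak h^*\to\mathfrak h$, with $\langle\alpha,\alpha'\rangle=\mathrm{Tr}(\alpha^*\alpha')$, put $$L_{Tb}=K_{Tb}+v^\sharp,\qquad K_{Tb}=\frac{h_{Tb}^L+h_{Tb}^R}{\tanh(h_{Tb}^L/T)+\tanh(h_{Tb}^R/T)},\qquad h^L\alpha=h\alpha,\quad h^R\alpha=\alpha\bar h,$$ the quotient being extended by continuity where $h^L+h^R=0$. Free energy of $\Gamma=\begin{pmatrix}\gamma&\alpha\\\alpha^*&1-\bar\gamma\end{pmatrix}$: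 $$F_T(\Gamma,a_b)=\mathrm{Tr}((-\Delta_{a_b})\gamma)+\tfrac12\mathrm{Tr}((v*d_\gamma)\gamma)+\tfrac12\mathrm{Tr}(\alpha^*v^\sharp\alpha)+\int_\Omega|\operatorname{curl}a_b|^2+T\,\mathrm{Tr}(\Gamma\ln\Gamma)-\mu\,\mathrm{Tr}\,\gamma ,$$ where $d_\gamma(x)=\gamma(x,x)$, and $F_T=+\infty$ if the kinetic energy, $\mathrm{Tr}\,\gamma$ or $-\mathrm{Tr}(\Gamma\ln\Gamma)$ is infinite. Proposition. There is an absolute constant $\varepsilon_*>0$ such that for all $\mu,M\in\mathbb R$ there are $T_0,b_0$ with the following property. For all $\delta,\tau,n,(c_s)$ and $v$ as above with $\|v\|_\infty\le M$ and $|\int v|\le\varepsilon_*$, for all $T>0$ such that $T>T_0$ or $b>b_0$, and for every normal state $(\Gamma_{Tb},a_b)$ as above: (1) $L_{Tb}>0$; more precisely, there is $\kappa>0$ with $\langle\alpha,L_{Tb}\alpha\rangle\ge\kappa\|\alpha\|^2$ for all $\alpha$ in the domain of $L_{Tb}$. (2) The normal state is energetically stable under general $\alpha$-perturbations: for every Hilbert-Schmidt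 $\alpha\ne0$ with $\alpha^*=\bar\alpha$ and $\alpha\alpha^*\le C[\gamma_{Tb}(1-\gamma_{Tb})]^2$ for some $C$, and with $\phi(\alpha)=\begin{pmatrix}0&\alpha\\\alpha^*&0\end{pmatrix}$, there is $\varepsilon_0>0$ such that $F_T(\Gamma_{Tb}+\varepsilon\phi(\alpha),a_b)>F_T(\Gamma_{Tb},a_b)$ whenever $0<|\varepsilon|<\varepsilon_0$. -/

import Mathlib

open MeasureTheory
open scoped ENNReal InnerProductSpace ComplexConjugate ContDiff

noncomputable section

namespace BdG

/-! ### Lattice, magnetic field, equivariant functions -/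

/-- Geometric data: the lattice `δ⁻¹ (ℤ + τ ℤ)` in the plane `ℝ × ℝ`, the number `n ≥ 1` of flux
quanta per cell, and the constants `c` of an automorphy factor
`exp (i χ_s)`, `χ_s(x) = (b / 2) (s ∧ x) + c_s`, for the vector potential
`a_b(x) = (b / 2) (-x₂, x₁)` with flux `b |Ω| = 2 π n`. The lattice point `s = m ω₁ + k ω₂` is
indexed by `(m, k)`. The field `cocycle` is the cocycle condition
`χ_{s+t}(x) - χ_s(x + t) - χ_t(x) ∈ 2 π ℤ`, in which
`(b / 2) (s ∧ t) = π n (m k' - k m')`. -/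
structure Cell where
  δ : ℝ
  τ : ℂ
  n : ℕ
  c : ℤ → ℤ → ℝ
  δ_pos : 0 < δ
  τ_im_pos : 0 < τ.im
  n_pos : 0 < n
  cocycle : ∀ m k m' k' : ℤ, ∃ j : ℤ,
    c (m + m') (k + k') - c m k - c m' k' - Real.pi * n * (m * k' - k * m') = 2 * Real.pi * j

namespace Cell

variable (X : Cell)

/-- The point `m ω₁ + k ω₂ = δ⁻¹ (m + k τ)`, for real coordinates `m`, `k`. -/
def point (m k : ℝ) : ℝ × ℝ := (X.δ⁻¹ * (m + k * X.τ.re), X.δ⁻¹ * (k * X.τ.im))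

/-- The fundamental cell. -/
def Ω : Set (ℝ × ℝ) := {x | ∃ m ∈ Set.Ico (0 : ℝ) 1, ∃ k ∈ Set.Ico (0 : ℝ) 1, x = X.point m k}

/-- The area of the fundamental cell. -/
def area : ℝ := X.τ.im / X.δ ^ 2

/-- The strength of the constant magnetic field: `b = 2 π n / |Ω|`. -/
def b : ℝ := 2 * Real.pi * X.n / X.area

/-- Lebesgue measure on the fundamental cell. -/
def vol : Measure (ℝ × ℝ) := (volume : Measure (ℝ × ℝ)).restrict X.Ω

/-- `χ_s(x) = (b / 2) (s ∧ x) + c_s` for `s = m ω₁ + k ω₂`. -/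
def χ (m k : ℤ) (x : ℝ × ℝ) : ℝ :=
  X.b / 2 * ((X.point m k).1 * x.2 - (X.point m k).2 * x.1) + X.c m k

/-- Invariance under the magnetic translations: `exp (-i χ_s(x)) f (x + s) = f x`. -/
def Equivariant (f : ℝ × ℝ → ℂ) : Prop :=
  ∀ (m k : ℤ) (x : ℝ × ℝ),
    Complex.exp (-(Complex.I * (X.χ m k x : ℂ))) * f (x + X.point m k) = f x

/-- Covariant derivatives `∂_j - i (a_b)_j`, with `a_b(x) = (b / 2) (-x₂, x₁)`. -/
def D₁ (f : ℝ × ℝ → ℂ) (x : ℝ × ℝ) : ℂ :=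
  fderiv ℝ f x (1, 0) - Complex.I * ((-(X.b / 2) * x.2 : ℝ) : ℂ) * f x

/-- See `D₁`. -/
def D₂ (f : ℝ × ℝ → ℂ) (x : ℝ × ℝ) : ℂ :=
  fderiv ℝ f x (0, 1) - Complex.I * ((X.b / 2 * x.1 : ℝ) : ℂ) * f x

/-- The differential expression `-Δ_{a_b}`. -/
def magLap (f : ℝ × ℝ → ℂ) (x : ℝ × ℝ) : ℂ := -(X.D₁ (X.D₁ f) x + X.D₂ (X.D₂ f) x)

/-! ### One-particle space and the magnetic Laplacian -/

/-- The one-particle space `𝔥` of locally square integrable equivariant functions with the norm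
of `L²(Ω)`. An equivariant function is determined by its restriction to the cell, so `𝔥` is
`L²(Ω)`; equivariance enters through the domain of the magnetic Laplacian. The dual space `𝔥*`,
which consists of the complex conjugates of the elements of `𝔥`, is likewise `L²(Ω)`. -/
abbrev H : Type := Lp ℂ 2 X.vol

/-- `𝔥 ⊗ 𝔥`: the integral kernels `α(x, y)` of the Hilbert-Schmidt operators `𝔥* → 𝔥`. -/
abbrev HS : Type := Lp ℂ 2 (X.vol.prod X.vol)

/-- The range of `-Δ_{a_b} - λ` on smooth equivariant functions. -/
def lapRange (lam : ℝ) : Submodule ℂ X.H :=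
  Submodule.span ℂ {f | ∃ φ : ℝ × ℝ → ℂ, ContDiff ℝ ∞ φ ∧ X.Equivariant φ ∧
    f =ᵐ[X.vol] fun x => X.magLap φ x - lam * φ x}

/-- The eigenspace, for the eigenvalue `λ`, of the self-adjoint operator `-Δ_{a_b}` on `𝔥`, which
is the adjoint of its restriction to smooth equivariant functions: `u` is in the
eigenspace iff `⟨u, (-Δ_{a_b} - λ) φ⟩ = 0` for all smooth equivariant `φ`. -/
abbrev eigenspace (lam : ℝ) : Submodule ℂ X.H := (X.lapRange lam)ᗮ

/-- `B = f(-Δ_{a_b})`. The magnetic Laplacian on the compact cell has pure point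
spectrum, so that a bounded function of it is given by its action on the eigenfunctions. -/
def IsFunctionOfLap (f : ℝ → ℝ) (B : X.H →L[ℂ] X.H) : Prop :=
  ∀ lam : ℝ, ∀ u ∈ X.eigenspace lam, B u = (f lam : ℂ) • u

end Cell

/-! ### Traces, complex conjugation, block operators -/

section Trace

variable {E : Type*} [NormedAddCommGroup E] [InnerProductSpace ℂ E] [CompleteSpace E]

variable (E) in
/-- An orthonormal basis of `E`. -/
def onbSet : Set E := (exists_hilbertBasis ℂ E).choose

/-- The trace `∑ ⟨e, A e⟩` of a positive operator, with values in `[0, ∞]`. -/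
def trace (A : E →L[ℂ] E) : ℝ≥0∞ :=
  ∑' e : onbSet E, ENNReal.ofReal (⟪(e : E), A e⟫_ℂ).re

/-- The function `f(A)` of a bounded self-adjoint operator (continuous functional calculus). -/
def opFun (f : ℝ → ℝ) (A : E →L[ℂ] E) : E →L[ℂ] E := cfc f A

end Trace

namespace Cell

variable {X : Cell}

/-- The operator `Ā = 𝒞 A 𝒞`, with `𝒞` the complex conjugation. -/
def conjOp (A : X.H →L[ℂ] X.H) : X.H →L[ℂ] X.H :=
  LinearMap.mkContinuous
    { toFun := fun f => star (A (star f))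
      map_add' := by
        have h : ∀ f g : X.H, star (f + g) = star f + star g := fun f g => by
          apply Lp.ext
          filter_upwards [Lp.coeFn_star (f + g), Lp.coeFn_add f g,
            Lp.coeFn_add (star f) (star g), Lp.coeFn_star f, Lp.coeFn_star g]
            with x h1 h2 h3 h4 h5
          rw [h1, h3, Pi.star_apply, h2, Pi.add_apply, Pi.add_apply, h4, h5, star_add]
          rfl
        intro f g
        rw [h, map_add, h]
      map_smul' := by
        have h : ∀ (a : ℂ) (f : X.H), star (a • f) = conj a • star f := fun a f => by
          apply Lp.ext
          filter_upwards [Lp.coeFn_star (a • f), Lp.coeFn_smul a f,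
            Lp.coeFn_smul (conj a) (star f), Lp.coeFn_star f]
            with x h1 h2 h3 h4
          simp [h1, h2, h3, h4]
        intro a f
        rw [h, map_smul, h]
        simp } ‖A‖ (by
    have h : ∀ f : X.H, ‖star f‖ = ‖f‖ := fun f => by
      rw [Lp.norm_def, Lp.norm_def]
      congr 1
      apply eLpNorm_congr_norm_ae
      filter_upwards [Lp.coeFn_star f] with x h1
      simp [h1]
    intro f
    change ‖star (A (star f))‖ ≤ _
    rw [h, ← h f]
    exact A.le_opNorm _)

/-- `A` is the operator `𝔥* → 𝔥` with integral kernel `α`. -/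
def HasKernel (A : X.H →L[ℂ] X.H) (α : X.HS) : Prop :=
  ∀ g : X.H, A g =ᵐ[X.vol] fun x => ∫ y, α (x, y) * g y ∂X.vol

/-- The operator matrix `Γ = (γ, α; α*, 1 - γ̄)` on `𝔥 × 𝔥*`. -/
def Gam (γ A : X.H →L[ℂ] X.H) : WithLp 2 (X.H × X.H) →L[ℂ] WithLp 2 (X.H × X.H) :=
  ((WithLp.prodContinuousLinearEquiv 2 ℂ X.H X.H).symm : X.H × X.H →L[ℂ] WithLp 2 (X.H × X.H)) ∘L
    ((γ ∘L ContinuousLinearMap.fst ℂ X.H X.H + A ∘L ContinuousLinearMap.snd ℂ X.H X.H).prod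
      (A.adjoint ∘L ContinuousLinearMap.fst ℂ X.H X.H
        + (1 - conjOp γ) ∘L ContinuousLinearMap.snd ℂ X.H X.H)) ∘L
    (WithLp.prodContinuousLinearEquiv 2 ℂ X.H X.H : WithLp 2 (X.H × X.H) →L[ℂ] X.H × X.H)

/-! ### Free energy -/

/-- The entropy `S(Γ) = - Tr (Γ ln Γ)`. -/
def entropy (γ A : X.H →L[ℂ] X.H) : ℝ≥0∞ := trace (opFun Real.negMulLog (Gam γ A))

/-- The kinetic energy `Tr ((-Δ_{a_b}) γ) = ∑_λ λ Tr (P_λ γ P_λ)`, with `P_λ` the eigenprojections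
of `-Δ_{a_b}`. -/
def kinetic (γ : X.H →L[ℂ] X.H) : ℝ≥0∞ :=
  ∑' lam : ℝ, ENNReal.ofReal lam *
    trace ((X.eigenspace lam).starProjection ∘L γ ∘L (X.eigenspace lam).starProjection)

/-- The one-particle density `d_γ(x) = γ(x, x) = ∑_e |(√γ e)(x)|²` of an operator `γ ≥ 0`. -/
def density (γ : X.H →L[ℂ] X.H) (x : ℝ × ℝ) : ℝ :=
  (∑' e : onbSet X.H, ‖(opFun Real.sqrt γ e : X.H) x‖ₑ ^ 2).toReal

open scoped Classical in
/-- The free energy `F_T(Γ, a_b) = E(Γ, a_b) - T S(Γ) - μ Tr γ` of the state `Γ = (γ, α; α*, 1 - γ̄)`,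
where `A` is the operator with kernel `α`, with
`E(Γ, a_b) = Tr ((-Δ_{a_b}) γ) + ½ Tr ((v * d_γ) γ) + ½ Tr (α* (v♯ α)) + ∫_Ω |curl a_b|²`.
It is `+∞` where the kinetic energy, the number of particles or the entropy is infinite. -/
def freeEnergy (v : ℝ × ℝ → ℝ) (μ T : ℝ) (γ A : X.H →L[ℂ] X.H) (α : X.HS) : EReal :=
  if kinetic γ < ⊤ ∧ trace γ < ⊤ ∧ entropy γ A < ⊤ then
    (((kinetic γ).toReal
      + 1 / 2 * ∫ x, ∫ y, v (x - y) * density γ y * density γ x ∂X.vol ∂X.vol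
      + 1 / 2 * ∫ z, v (z.1 - z.2) * ‖α z‖ ^ 2 ∂(X.vol.prod X.vol)
      + X.b ^ 2 * X.area
      - T * (entropy γ A).toReal - μ * (trace γ).toReal : ℝ) : EReal)
  else ⊤

end Cell

/-! ### Pair potentials, normal states, the operator `L_{Tb}` -/

/-- Real, bounded, even pair potentials `v(x, y) = v(x - y)`, periodic with respect to the lattice
(so that multiplication by `v(x - y)` preserves the equivariant kernels). -/
structure IsPairPotential (X : Cell) (M : ℝ) (v : ℝ × ℝ → ℝ) : Prop where
  measurable : Measurable v
  bound : ∀ x, |v x| ≤ M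
  even : ∀ x, v (-x) = v x
  periodic : ∀ (m k : ℤ) (x : ℝ × ℝ), v (x + X.point m k) = v x

namespace Cell

/-- The Fermi-Dirac function `g♯(h) = (e^{2 h} + 1)⁻¹`. -/
def fermi (h : ℝ) : ℝ := (Real.exp (2 * h) + 1)⁻¹

/-- `γ` and the real constant `ξ` define the magnetically translation invariant normal state
`(Γ_{Tb}, a_b)`, with `Γ_{Tb} = (γ, 0; 0, 1 - γ̄)`: with the exchange term dropped, `γ` solves
`γ = g♯(h_{Tb} / T)`, `h_{Tb} = -Δ_{a_b} + v * d_γ - μ`. The density `d_γ` of a magnetically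
translation invariant `γ` is constant, hence equal to the trace per unit area `Tr γ / |Ω|`, and
`v * d_γ` is the constant `ξ = (∫ v) Tr γ / |Ω|`. -/
structure IsNormalState {X : Cell} (v : ℝ × ℝ → ℝ) (μ T ξ : ℝ) (γ : X.H →L[ℂ] X.H) : Prop where
  trace_lt_top : trace γ < ⊤
  fixed_point : X.IsFunctionOfLap (fun lam => fermi ((lam - μ + ξ) / T)) γ
  potential : ξ = (∫ y, v y ∂X.vol) * ((trace γ).toReal / X.area)

/-- `(x + y) / (tanh (x / T) + tanh (y / T))`, extended by continuity to `x + y = 0`. -/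
def kSymbol (T x y : ℝ) : ℝ :=
  if x + y = 0 then T * Real.cosh (x / T) ^ 2
  else (x + y) / (Real.tanh (x / T) + Real.tanh (y / T))

variable {X : Cell}

/-- `β = K_{Tb} α`, for the self-adjoint operator
`K_{Tb} = (h^L + h^R) / (tanh (h^L / T) + tanh (h^R / T))` on `𝔥 ⊗ 𝔥`, where `h = -Δ_{a_b} - μ + ξ`,
`h^L α = h α` and `h^R α = α h̄`. The kernels `u(x) w(y)`, with `u` and `w` eigenfunctions
of `-Δ_{a_b}`, are the joint eigenvectors of `h^L` and `h^R`. -/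
def IsK (μ T ξ : ℝ) (α β : X.HS) : Prop :=
  ∀ lam lam' : ℝ, ∀ u ∈ X.eigenspace lam, ∀ w ∈ X.eigenspace lam',
    ∫ z, conj (u z.1 * w z.2) * β z ∂(X.vol.prod X.vol)
      = kSymbol T (lam - μ + ξ) (lam' - μ + ξ)
        * ∫ z, conj (u z.1 * w z.2) * α z ∂(X.vol.prod X.vol)

/-- `β = L_{Tb} α`, where `L_{Tb} = K_{Tb} + v♯` and `(v♯ α)(x, y) = v(x - y) α(x, y)`. -/
def IsL (v : ℝ × ℝ → ℝ) (μ T ξ : ℝ) (α β : X.HS) : Prop :=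
  ∃ κ : X.HS, IsK μ T ξ α κ ∧ β =ᵐ[X.vol.prod X.vol] fun z => κ z + (v (z.1 - z.2) : ℂ) * α z

/-- `L_{Tb} > 0`: the quadratic form of `L_{Tb}` is bounded below by a positive constant. -/
def LPos (X : Cell) (v : ℝ × ℝ → ℝ) (μ T ξ : ℝ) : Prop :=
  ∃ κ > 0, ∀ α β : X.HS, IsL v μ T ξ α β → κ * ‖α‖ ^ 2 ≤ (⟪α, β⟫_ℂ).re

/-- The `α`-perturbations `Γ' = (0, α; α*, 0)` of the normal state: `α` is Hilbert-Schmidt, with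
kernel `α`, `α* = ᾱ`, and `α α* ≤ C [γ (1 - γ)]²` for some `C`. -/
structure IsPerturbation (γ A : X.H →L[ℂ] X.H) (α : X.HS) : Prop where
  kernel : HasKernel A α
  symm : A.adjoint = conjOp A
  dominated : ∃ C : ℝ, A ∘L A.adjoint ≤ C • (γ * (1 - γ)) ^ 2

/-- Energetic stability of the normal state under general `α`-perturbations: along every
perturbation `α ≠ 0`, `F_T(Γ_{Tb} + ε φ(α), a_b) > F_T(Γ_{Tb}, a_b)` for all small `ε ≠ 0`. -/
def IsEnergeticallyStable (v : ℝ × ℝ → ℝ) (μ T : ℝ) (γ : X.H →L[ℂ] X.H) : Prop :=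
  ∀ (A : X.H →L[ℂ] X.H) (α : X.HS), IsPerturbation γ A α → α ≠ 0 →
    ∃ ε₀ > 0, ∀ ε : ℝ, ε ≠ 0 → |ε| < ε₀ →
      freeEnergy v μ T γ 0 0 < freeEnergy v μ T γ ((ε : ℂ) • A) ((ε : ℂ) • α)

end Cell

end BdG

end

/-! The perturbation `ε φ(α)` leaves `γ` fixed, so only two terms of the free energy move: the pair
energy, which is at least `-½ M ε² ‖α‖²`, and the entropy. It therefore suffices that the entropy
drops by at least `r ε² ‖α‖²` with `T r > M / 2`. The drop comes from the strict concavity of `-p ln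
p`. On `[0, 1]` this function lies below a parabola touching it at `q` with curvature constant `r`.
Through the functional calculus of `Γ` the bound passes to matrix elements at an eigenvector `e` of
`γ`, where the linear term vanishes and the quadratic one is `‖α* e‖²`; summed over a basis this is
the Hilbert-Schmidt norm (`entropy_add_le`). Thus (2) is proved by a direct convexity estimate,
without expanding to second order or passing through (1).

For (1), `K` is diagonal in products of eigenfunctions. Its symbol is at least `T` everywhere
(`le_kSymbol`) and at least `H` when both levels are at least `H > 0` (`le_kSymbol_of_le`), while
`v♯ ≥ -M`.

Two regimes result. For `T > 2|M| + 1` the bound `T` on the symbol and the universal constant `r =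
1/4` are enough. Otherwise `T` is bounded and the field is strong. All levels `(2k + 1) b - μ + ξ`
are then large, provided that `ξ` does not cancel `b`. Self-consistency excludes this: `n / |Ω| = b
/ (2π)` particles per unit area and level, together with a small `∫ v`, force `ξ ≥ -2b/3`
(`IsNormalState.neg_mul_le_potential`). Large levels mean tiny occupations `q`, for which the
concavity constant improves to `-ln q / 8` (`negMulLog_upper_of_small`).

Operators are only prescribed on eigenvectors of the magnetic Laplacian, so everything rests on a
complete eigenbasis with `n` vectors at each `(2k + 1) b` (`exists_landau_basis`). It is explicit:
plane waves times Hermite-Gauss functions on a strip, summed over translates. The eigenvalue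
equation is checked weakly, by integrating by parts on the strip. Completeness follows from Fourier
series in one coordinate and totality of polynomials times a Gaussian in the other. -/

namespace BdG

open Polynomial Filter Topology

/-! ### Polynomials times Gaussians -/

/-- The function `P(y) exp (-z y²)` on the real line. -/
noncomputable def gaussPoly (z : ℂ) (P : ℂ[X]) (y : ℝ) : ℂ :=
  P.eval (y : ℂ) * Complex.exp (-z * (y : ℂ) ^ 2)

theorem exists_norm_eval_le_exp_abs (P : ℂ[X]) :
    ∃ C : ℝ, 0 ≤ C ∧ ∀ y : ℝ, ‖P.eval (y : ℂ)‖ ≤ C * Real.exp |y| := by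
  induction P using Polynomial.induction_on' with
  | add p q hp hq =>
    obtain ⟨C, hC, h⟩ := hp
    obtain ⟨C', hC', h'⟩ := hq
    refine ⟨C + C', by positivity, fun y => ?_⟩
    rw [eval_add, add_mul]
    exact (norm_add_le _ _).trans (add_le_add (h y) (h' y))
  | monomial n a =>
    refine ⟨‖a‖ * n.factorial, by positivity, fun y => ?_⟩
    have h1 := Real.pow_div_factorial_le_exp |y| (abs_nonneg y) n
    rw [div_le_iff₀ (by positivity)] at h1
    rw [eval_monomial, norm_mul, norm_pow, Complex.norm_real, Real.norm_eq_abs, mul_assoc]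
    gcongr
    linarith

/-- A Gaussian beats every exponential. The rate `a` is left free because the totality argument
needs exponential moments of all orders. -/
theorem exists_norm_gaussPoly_le {z : ℂ} (hz : 0 < z.re) (P : ℂ[X]) (a : ℝ) :
    ∃ C : ℝ, 0 ≤ C ∧ ∀ y : ℝ, ‖gaussPoly z P y‖ ≤ C * Real.exp (-a * |y|) := by
  obtain ⟨C, hC, h⟩ := exists_norm_eval_le_exp_abs P
  -- `(1 + a)² / (4 z.re)` is the maximum of `(1 + a) u - z.re u²` over real `u`, here with `u =
  -- |y|`.
  refine ⟨C * Real.exp ((1 + a) ^ 2 / (4 * z.re)), by positivity, fun y => ?_⟩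
  have hre : (-z * (y : ℂ) ^ 2).re = -z.re * y ^ 2 := by
    rw [← Complex.ofReal_pow, Complex.re_mul_ofReal, Complex.neg_re]
  rw [gaussPoly, norm_mul, Complex.norm_exp, hre]
  calc _ ≤ C * Real.exp |y| * Real.exp (-z.re * y ^ 2) := by gcongr; exact h y
    _ = C * Real.exp (|y| + -z.re * y ^ 2) := by rw [mul_assoc, Real.exp_add]
    _ ≤ C * Real.exp ((1 + a) ^ 2 / (4 * z.re) + -a * |y|) := by
      refine mul_le_mul_of_nonneg_left (Real.exp_le_exp.2 ?_) hC
      have h2 : |y| + -z.re * y ^ 2 + a * |y| ≤ (1 + a) ^ 2 / (4 * z.re) := by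
        rw [le_div_iff₀ (by positivity), ← sq_abs y]
        nlinarith [sq_nonneg (2 * z.re * |y| - (1 + a))]
      linarith
    _ = _ := by rw [Real.exp_add, mul_assoc]

theorem continuous_gaussPoly (z : ℂ) (P : ℂ[X]) : Continuous (gaussPoly z P) := by
  unfold gaussPoly
  fun_prop

/-- Differentiation acts on the polynomial factor alone, which turns the analysis of Landau
functions into algebra in `ℂ[X]`. -/
theorem hasDerivAt_gaussPoly (z : ℂ) (P : ℂ[X]) (y : ℝ) :
    HasDerivAt (gaussPoly z P) (gaussPoly z (derivative P - C (2 * z) * X * P) y) y := by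
  have h1 : HasDerivAt (fun w : ℂ => P.eval w * Complex.exp (-z * w ^ 2))
      (P.derivative.eval (y : ℂ) * Complex.exp (-z * (y : ℂ) ^ 2) + P.eval (y : ℂ) *
        (Complex.exp (-z * (y : ℂ) ^ 2) * (-z * (2 * (y : ℂ))))) (y : ℂ) := by
    refine (P.hasDerivAt _).mul (HasDerivAt.cexp ?_)
    simpa using (hasDerivAt_pow 2 (y : ℂ)).const_mul (-z)
  refine h1.comp_ofReal.congr_deriv ?_
  simp only [gaussPoly, eval_sub, eval_mul, eval_C, eval_X]
  ring

theorem integrable_exp_neg_abs : Integrable fun y : ℝ => Real.exp (-|y|) := by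
  rw [← integrableOn_univ, ← Set.Iic_union_Ioi (a := (0 : ℝ))]
  refine IntegrableOn.union ?_ ?_
  · refine (integrableOn_exp_Iic 0).congr_fun (fun y hy => ?_) measurableSet_Iic
    simp [abs_of_nonpos (show y ≤ 0 from hy)]
  · refine (integrableOn_exp_neg_Ioi 0).congr_fun (fun y hy => ?_) measurableSet_Ioi
    simp [abs_of_pos (show 0 < y from hy)]

theorem integrable_gaussPoly {z : ℂ} (hz : 0 < z.re) (P : ℂ[X]) :
    Integrable (gaussPoly z P) := by
  obtain ⟨C, -, h⟩ := exists_norm_gaussPoly_le hz P 1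
  refine (integrable_exp_neg_abs.const_mul C).mono'
    (continuous_gaussPoly z P).aestronglyMeasurable (ae_of_all _ fun y => ?_)
  simpa using h y

/-- An integrable function with vanishing Fourier transform vanishes. -/
theorem ae_eq_zero_of_fourier_eq_zero {f : ℝ → ℂ} (hf : Integrable f)
    (h : ∀ ξ : ℝ, FourierTransform.fourier f ξ = 0) : f =ᵐ[volume] 0 := by
  refine ae_eq_zero_of_integral_contDiff_smul_eq_zero hf.locallyIntegrable fun g hg hgs => ?_
  have hg' : ContDiff ℝ ∞ fun x => (g x : ℂ) := Complex.ofRealCLM.contDiff.comp hg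
  have hgs' : HasCompactSupport fun x => (g x : ℂ) :=
    hgs.comp_left (g := fun x : ℝ => (x : ℂ)) Complex.ofReal_zero
  set G : SchwartzMap ℝ ℂ := hgs'.toSchwartzMap hg' with hG
  -- The test function is itself a Fourier transform, of the Schwartz function `K`; moving the
  -- transform onto `f` annihilates the pairing.
  set K : SchwartzMap ℝ ℂ := FourierTransformInv.fourierInv G with hK
  have hKG : FourierTransform.fourier K = G := FourierTransform.fourier_fourierInv_eq G
  have key : ∫ ξ, FourierTransform.fourier f ξ • K ξ
      = ∫ x, f x • FourierTransform.fourier (K : ℝ → ℂ) x := by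
    simpa using! VectorFourier.integral_fourierIntegral_smul_eq_flip (L := innerₗ ℝ)
      Real.continuous_fourierChar continuous_inner hf K.integrable
  simp only [h, zero_smul, integral_zero] at key
  have h3 : (FourierTransform.fourier (K : ℝ → ℂ)) = fun x => (g x : ℂ) := by
    rw [← SchwartzMap.fourier_coe, hKG]
    rfl
  rw [h3] at key
  rw [key]
  congr 1
  ext x
  simp [mul_comm]

/-- Polynomials times a Gaussian are total. -/
theorem ae_eq_zero_of_integral_conj_gaussPoly_mul_eq_zero {z : ℂ} (hz : 0 < z.re) {F : ℝ → ℂ}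
    (hF : AEStronglyMeasurable F volume) (hint : Integrable fun y => Real.exp (-|y|) • F y)
    (h : ∀ P : ℂ[X], ∫ y, conj (gaussPoly z P y) * F y = 0) : F =ᵐ[volume] 0 := by
  -- `F` need only be integrable against `exp (-|y|)`; after multiplication by the Gaussian it has
  -- all exponential moments, so its Fourier transform is given by a power series in the moments.
  set G : ℝ → ℂ := fun y => conj (gaussPoly z 1 y) * F y with hG
  have hGm : AEStronglyMeasurable G volume :=
    (Complex.continuous_conj.comp (continuous_gaussPoly z 1)).aestronglyMeasurable.mul hF
  have hexp : ∀ a : ℝ, Integrable fun y => Real.exp (a * |y|) * ‖G y‖ := by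
    intro a
    obtain ⟨C, hC, hb⟩ := exists_norm_gaussPoly_le hz 1 (1 + a)
    refine (hint.norm.const_mul C).mono' ?_ (ae_of_all _ fun y => ?_)
    · exact (by fun_prop : Continuous fun y : ℝ => Real.exp (a * |y|)).aestronglyMeasurable.mul
        hGm.norm
    · rw [Real.norm_of_nonneg (by positivity), hG, norm_mul, RCLike.norm_conj, norm_smul,
        Real.norm_of_nonneg (Real.exp_nonneg _)]
      calc _ ≤ Real.exp (a * |y|) * (C * Real.exp (-(1 + a) * |y|) * ‖F y‖) := by
            gcongr; exact hb y
        _ = C * (Real.exp (a * |y| + -(1 + a) * |y|) * ‖F y‖) := by rw [Real.exp_add]; ring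
        _ = _ := by ring_nf
  have hGi : Integrable G := by
    have := hexp 0
    simp only [zero_mul, Real.exp_zero, one_mul] at this
    exact (integrable_norm_iff hGm).1 this
  have hzero : G =ᵐ[volume] 0 := by
    refine ae_eq_zero_of_fourier_eq_zero hGi fun ξ => ?_
    rw [Real.fourier_eq']
    set c : ℂ := (-2 * Real.pi * ξ : ℝ) * Complex.I with hc
    -- Termwise integration of the exponential series is dominated by `exp (‖c‖ |y|) ‖G y‖`; each
    -- term is a moment, zero by hypothesis with `P = X ^ k`.
    have hs : HasSum (fun k : ℕ => ∫ y : ℝ, (c * y) ^ k / (k.factorial : ℂ) * G y)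
        (∫ y : ℝ, Complex.exp (c * y) * G y) := by
      refine hasSum_integral_of_dominated_convergence
        (fun k y => (‖c‖ * |y|) ^ k / k.factorial * ‖G y‖) (fun k => ?_)
        (fun k => ae_of_all _ fun y => ?_) (ae_of_all _ fun y => ?_) ?_ (ae_of_all _ fun y => ?_)
      · exact (by fun_prop : Continuous fun y : ℝ => (c * y) ^ k / (k.factorial : ℂ)
          ).aestronglyMeasurable.mul hGm
      · simp
      · exact (Real.summable_pow_div_factorial _).mul_right _
      · refine (hexp ‖c‖).congr (ae_of_all _ fun y => ?_)
        simp only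
        rw [tsum_mul_right, Real.exp_eq_exp_ℝ, NormedSpace.exp_eq_tsum_div]
      · refine HasSum.mul_right _ ?_
        rw [Complex.exp_eq_exp_ℂ]
        exact NormedSpace.expSeries_div_hasSum_exp _
    have hterm : ∀ k : ℕ, ∫ y : ℝ, (c * y) ^ k / (k.factorial : ℂ) * G y = 0 := by
      intro k
      have := h (X ^ k)
      have h2 : (fun y : ℝ => (c * y) ^ k / (k.factorial : ℂ) * G y) = fun y =>
          c ^ k / (k.factorial : ℂ) * (conj (gaussPoly z (X ^ k) y) * F y) := by
        ext y
        simp only [hG, gaussPoly, eval_pow, eval_X, eval_one, one_mul, map_mul, map_pow,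
          Complex.conj_ofReal]
        ring
      rw [h2, integral_const_mul, this, mul_zero]
    simp only [hterm] at hs
    have h0 := hs.unique hasSum_zero
    rw [← h0]
    congr 1
    ext y
    rw [smul_eq_mul, hc]
    congr 2
    simp
    ring
  filter_upwards [hzero] with y hy
  have : conj (gaussPoly z 1 y) ≠ 0 := by simp [gaussPoly]
  simpa [hG, this] using hy

/-! ### Hermite functions -/

/-- The Hermite polynomials `He_k(√(2κ) y)`, orthogonal with respect to `exp (-κ y²)`. -/
noncomputable def hermiteC (κ : ℝ) (k : ℕ) : ℂ[X] :=
  ((hermite k).map (Int.castRingHom ℂ)).comp (C (Real.sqrt (2 * κ) : ℂ) * X)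

theorem derivative_hermite_succ (k : ℕ) :
    derivative (hermite (k + 1)) = (k + 1 : ℤ[X]) * hermite k := by
  induction k with
  | zero => simp
  | succ k ih =>
    rw [hermite_succ (k + 1), derivative_sub, derivative_mul, ih, derivative_X, derivative_mul]
    have : derivative ((k : ℤ[X]) + 1) = 0 := by simp
    rw [this, hermite_succ k]
    push_cast
    ring

theorem hermite_ode (k : ℕ) :
    derivative (derivative (hermite k)) - X * derivative (hermite k) = -(k : ℤ[X]) * hermite k := by
  cases k with
  | zero => simp
  | succ k =>
    have h := hermite_succ k
    have : derivative ((k : ℤ[X]) + 1) = 0 := by simp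
    rw [derivative_hermite_succ, derivative_mul, this, h]
    push_cast
    ring

theorem derivative_hermiteC (κ : ℝ) (k : ℕ) :
    derivative (hermiteC κ k) = C (Real.sqrt (2 * κ) : ℂ) *
      ((derivative (hermite k)).map (Int.castRingHom ℂ)).comp (C (Real.sqrt (2 * κ) : ℂ) * X) := by
  rw [hermiteC, derivative_comp, derivative_map]
  simp

/-- Hermite's equation rescaled by `√(2κ)`. It is the source of the eigenvalues `2k + 1` in
`raise_raise`. -/
theorem hermiteC_ode {κ : ℝ} (hκ : 0 ≤ κ) (k : ℕ) :
    derivative (derivative (hermiteC κ k)) - C (2 * κ : ℂ) * X * derivative (hermiteC κ k)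
      = -C (2 * κ * k : ℂ) * hermiteC κ k := by
  have h := congrArg (fun p => (p.map (Int.castRingHom ℂ)).comp (C (Real.sqrt (2 * κ) : ℂ) * X))
    (hermite_ode k)
  simp only [Polynomial.map_sub, Polynomial.map_mul, Polynomial.map_neg, Polynomial.map_natCast,
    sub_comp, mul_comp, neg_comp, natCast_comp, map_X, X_comp] at h
  have hs : C (2 * κ : ℂ) = C (Real.sqrt (2 * κ) : ℂ) * C (Real.sqrt (2 * κ) : ℂ) := by
    rw [← C_mul, ← Complex.ofReal_mul, Real.mul_self_sqrt (by positivity)]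
    push_cast
    rfl
  have hk : C (2 * κ * k : ℂ) = C (2 * κ : ℂ) * (k : ℂ[X]) := by
    rw [C_mul]; simp
  rw [derivative_hermiteC, derivative_mul, derivative_C, zero_mul, zero_add, derivative_comp,
    derivative_map, hk, hs, hermiteC]
  simp only [derivative_mul, derivative_C, derivative_X, zero_mul, zero_add, mul_one]
  linear_combination (C (Real.sqrt (2 * κ) : ℂ) * C (Real.sqrt (2 * κ) : ℂ)) * h

/-- The left side is the polynomial factor of the derivative of `hermiteC κ k` times `exp (-κ y²)`:
Rodrigues' recursion, which makes the next Hermite polynomial a total derivative. -/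
theorem hermiteC_succ {κ : ℝ} (hκ : 0 < κ) (k : ℕ) :
    derivative (hermiteC κ k) - C (2 * κ : ℂ) * X * hermiteC κ k
      = -C (Real.sqrt (2 * κ) : ℂ) * hermiteC κ (k + 1) := by
  have hs : C (2 * κ : ℂ) = C (Real.sqrt (2 * κ) : ℂ) * C (Real.sqrt (2 * κ) : ℂ) := by
    rw [← C_mul, ← Complex.ofReal_mul, Real.mul_self_sqrt (by positivity)]
    push_cast
    rfl
  rw [derivative_hermiteC, hs, hermiteC, hermiteC, hermite_succ]
  simp only [Polynomial.map_sub, Polynomial.map_mul, sub_comp, mul_comp, map_X, X_comp]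
  ring

theorem natDegree_hermiteC {κ : ℝ} (hκ : 0 < κ) (k : ℕ) : (hermiteC κ k).natDegree = k := by
  have hs : (Real.sqrt (2 * κ) : ℂ) ≠ 0 := by
    rw [Complex.ofReal_ne_zero]; exact (Real.sqrt_pos.2 (by positivity)).ne'
  rw [hermiteC, natDegree_comp, natDegree_C_mul_X _ hs, mul_one,
    natDegree_map_eq_of_injective (Int.cast_injective), natDegree_hermite]

theorem hermiteC_ne_zero {κ : ℝ} (hκ : 0 < κ) (k : ℕ) : hermiteC κ k ≠ 0 := by
  cases k with
  | zero => simp [hermiteC]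
  | succ k =>
    intro h
    have := natDegree_hermiteC hκ (k + 1)
    simp [h] at this

theorem integral_gaussPoly_derivative_sub {z : ℂ} (hz : 0 < z.re) (P : ℂ[X]) :
    ∫ y, gaussPoly z (derivative P - C (2 * z) * X * P) y = 0 :=
  integral_eq_zero_of_hasDerivAt_of_integrable (hasDerivAt_gaussPoly z P)
    (integrable_gaussPoly hz _) (integrable_gaussPoly hz _)

/-- Induction by parts: the total derivative of `hermiteC κ k * Q` times the Gaussian integrates to
zero, which trades one Hermite degree for one derivative on `Q`. -/
theorem integral_hermiteC_mul_eq_zero {κ : ℝ} (hκ : 0 < κ) (k : ℕ) (Q : ℂ[X])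
    (hQ : Q.degree < k) : ∫ y, gaussPoly κ (hermiteC κ k * Q) y = 0 := by
  induction k generalizing Q with
  | zero =>
    have : Q = 0 := by
      rw [← degree_eq_bot]
      exact Nat.WithBot.lt_zero_iff.1 (by simpa using hQ)
    simp [this, gaussPoly]
  | succ k ih =>
    have hz : 0 < (κ : ℂ).re := by simpa using hκ
    have hs : (Real.sqrt (2 * κ) : ℂ) ≠ 0 := by
      rw [Complex.ofReal_ne_zero]; exact (Real.sqrt_pos.2 (by positivity)).ne'
    have h1 := integral_gaussPoly_derivative_sub hz (hermiteC κ k * Q)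
    have h2 : derivative (hermiteC κ k * Q) - C (2 * κ : ℂ) * X * (hermiteC κ k * Q)
        = C (-Real.sqrt (2 * κ) : ℂ) * (hermiteC κ (k + 1) * Q)
          + hermiteC κ k * derivative Q := by
      rw [derivative_mul, C_neg]
      linear_combination Q * hermiteC_succ hκ k
    have h3 : ∀ y, gaussPoly κ (C (-Real.sqrt (2 * κ) : ℂ) * (hermiteC κ (k + 1) * Q)
          + hermiteC κ k * derivative Q) y = (-Real.sqrt (2 * κ) : ℂ) *
          gaussPoly κ (hermiteC κ (k + 1) * Q) y + gaussPoly κ (hermiteC κ k * derivative Q) y := by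
      intro y
      simp only [gaussPoly, eval_add, eval_mul, eval_C]
      ring
    rw [h2] at h1
    simp only [h3] at h1
    rw [integral_add ((integrable_gaussPoly hz _).const_mul _) (integrable_gaussPoly hz _),
      integral_const_mul, ih, add_zero] at h1
    · exact (mul_eq_zero.1 h1).resolve_left (neg_ne_zero.2 hs)
    · by_cases h0 : Q = 0
      · simp [h0]
      · refine (degree_derivative_lt h0).trans_le ?_
        rw [degree_eq_natDegree h0] at hQ ⊢
        exact_mod_cast Nat.lt_succ_iff.1 (by exact_mod_cast hQ)

theorem conj_eval_hermiteC (κ : ℝ) (k : ℕ) (y : ℝ) :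
    conj ((hermiteC κ k).eval (y : ℂ)) = (hermiteC κ k).eval (y : ℂ) := by
  rw [hermiteC, eval_comp, eval_mul, eval_C, eval_X, ← Complex.ofReal_mul, eval_map,
    eval₂_eq_sum_range]
  simp [map_sum]

/-- For a lattice that is not rectangular the Gaussian exponent is complex; its imaginary part
cancels in the product with a conjugate, so orthogonality is that for the real weight `exp (-κ y²)`.
-/
theorem conj_gaussPoly_mul_gaussPoly {κ : ℝ} {z : ℂ} (hz : 2 * z.re = κ) (k : ℕ) (Q : ℂ[X])
    (y : ℝ) : conj (gaussPoly z (hermiteC κ k) y) * gaussPoly z Q y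
      = gaussPoly κ (hermiteC κ k * Q) y := by
  have : (κ : ℂ) = conj z + z := by
    rw [← hz, add_comm, Complex.add_conj]
  rw [gaussPoly, gaussPoly, gaussPoly, map_mul, conj_eval_hermiteC, ← Complex.exp_conj, this,
    eval_mul, map_mul, map_neg, map_pow, Complex.conj_ofReal]
  rw [mul_mul_mul_comm, ← Complex.exp_add]
  ring_nf

/-- Orthogonality of the Hermite functions. -/
theorem integral_conj_gaussPoly_hermiteC_mul {κ : ℝ} (hκ : 0 < κ) {z : ℂ} (hz : 2 * z.re = κ)
    {k l : ℕ} (hkl : k ≠ l) :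
    ∫ y, conj (gaussPoly z (hermiteC κ k) y) * gaussPoly z (hermiteC κ l) y = 0 := by
  simp only [conj_gaussPoly_mul_gaussPoly hz]
  rcases lt_or_gt_of_ne hkl with h | h
  · simp only [mul_comm (hermiteC κ k)]
    refine integral_hermiteC_mul_eq_zero hκ _ _ ?_
    rw [degree_eq_natDegree (hermiteC_ne_zero hκ _), natDegree_hermiteC hκ]
    exact_mod_cast h
  · refine integral_hermiteC_mul_eq_zero hκ _ _ ?_
    rw [degree_eq_natDegree (hermiteC_ne_zero hκ _), natDegree_hermiteC hκ]
    exact_mod_cast h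

theorem integral_conj_gaussPoly_hermiteC_self_pos {κ : ℝ} (hκ : 0 < κ) {z : ℂ} (hz : 2 * z.re = κ)
    (k : ℕ) : ∃ N : ℝ, 0 < N ∧
      ∫ y, conj (gaussPoly z (hermiteC κ k) y) * gaussPoly z (hermiteC κ k) y = N := by
  have hz' : 0 < z.re := by linarith
  have hc : Continuous fun y => ‖gaussPoly z (hermiteC κ k) y‖ ^ 2 :=
    (continuous_gaussPoly z _).norm.pow 2
  have heq : ∀ y, conj (gaussPoly z (hermiteC κ k) y) * gaussPoly z (hermiteC κ k) y
      = ((‖gaussPoly z (hermiteC κ k) y‖ ^ 2 : ℝ) : ℂ) := by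
    intro y
    rw [mul_comm, Complex.mul_conj, Complex.normSq_eq_norm_sq]
  refine ⟨∫ y, ‖gaussPoly z (hermiteC κ k) y‖ ^ 2, ?_, ?_⟩
  · have hint : Integrable fun y => ‖gaussPoly z (hermiteC κ k) y‖ ^ 2 := by
      have h1 : Integrable (gaussPoly κ (hermiteC κ k * hermiteC κ k)) :=
        integrable_gaussPoly (by simpa using hκ) _
      refine h1.norm.congr (ae_of_all _ fun y => ?_)
      simp only
      rw [← conj_gaussPoly_mul_gaussPoly hz, heq]
      simp
    have hroots : {y : ℝ | (hermiteC κ k).eval (y : ℂ) = 0}.Finite := by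
      refine Set.Finite.preimage (f := fun y : ℝ => (y : ℂ)) (s := {w | (hermiteC κ k).IsRoot w})
        Complex.ofReal_injective.injOn (finite_setOfPred_isRoot (hermiteC_ne_zero hκ k))
    obtain ⟨y, hy⟩ := hroots.infinite_compl.nonempty
    refine integral_pos_of_integrable_nonneg_nonzero (x := y) hc hint (fun y => by positivity) ?_
    have : (hermiteC κ k).eval (y : ℂ) ≠ 0 := hy
    simp [gaussPoly, this]
  · simp only [heq]
    exact integral_ofReal

end BdG

namespace BdG

open Polynomial Filter Topology

/-! ### Coordinates of the cell -/

/-- Lebesgue measure on the unit interval. -/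
noncomputable def unitVol : Measure ℝ := volume.restrict (Set.Ico 0 1)

/-- Lebesgue measure on the unit square. -/
noncomputable def sqVol : Measure (ℝ × ℝ) := unitVol.prod unitVol

/-- Lebesgue measure on the strip `[0, 1) × ℝ`. -/
noncomputable def stripVol : Measure (ℝ × ℝ) := unitVol.prod volume

instance : IsProbabilityMeasure unitVol := ⟨by simp [unitVol]⟩
instance : IsProbabilityMeasure sqVol := by unfold sqVol; infer_instance

theorem volume_eq_sum_map_unitVol :
    (volume : Measure ℝ) = Measure.sum fun m : ℤ => unitVol.map fun t : ℝ => t + (m : ℝ) := by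
  have h : ∀ m : ℤ, unitVol.map (fun t : ℝ => t + (m : ℝ)) = volume.restrict (Set.Ico (m : ℝ) (m + 1)) := by
    intro m
    have h1 := (measurableEmbedding_addRight (m : ℝ)).restrict_map volume
      (Set.Ico (m : ℝ) (m + 1))
    rw [map_add_right_eq_self] at h1
    rw [h1]
    simp [unitVol]
  simp only [h]
  rw [← Measure.restrict_iUnion _ fun _ => measurableSet_Ico, iUnion_Ico_intCast,
    Measure.restrict_univ]
  exact Set.pairwise_disjoint_Ico_intCast ℝ

theorem measurableEmbedding_shift (m : ℤ) :
    MeasurableEmbedding fun p : ℝ × ℝ => (p.1, p.2 + (m : ℝ)) :=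
  MeasurableEmbedding.id.prodMap (measurableEmbedding_addRight (m : ℝ))

theorem stripVol_eq_sum :
    stripVol = Measure.sum fun m : ℤ => sqVol.map fun p => (p.1, p.2 + (m : ℝ)) := by
  have hsf : ∀ m : ℤ, SFinite (unitVol.map fun t : ℝ => t + (m : ℝ)) := fun m => inferInstance
  rw [stripVol, volume_eq_sum_map_unitVol, Measure.prod_sum_right]
  congr 1
  ext1 m
  have := Measure.map_prod_map unitVol unitVol measurable_id (measurable_add_const (m : ℝ))
  rw [Measure.map_id] at this
  exact this

theorem ae_sqVol_mem : ∀ᵐ p ∂sqVol, p.1 ∈ Set.Ico (0 : ℝ) 1 ∧ p.2 ∈ Set.Ico (0 : ℝ) 1 := by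
  rw [sqVol, unitVol, Measure.prod_restrict]
  exact ae_restrict_mem (measurableSet_Ico.prod measurableSet_Ico)

namespace Cell

variable (X : Cell)

theorem area_pos : 0 < X.area := div_pos X.τ_im_pos (pow_pos X.δ_pos 2)

theorem b_pos : 0 < X.b := by
  have := X.area_pos
  have : (0 : ℝ) < X.n := by exact_mod_cast X.n_pos
  unfold b
  positivity

/-- The linear map with `coord (s, t) = s ω₁ + t ω₂`. -/
noncomputable def coord : (ℝ × ℝ) ≃ₗ[ℝ] (ℝ × ℝ) where
  toFun p := X.point p.1 p.2
  map_add' p q := by ext <;> simp [point] <;> ring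
  map_smul' a p := by ext <;> simp [point] <;> ring
  invFun x := (X.δ * x.1 - X.δ * x.2 / X.τ.im * X.τ.re, X.δ * x.2 / X.τ.im)
  left_inv p := by
    have := X.δ_pos.ne'
    have := X.τ_im_pos.ne'
    ext
    · simp [point]; field_simp; ring
    · simp [point]; field_simp
  right_inv p := by
    have := X.δ_pos.ne'
    have := X.τ_im_pos.ne'
    ext
    · simp [point]; field_simp
    · simp [point]; field_simp

theorem coord_apply (p : ℝ × ℝ) : X.coord p = X.point p.1 p.2 := rfl

theorem continuous_coord : Continuous X.coord := X.coord.toLinearMap.continuous_of_finiteDimensional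

theorem measurableEmbedding_coord : MeasurableEmbedding X.coord :=
  X.coord.toContinuousLinearEquiv.toHomeomorph.measurableEmbedding

theorem det_coord : LinearMap.det (X.coord : (ℝ × ℝ) →ₗ[ℝ] ℝ × ℝ) = X.area := by
  have := X.δ_pos.ne'
  rw [← LinearMap.det_toMatrix (Module.Basis.finTwoProd ℝ), Matrix.det_fin_two]
  simp [LinearMap.toMatrix_apply, coord_apply, point, area]
  field_simp

theorem vol_eq : X.vol = ENNReal.ofReal X.area • sqVol.map X.coord := by
  have h1 : volume.map X.coord = ENNReal.ofReal X.area⁻¹ • (volume : Measure (ℝ × ℝ)) := by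
    have := Measure.map_linearMap_addHaar_eq_smul_addHaar (volume : Measure (ℝ × ℝ))
      (f := (X.coord : (ℝ × ℝ) →ₗ[ℝ] ℝ × ℝ)) (by rw [det_coord]; exact X.area_pos.ne')
    rw [det_coord, abs_of_pos (inv_pos.2 X.area_pos)] at this
    exact this
  have h2 : X.coord ⁻¹' X.Ω = Set.Ico 0 1 ×ˢ Set.Ico 0 1 := by
    ext p
    constructor
    · rintro ⟨m, hm, k, hk, h⟩
      have : p = (m, k) := X.coord.injective h
      rw [this]
      exact ⟨hm, hk⟩
    · rintro ⟨h1, h2⟩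
      exact ⟨p.1, h1, p.2, h2, rfl⟩
  have h3 := X.measurableEmbedding_coord.restrict_map (volume : Measure (ℝ × ℝ)) X.Ω
  rw [h1, h2, Measure.restrict_smul] at h3
  rw [sqVol, unitVol, Measure.prod_restrict, ← Measure.volume_eq_prod, ← h3, smul_smul,
    ← ENNReal.ofReal_mul X.area_pos.le, mul_inv_cancel₀ X.area_pos.ne']
  simp [vol]

instance : IsFiniteMeasure X.vol := by
  rw [vol_eq]
  have : IsFiniteMeasure (sqVol.map X.coord) := inferInstance
  exact Measure.smul_finite _ ENNReal.ofReal_ne_top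

theorem integral_vol {E : Type*} [NormedAddCommGroup E] [NormedSpace ℝ E] (f : ℝ × ℝ → E) :
    ∫ x, f x ∂X.vol = X.area • ∫ p, f (X.coord p) ∂sqVol := by
  rw [vol_eq, integral_smul_measure, X.measurableEmbedding_coord.integral_map,
    ENNReal.toReal_ofReal X.area_pos.le]

theorem ae_vol_iff {q : ℝ × ℝ → Prop} : (∀ᵐ x ∂X.vol, q x) ↔ ∀ᵐ p ∂sqVol, q (X.coord p) := by
  rw [vol_eq, ae_iff, ae_iff, Measure.smul_apply, smul_eq_mul, mul_eq_zero,
    X.measurableEmbedding_coord.map_apply]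
  simp [X.area_pos]

theorem memLp_vol_iff {f : ℝ × ℝ → ℂ} {p : ℝ≥0∞} :
    MemLp f p X.vol ↔ MemLp (fun q => f (X.coord q)) p sqVol := by
  rw [← Function.comp_def, ← X.measurableEmbedding_coord.memLp_map_measure_iff, vol_eq]
  constructor
  · intro h
    have := h.smul_measure (c := (ENNReal.ofReal X.area)⁻¹) (by simp [X.area_pos])
    rw [smul_smul, ENNReal.inv_mul_cancel (by simp [X.area_pos]) ENNReal.ofReal_ne_top,
      one_smul] at this
    exact this
  · intro h
    exact h.smul_measure ENNReal.ofReal_ne_top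

theorem inner_eq_integral (f g : X.H) :
    ⟪f, g⟫_ℂ = ∫ x, conj (f x) * g x ∂X.vol := by
  simp only [L2.inner_def, RCLike.inner_apply']

/-- `exp (i χ_s(x))` for `s = m ω₂`, a function of the first coordinate only. -/
noncomputable def phase (m : ℤ) (s : ℝ) : ℂ :=
  Complex.exp (Complex.I * ((X.c 0 m - Real.pi * X.n * m * s : ℝ) : ℂ))

theorem norm_phase (m : ℤ) (s : ℝ) : ‖X.phase m s‖ = 1 := by
  rw [phase, mul_comm, Complex.norm_exp_ofReal_mul_I]

theorem continuous_phase (m : ℤ) : Continuous (X.phase m) := by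
  unfold phase
  fun_prop

/-- Since `b |Ω| = 2 π n`, the wedge product in cell coordinates carries the factor `π n` whatever
the shape of the lattice. -/
theorem χ_coord (m k : ℤ) (p : ℝ × ℝ) :
    X.χ m k (X.coord p) = Real.pi * X.n * (m * p.2 - k * p.1) + X.c m k := by
  have := X.δ_pos.ne'
  have := X.τ_im_pos.ne'
  simp only [χ, coord_apply, point, b, area]
  field_simp
  ring

theorem Equivariant.apply_add {X : Cell} {φ : ℝ × ℝ → ℂ} (h : X.Equivariant φ) (m k : ℤ)
    (p : ℝ × ℝ) : φ (X.coord (p + ((m : ℝ), (k : ℝ))))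
      = Complex.exp (Complex.I * (X.χ m k (X.coord p) : ℂ)) * φ (X.coord p) := by
  have h1 := h m k (X.coord p)
  have h2 : X.coord (p + ((m : ℝ), (k : ℝ))) = X.coord p + X.point m k := map_add X.coord _ _
  rw [h2]
  rw [← h1, ← mul_assoc, ← Complex.exp_add]
  simp

theorem Equivariant.apply_shift {X : Cell} {φ : ℝ × ℝ → ℂ} (h : X.Equivariant φ) (m : ℤ)
    (s t : ℝ) : φ (X.coord (s, t + m)) = X.phase m s * φ (X.coord (s, t)) := by
  have := h.apply_add 0 m (s, t)
  simp only [Prod.mk_add_mk, Int.cast_zero, add_zero] at this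
  rw [this, χ_coord, phase]
  congr 3
  push_cast
  ring_nf

theorem Equivariant.apply_period {X : Cell} {φ : ℝ × ℝ → ℂ} (h : X.Equivariant φ)
    (s t : ℝ) : φ (X.coord (s + 1, t)) =
      Complex.exp (Complex.I * ((Real.pi * X.n * t + X.c 1 0 : ℝ) : ℂ)) * φ (X.coord (s, t)) := by
  have := h.apply_add 1 0 (s, t)
  simp only [Prod.mk_add_mk, Int.cast_zero, Int.cast_one, add_zero] at this
  rw [this, χ_coord]
  simp

/-! ### Sums over translates -/

/-- The sum `∑_m exp (-i χ_{m ω₂}) e(· + m ω₂)` over the translates of a function on the strip. -/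
noncomputable def periodize (e : ℝ × ℝ → ℂ) (p : ℝ × ℝ) : ℂ :=
  ∑' m : ℤ, conj (X.phase m p.1) * e (p.1, p.2 + m)

/-- The bound by which the translates of a function on the strip are summable. -/
def Decays (e : ℝ × ℝ → ℂ) : Prop := ∃ C : ℝ, 0 ≤ C ∧ ∀ p, ‖e p‖ ≤ C * Real.exp (-|p.2|)

theorem summable_exp_neg_abs_int : Summable fun m : ℤ => Real.exp (-|(m : ℝ)|) := by
  refine Summable.of_nat_of_neg ?_ ?_ <;> simpa using Real.summable_exp_neg_nat

theorem exp_neg_abs_add_le {t : ℝ} (ht : t ∈ Set.Ico (0 : ℝ) 1) (m : ℤ) :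
    Real.exp (-|t + m|) ≤ Real.exp 1 * Real.exp (-|(m : ℝ)|) := by
  rw [← Real.exp_add, Real.exp_le_exp]
  have h1 : |(m : ℝ)| ≤ |t + m| + |t| := by
    have := abs_sub (t + m) t
    simpa using this
  rw [abs_of_nonneg ht.1] at h1
  linarith [ht.2]

variable {X}

theorem Decays.norm_shift_le {e : ℝ × ℝ → ℂ} {C : ℝ} (hC : 0 ≤ C)
    (h : ∀ p, ‖e p‖ ≤ C * Real.exp (-|p.2|)) {p : ℝ × ℝ} (hp : p.2 ∈ Set.Ico (0 : ℝ) 1) (m : ℤ) :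
    ‖e (p.1, p.2 + m)‖ ≤ C * (Real.exp 1 * Real.exp (-|(m : ℝ)|)) :=
  (h _).trans (mul_le_mul_of_nonneg_left (exp_neg_abs_add_le hp m) hC)

theorem summable_majorant (C : ℝ) :
    Summable fun m : ℤ => C * (Real.exp 1 * Real.exp (-|(m : ℝ)|)) :=
  (summable_exp_neg_abs_int.mul_left _).mul_left _

theorem Decays.summable {e : ℝ × ℝ → ℂ} (h : Decays e) {p : ℝ × ℝ}
    (hp : p.2 ∈ Set.Ico (0 : ℝ) 1) :
    Summable fun m : ℤ => conj (X.phase m p.1) * e (p.1, p.2 + m) := by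
  obtain ⟨C, hC, h⟩ := h
  refine (summable_majorant C).of_norm_bounded fun m => ?_
  rw [norm_mul, RCLike.norm_conj, norm_phase, one_mul]
  exact Decays.norm_shift_le hC h hp m

theorem Decays.exists_norm_periodize_le {e : ℝ × ℝ → ℂ} (h : Decays e) :
    ∃ K : ℝ, ∀ p : ℝ × ℝ, p.2 ∈ Set.Ico (0 : ℝ) 1 → ‖X.periodize e p‖ ≤ K := by
  obtain ⟨C, hC, h⟩ := h
  refine ⟨_, fun p hp => tsum_of_norm_bounded (summable_majorant C).hasSum fun m => ?_⟩
  rw [norm_mul, RCLike.norm_conj, norm_phase, one_mul]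
  exact Decays.norm_shift_le hC h hp m

theorem measurable_periodize {e : ℝ × ℝ → ℂ} (he : Continuous e) : Measurable (X.periodize e) := by
  refine Measurable.tsum fun m => ?_
  have := X.continuous_phase m
  exact (by fun_prop : Continuous fun p : ℝ × ℝ =>
    conj (X.phase m p.1) * e (p.1, p.2 + m)).measurable

theorem memLp_periodize {e : ℝ × ℝ → ℂ} (he : Continuous e) (h : Decays e) (q : ℝ≥0∞) :
    MemLp (X.periodize e) q sqVol := by
  obtain ⟨K, hK⟩ := h.exists_norm_periodize_le (X := X)
  refine MemLp.of_bound (measurable_periodize he).aestronglyMeasurable K ?_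
  filter_upwards [ae_sqVol_mem] with p hp
  exact hK p hp.2

theorem unfold_aux {e f F : ℝ × ℝ → ℂ} (m : ℤ)
    (hF : ∀ p : ℝ × ℝ, p.2 ∈ Set.Ico (0 : ℝ) 1 → ∀ m : ℤ,
      F (p.1, p.2 + m) = X.phase m p.1 * f p) :
    (fun p : ℝ × ℝ => conj (e (p.1, p.2 + m)) * F (p.1, p.2 + m)) =ᵐ[sqVol]
      fun p => conj (e (p.1, p.2 + m)) * X.phase m p.1 * f p := by
  filter_upwards [ae_sqVol_mem] with p hp
  rw [hF p hp.2 m, mul_assoc]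

theorem integrable_unfold_term {e f : ℝ × ℝ → ℂ} (he : Continuous e) (hf : Integrable f sqVol)
    {C : ℝ} (hC : 0 ≤ C) (h : ∀ p, ‖e p‖ ≤ C * Real.exp (-|p.2|)) (m : ℤ) :
    Integrable (fun p => conj (e (p.1, p.2 + m)) * X.phase m p.1 * f p) sqVol ∧
      ∫ p, ‖conj (e (p.1, p.2 + m)) * X.phase m p.1 * f p‖ ∂sqVol
        ≤ C * (Real.exp 1 * Real.exp (-|(m : ℝ)|)) * ∫ p, ‖f p‖ ∂sqVol := by
  have hb : ∀ᵐ p : ℝ × ℝ ∂sqVol, ‖conj (e (p.1, p.2 + m)) * X.phase m p.1 * f p‖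
      ≤ C * (Real.exp 1 * Real.exp (-|(m : ℝ)|)) * ‖f p‖ := by
    filter_upwards [ae_sqVol_mem] with p hp
    rw [norm_mul, norm_mul, RCLike.norm_conj, norm_phase, mul_one]
    gcongr
    exact Decays.norm_shift_le hC h hp.2 m
  have hc := X.continuous_phase m
  have hi : Integrable (fun p => conj (e (p.1, p.2 + m)) * X.phase m p.1 * f p) sqVol :=
    (hf.norm.const_mul _).mono' ((by fun_prop : Continuous fun p : ℝ × ℝ =>
      conj (e (p.1, p.2 + m)) * X.phase m p.1).aestronglyMeasurable.mul hf.1) hb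
  refine ⟨hi, ?_⟩
  rw [← integral_const_mul]
  exact integral_mono_ae hi.norm (hf.norm.const_mul _) hb

theorem integrable_unfold {e f F : ℝ × ℝ → ℂ} (he : Continuous e) (hd : Decays e)
    (hf : Integrable f sqVol)
    (hF : ∀ p : ℝ × ℝ, p.2 ∈ Set.Ico (0 : ℝ) 1 → ∀ m : ℤ,
      F (p.1, p.2 + m) = X.phase m p.1 * f p) :
    Integrable (fun p => conj (e p) * F p) stripVol := by
  obtain ⟨C, hC, h⟩ := hd
  rw [stripVol_eq_sum]
  refine integrable_sum_measure (fun m => ?_) ?_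
  · rw [(measurableEmbedding_shift m).integrable_map_iff]
    exact (integrable_unfold_term (X := X) he hf hC h m).1.congr (unfold_aux m hF).symm
  · refine Summable.of_nonneg_of_le (fun m => integral_nonneg fun _ => norm_nonneg _) (fun m => ?_)
      ((summable_majorant C).mul_right (∫ p, ‖f p‖ ∂sqVol))
    rw [(measurableEmbedding_shift m).integral_map]
    refine le_of_eq_of_le (integral_congr_ae ?_) (integrable_unfold_term (X := X) he hf hC h m).2
    filter_upwards [unfold_aux (e := e) m hF] with p hp
    rw [hp]

/-- Unfolding: the translates of the unit square tile the strip, and the phases in the periodized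
sum are those acquired by `F` under translation. Decay of `e` justifies exchanging sum and integral.
-/
theorem integral_conj_periodize_mul {e f F : ℝ × ℝ → ℂ} (he : Continuous e) (hd : Decays e)
    (hf : Integrable f sqVol)
    (hF : ∀ p : ℝ × ℝ, p.2 ∈ Set.Ico (0 : ℝ) 1 → ∀ m : ℤ,
      F (p.1, p.2 + m) = X.phase m p.1 * f p) :
    ∫ p, conj (X.periodize e p) * f p ∂sqVol = ∫ p, conj (e p) * F p ∂stripVol := by
  have hint := integrable_unfold he hd hf hF
  obtain ⟨C, hC, h⟩ := hd
  have h1 : HasSum (fun m : ℤ => ∫ p, conj (e (p.1, p.2 + m)) * X.phase m p.1 * f p ∂sqVol)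
      (∫ p, ∑' m : ℤ, conj (e (p.1, p.2 + m)) * X.phase m p.1 * f p ∂sqVol) := by
    refine hasSum_integral_of_summable_integral_norm
      (fun m => (integrable_unfold_term he hf hC h m).1) ?_
    exact Summable.of_nonneg_of_le (fun m => integral_nonneg fun _ => norm_nonneg _)
      (fun m => (integrable_unfold_term he hf hC h m).2)
      ((summable_majorant C).mul_right (∫ p, ‖f p‖ ∂sqVol))
  have h2 : ∫ p, conj (e p) * F p ∂stripVol
      = ∑' m : ℤ, ∫ p, conj (e (p.1, p.2 + m)) * X.phase m p.1 * f p ∂sqVol := by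
    rw [stripVol_eq_sum] at hint ⊢
    rw [integral_sum_measure hint]
    congr 1
    ext1 m
    rw [(measurableEmbedding_shift m).integral_map]
    exact integral_congr_ae (unfold_aux m hF)
  rw [h2, h1.tsum_eq]
  refine integral_congr_ae (ae_of_all _ fun p => ?_)
  simp only [periodize]
  rw [Complex.conj_tsum, tsum_mul_right]
  congr 2
  ext m
  rw [map_mul, Complex.conj_conj, mul_comm]

end Cell

end BdG

/-! ### Integration by parts on the strip -/

namespace BdG

open Polynomial Filter Topology

namespace Cell

theorem Decays.integrable_slice {e : ℝ × ℝ → ℂ} (he : Continuous e) (h : Decays e) (s : ℝ) :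
    Integrable fun t => e (s, t) := by
  obtain ⟨C, -, h⟩ := h
  exact (integrable_exp_neg_abs.const_mul C).mono'
    (by fun_prop : Continuous fun t => e (s, t)).aestronglyMeasurable (ae_of_all _ fun t => h _)

theorem Decays.integrable_strip {e : ℝ × ℝ → ℂ} (he : Continuous e) (h : Decays e) :
    Integrable e stripVol := by
  obtain ⟨C, -, h⟩ := h
  have h1 : Integrable (fun p : ℝ × ℝ => (1 : ℝ) * (C * Real.exp (-|p.2|))) stripVol :=
    Integrable.mul_prod (integrable_const _) (integrable_exp_neg_abs.const_mul C)
  refine h1.mono' he.aestronglyMeasurable (ae_of_all _ fun p => ?_)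
  simpa using h p

theorem Decays.add {e e' : ℝ × ℝ → ℂ} (h : Decays e) (h' : Decays e') :
    Decays fun p => e p + e' p := by
  obtain ⟨C, hC, h⟩ := h
  obtain ⟨C', hC', h'⟩ := h'
  refine ⟨C + C', by positivity, fun p => ?_⟩
  rw [add_mul]
  exact (norm_add_le _ _).trans (add_le_add (h p) (h' p))

theorem Decays.const_mul {e : ℝ × ℝ → ℂ} (h : Decays e) (a : ℂ) : Decays fun p => a * e p := by
  obtain ⟨C, hC, h⟩ := h
  refine ⟨‖a‖ * C, by positivity, fun p => ?_⟩
  rw [norm_mul, mul_assoc]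
  gcongr
  exact h p

theorem Decays.conj_mul {e f : ℝ × ℝ → ℂ} (h : Decays e) {K : ℝ} (hf : ∀ p, ‖f p‖ ≤ K) :
    Decays fun p => conj (e p) * f p := by
  obtain ⟨C, hC, h⟩ := h
  have hK : 0 ≤ K := (norm_nonneg _).trans (hf 0)
  refine ⟨C * K, by positivity, fun p => ?_⟩
  rw [norm_mul, RCLike.norm_conj]
  calc _ ≤ C * Real.exp (-|p.2|) * K := mul_le_mul (h p) (hf p) (norm_nonneg _) (by positivity)
    _ = _ := by ring

/-- The boundary terms at the two edges of the strip cancel by periodicity. In the other direction,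
`integral_strip_snd_deriv`, they vanish by decay. -/
theorem integral_strip_fst_deriv {W W' : ℝ × ℝ → ℂ} (hW' : Continuous W') (hd : Decays W')
    (h : ∀ s t, HasDerivAt (fun s => W (s, t)) (W' (s, t)) s)
    (hper : ∀ s t, W (s + 1, t) = W (s, t)) : ∫ p, W' p ∂stripVol = 0 := by
  rw [stripVol, integral_prod_symm _ (hd.integrable_strip hW')]
  refine integral_eq_zero_of_ae (ae_of_all _ fun t => ?_)
  simp only [Pi.zero_apply, unitVol]
  rw [integral_Ico_eq_integral_Ioc, ← intervalIntegral.integral_of_le zero_le_one,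
    intervalIntegral.integral_eq_sub_of_hasDerivAt (fun s _ => h s t)
      ((by fun_prop : Continuous fun s => W' (s, t)).intervalIntegrable _ _)]
  have := hper 0 t
  rw [zero_add] at this
  rw [this, sub_self]

theorem integral_strip_snd_deriv {W W' : ℝ × ℝ → ℂ} (hW : Continuous W) (hd : Decays W)
    (hW' : Continuous W') (hd' : Decays W')
    (h : ∀ s t, HasDerivAt (fun t => W (s, t)) (W' (s, t)) t) : ∫ p, W' p ∂stripVol = 0 := by
  rw [stripVol, integral_prod _ (hd'.integrable_strip hW')]
  refine integral_eq_zero_of_ae (ae_of_all _ fun s => ?_)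
  exact integral_eq_zero_of_hasDerivAt_of_integrable (h s) (hd'.integrable_slice hW' s)
    (hd.integrable_slice hW s)

variable (X : Cell)

/-! ### Plane waves times Gaussians -/

/-- The exponent of the Gaussian factor of the eigenfunctions. -/
noncomputable def gaussExp : ℂ := Real.pi * X.n * (X.τ.im - Complex.I * X.τ.re)

/-- The inverse square of the magnetic length, in the coordinate `t`. -/
noncomputable def kap : ℝ := 2 * Real.pi * X.n * X.τ.im

/-- The center of the Gaussian in the `j`-th wave. -/
noncomputable def center (j : ℕ) : ℝ := (X.c 1 0 / (2 * Real.pi) + j) / X.n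

/-- The restriction to the strip of a plane wave in the first coordinate times a polynomial and a
Gaussian in the second one. -/
noncomputable def wave (j : ℕ) (P : ℂ[X]) (p : ℝ × ℝ) : ℂ :=
  Complex.exp (Complex.I * (((Real.pi * X.n * p.2 + X.c 1 0 + 2 * Real.pi * j) * p.1 : ℝ) : ℂ))
    * gaussPoly X.gaussExp P (p.2 + X.center j)

theorem n_cast_pos : (0 : ℝ) < X.n := by exact_mod_cast X.n_pos

theorem kap_pos : 0 < X.kap := by
  have := X.n_cast_pos
  have := X.τ_im_pos
  unfold kap
  positivity

theorem two_mul_gaussExp_re : 2 * X.gaussExp.re = X.kap := by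
  simp [gaussExp, kap]
  ring

theorem gaussExp_re_pos : 0 < X.gaussExp.re := by
  have := X.kap_pos
  rw [← two_mul_gaussExp_re] at this
  linarith

theorem continuous_wave (j : ℕ) (P : ℂ[X]) : Continuous (X.wave j P) := by
  have := continuous_gaussPoly X.gaussExp P
  unfold wave
  fun_prop

theorem norm_wave (j : ℕ) (P : ℂ[X]) (p : ℝ × ℝ) :
    ‖X.wave j P p‖ = ‖gaussPoly X.gaussExp P (p.2 + X.center j)‖ := by
  rw [wave, norm_mul, mul_comm Complex.I, Complex.norm_exp_ofReal_mul_I, one_mul]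

theorem decays_wave (j : ℕ) (P : ℂ[X]) : Decays (X.wave j P) := by
  obtain ⟨C, hC, h⟩ := exists_norm_gaussPoly_le X.gaussExp_re_pos P 1
  refine ⟨C * Real.exp |X.center j|, by positivity, fun p => ?_⟩
  rw [norm_wave, mul_assoc, ← Real.exp_add]
  refine (h _).trans (mul_le_mul_of_nonneg_left (Real.exp_le_exp.2 ?_) hC)
  have := abs_sub_abs_le_abs_sub p.2 (-X.center j)
  rw [abs_neg, sub_neg_eq_add] at this
  linarith

theorem wave_add (j : ℕ) (P Q : ℂ[X]) (p : ℝ × ℝ) :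
    X.wave j (P + Q) p = X.wave j P p + X.wave j Q p := by
  simp only [wave, gaussPoly, eval_add]
  ring

theorem wave_C_mul (j : ℕ) (a : ℂ) (P : ℂ[X]) (p : ℝ × ℝ) :
    X.wave j (C a * P) p = a * X.wave j P p := by
  simp only [wave, gaussPoly, eval_mul, eval_C]
  ring

theorem wave_X_mul (j : ℕ) (P : ℂ[X]) (p : ℝ × ℝ) :
    X.wave j (Polynomial.X * P) p = ((p.2 + X.center j : ℝ) : ℂ) * X.wave j P p := by
  simp only [wave, gaussPoly, eval_mul, eval_X]
  ring

/-- The multiplier is that of `Equivariant.apply_period`, because `j` is an integer; hence a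
conjugated wave times an equivariant function is 1-periodic in `s`, as `integral_strip_fst_deriv`
requires. -/
theorem wave_period (j : ℕ) (P : ℂ[X]) (s t : ℝ) :
    X.wave j P (s + 1, t)
      = Complex.exp (Complex.I * ((Real.pi * X.n * t + X.c 1 0 : ℝ) : ℂ)) * X.wave j P (s, t) := by
  simp only [wave]
  rw [← mul_assoc, ← Complex.exp_add]
  congr 1
  rw [Complex.exp_eq_exp_iff_exists_int]
  refine ⟨j, ?_⟩
  push_cast
  ring

theorem hasDerivAt_wave_fst (j : ℕ) (P : ℂ[X]) (s t : ℝ) :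
    HasDerivAt (fun s => X.wave j P (s, t)) (Complex.I *
      ((Real.pi * X.n * t + X.c 1 0 + 2 * Real.pi * j : ℝ) : ℂ) * X.wave j P (s, t)) s := by
  have h1 : HasDerivAt (fun s : ℝ => Complex.I *
      (((Real.pi * X.n * t + X.c 1 0 + 2 * Real.pi * j) * s : ℝ) : ℂ))
      (Complex.I * ((Real.pi * X.n * t + X.c 1 0 + 2 * Real.pi * j : ℝ) : ℂ)) s := by
    refine HasDerivAt.const_mul _ (HasDerivAt.ofReal_comp ?_)
    simpa using (hasDerivAt_id s).const_mul (Real.pi * X.n * t + X.c 1 0 + 2 * Real.pi * j)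
  refine (h1.cexp.mul_const (gaussPoly X.gaussExp P (t + X.center j))).congr_deriv ?_
  simp only [wave]
  ring

theorem hasDerivAt_wave_snd (j : ℕ) (P : ℂ[X]) (s t : ℝ) :
    HasDerivAt (fun t => X.wave j P (s, t)) (Complex.I * ((Real.pi * X.n * s : ℝ) : ℂ) *
      X.wave j P (s, t) +
        X.wave j (derivative P - C (2 * X.gaussExp) * Polynomial.X * P) (s, t)) t := by
  have h1 : HasDerivAt (fun t : ℝ => Complex.I *
      (((Real.pi * X.n * t + X.c 1 0 + 2 * Real.pi * j) * s : ℝ) : ℂ))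
      (Complex.I * ((Real.pi * X.n * s : ℝ) : ℂ)) t := by
    refine HasDerivAt.const_mul _ (HasDerivAt.ofReal_comp ?_)
    simpa using ((((hasDerivAt_id t).const_mul (Real.pi * X.n)).add_const (X.c 1 0)).add_const
      (2 * Real.pi * j)).mul_const s
  have h2 := (hasDerivAt_gaussPoly X.gaussExp P (t + X.center j)).comp_add_const t (X.center j)
  refine (h1.cexp.mul h2).congr_deriv ?_
  simp only [wave]
  ring

/-! ### Smooth equivariant functions -/

variable {X}

theorem Equivariant.exists_norm_le {φ : ℝ × ℝ → ℂ} (h : X.Equivariant φ) (hc : Continuous φ) :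
    ∃ K : ℝ, ∀ p, ‖φ (X.coord p)‖ ≤ K := by
  obtain ⟨K, hK⟩ := ((isCompact_Icc (a := (0 : ℝ)) (b := 1)).prod
    (isCompact_Icc (a := (0 : ℝ)) (b := 1))).exists_bound_of_continuousOn
    (f := fun p => φ (X.coord p)) (hc.comp X.continuous_coord).continuousOn
  refine ⟨K, fun p => ?_⟩
  have h1 := h.apply_add ⌊p.1⌋ ⌊p.2⌋ (Int.fract p.1, Int.fract p.2)
  have h2 : (Int.fract p.1, Int.fract p.2) + ((⌊p.1⌋ : ℝ), (⌊p.2⌋ : ℝ)) = p := by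
    ext <;> simp [Int.fract_add_floor]
  rw [h2] at h1
  rw [h1, norm_mul, mul_comm Complex.I, Complex.norm_exp_ofReal_mul_I, one_mul]
  exact hK _ ⟨⟨Int.fract_nonneg _, (Int.fract_lt_one _).le⟩,
    ⟨Int.fract_nonneg _, (Int.fract_lt_one _).le⟩⟩

theorem contDiff_D₁ {φ : ℝ × ℝ → ℂ} (hφ : ContDiff ℝ ∞ φ) : ContDiff ℝ ∞ (X.D₁ φ) := by
  have h1 : ContDiff ℝ ∞ fun x => fderiv ℝ φ x (1, 0) :=
    (hφ.fderiv_right (m := ∞) (by simp)).clm_apply contDiff_const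
  have h2 : ContDiff ℝ ∞ fun x : ℝ × ℝ => ((-(X.b / 2) * x.2 : ℝ) : ℂ) :=
    Complex.ofRealCLM.contDiff.comp (contDiff_const.mul contDiff_snd)
  exact h1.sub ((contDiff_const.mul h2).mul hφ)

theorem contDiff_D₂ {φ : ℝ × ℝ → ℂ} (hφ : ContDiff ℝ ∞ φ) : ContDiff ℝ ∞ (X.D₂ φ) := by
  have h1 : ContDiff ℝ ∞ fun x => fderiv ℝ φ x (0, 1) :=
    (hφ.fderiv_right (m := ∞) (by simp)).clm_apply contDiff_const
  have h2 : ContDiff ℝ ∞ fun x : ℝ × ℝ => ((X.b / 2 * x.1 : ℝ) : ℂ) :=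
    Complex.ofRealCLM.contDiff.comp (contDiff_const.mul contDiff_fst)
  exact h1.sub ((contDiff_const.mul h2).mul hφ)

/-- Obtained by differentiating the equivariance relation. The extra term is the gradient of `χ`,
which equals the change of the vector potential under the translation, so the covariant derivatives
remain equivariant. -/
theorem Equivariant.fderiv_add {φ : ℝ × ℝ → ℂ} (h : X.Equivariant φ) (hφ : Differentiable ℝ φ)
    (m k : ℤ) (x v : ℝ × ℝ) :
    Complex.exp (-(Complex.I * (X.χ m k x : ℂ))) * fderiv ℝ φ (x + X.point m k) v
      = fderiv ℝ φ x v + Complex.I * ((X.b / 2 * ((X.point m k).1 * v.2 - (X.point m k).2 * v.1)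
        : ℝ) : ℂ) * φ x := by
  set l : ℝ × ℝ →L[ℝ] ℝ := (X.b / 2) • ((X.point m k).1 • ContinuousLinearMap.snd ℝ ℝ ℝ
    - (X.point m k).2 • ContinuousLinearMap.fst ℝ ℝ ℝ) with hl
  have hχ : HasFDerivAt (X.χ m k) l x := by
    have : X.χ m k = fun y => l y + X.c m k := by
      ext y
      simp [χ, hl]
    rw [this]
    exact l.hasFDerivAt.add_const _
  have h1 : HasFDerivAt (fun y => φ (y + X.point m k)) (fderiv ℝ φ (x + X.point m k)) x :=
    (hasFDerivAt_comp_add_right _).2 (hφ _).hasFDerivAt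
  have h2 : HasFDerivAt (fun y => -(Complex.I * (X.χ m k y : ℂ)))
      (-(Complex.I • Complex.ofRealCLM.comp l)) x :=
    ((Complex.ofRealCLM.hasFDerivAt.comp x hχ).const_mul Complex.I).neg
  have h3 := h2.cexp.mul h1
  have h4 : (fun y => Complex.exp (-(Complex.I * (X.χ m k y : ℂ))) * φ (y + X.point m k)) = φ :=
    funext fun y => h m k y
  have h5 := (h3.congr_of_eventuallyEq (Eventually.of_forall fun y => (h m k y).symm)).fderiv
  rw [h5]
  have h6 := h m k x
  simp only [add_apply, smul_apply, neg_apply, ContinuousLinearMap.comp_apply, smul_eq_mul,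
    Complex.ofRealCLM_apply, hl, sub_apply, ContinuousLinearMap.coe_fst',
    ContinuousLinearMap.coe_snd']
  rw [← h6]
  push_cast
  ring

theorem Equivariant.D₁ {φ : ℝ × ℝ → ℂ} (h : X.Equivariant φ) (hφ : Differentiable ℝ φ) :
    X.Equivariant (X.D₁ φ) := by
  intro m k x
  have h1 := h.fderiv_add hφ m k x (1, 0)
  have h2 := h m k x
  simp only [Cell.D₁, mul_sub]
  rw [h1, ← h2]
  simp only [Prod.snd_add]
  push_cast
  ring

theorem Equivariant.D₂ {φ : ℝ × ℝ → ℂ} (h : X.Equivariant φ) (hφ : Differentiable ℝ φ) :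
    X.Equivariant (X.D₂ φ) := by
  intro m k x
  have h1 := h.fderiv_add hφ m k x (0, 1)
  have h2 := h m k x
  simp only [Cell.D₂, mul_sub]
  rw [h1, ← h2]
  simp only [Prod.fst_add]
  push_cast
  ring

/-- Along `ω₁` the component of the vector potential is `-π n t`, which converts the plain
derivative into `D₁`; likewise for `ω₂` below, with both covariant derivatives. -/
theorem hasDerivAt_coord_fst {φ : ℝ × ℝ → ℂ} (hφ : Differentiable ℝ φ) (s t : ℝ) :
    HasDerivAt (fun s => φ (X.coord (s, t))) ((X.δ⁻¹ : ℝ) * X.D₁ φ (X.coord (s, t))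
      - Complex.I * ((Real.pi * X.n * t : ℝ) : ℂ) * φ (X.coord (s, t))) s := by
  have h1 : HasDerivAt (fun s => X.coord (s, t)) (X.δ⁻¹ • ((1 : ℝ), (0 : ℝ))) s := by
    have h2 : (fun s => X.coord (s, t)) = fun s => s • (X.δ⁻¹ • ((1 : ℝ), (0 : ℝ)))
        + X.coord (0, t) := by
      ext s <;> simp [coord_apply, point]
      ring
    rw [h2]
    simpa using ((hasDerivAt_id s).smul_const (X.δ⁻¹ • ((1 : ℝ), (0 : ℝ)))).add_const
      (X.coord (0, t))
  have h3 := (hφ (X.coord (s, t))).hasFDerivAt.comp_hasDerivAt s h1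
  refine h3.congr_deriv ?_
  rw [map_smul]
  have h4 : (Real.pi * X.n * t : ℝ) = X.δ⁻¹ * (X.b / 2 * (X.coord (s, t)).2) := by
    have := X.δ_pos.ne'
    have := X.τ_im_pos.ne'
    simp only [coord_apply, point, b, area]
    field_simp
  rw [h4, D₁, Complex.real_smul]
  push_cast
  ring

theorem hasDerivAt_coord_snd {φ : ℝ × ℝ → ℂ} (hφ : Differentiable ℝ φ) (s t : ℝ) :
    HasDerivAt (fun t => φ (X.coord (s, t))) ((X.δ⁻¹ : ℝ) * (X.τ.re * X.D₁ φ (X.coord (s, t))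
      + X.τ.im * X.D₂ φ (X.coord (s, t)))
      + Complex.I * ((Real.pi * X.n * s : ℝ) : ℂ) * φ (X.coord (s, t))) t := by
  set w : ℝ × ℝ := X.δ⁻¹ • (X.τ.re • ((1 : ℝ), (0 : ℝ)) + X.τ.im • ((0 : ℝ), (1 : ℝ))) with hw
  have h1 : HasDerivAt (fun t => X.coord (s, t)) w t := by
    have h2 : (fun t => X.coord (s, t)) = fun t => t • w + X.coord (s, 0) := by
      ext t <;> simp [coord_apply, point, hw] <;> ring
    rw [h2]
    simpa using ((hasDerivAt_id t).smul_const w).add_const (X.coord (s, 0))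
  have h3 := (hφ (X.coord (s, t))).hasFDerivAt.comp_hasDerivAt t h1
  refine h3.congr_deriv ?_
  rw [hw, map_smul, map_add, map_smul, map_smul]
  have h4 : (Real.pi * X.n * s : ℝ) = X.δ⁻¹ * (X.b / 2 * (X.τ.im * (X.coord (s, t)).1
      - X.τ.re * (X.coord (s, t)).2)) := by
    have := X.δ_pos.ne'
    have := X.τ_im_pos.ne'
    simp only [coord_apply, point, b, area]
    field_simp
    ring
  rw [h4, D₁, D₂]
  simp only [Complex.real_smul]
  push_cast
  ring

end Cell

end BdG

namespace BdG

open Polynomial Filter Topology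

namespace Cell

variable (X : Cell)

/-! ### The weak eigenvalue equation -/

/-- The pairing of a wave with an equivariant function on the strip. -/
noncomputable def pairing (j : ℕ) (P : ℂ[X]) (φ : ℝ × ℝ → ℂ) : ℂ :=
  ∫ p, conj (X.wave j P p) * φ (X.coord p) ∂stripVol

/-- The action of the first covariant derivative on the polynomial factor of a wave. -/
noncomputable def raise₁ (P : ℂ[X]) : ℂ[X] :=
  C (2 * Real.pi * X.n * X.δ * Complex.I) * (Polynomial.X * P)

/-- The action of the second covariant derivative on the polynomial factor of a wave. -/
noncomputable def raise₂ (P : ℂ[X]) : ℂ[X] :=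
  C (X.δ / X.τ.im : ℂ) * (derivative P - C (X.kap : ℂ) * (Polynomial.X * P))

/-- This decomposition fixes the complex exponent `gaussExp`: differentiation along `ω₂` must be the
same combination of `raise₁` and `raise₂`, with weights `τ.re` and `τ.im`, as it is of `D₁` and
`D₂`. -/
theorem derivative_sub_eq_raise (P : ℂ[X]) :
    derivative P - C (2 * X.gaussExp) * Polynomial.X * P
      = C (X.δ⁻¹ * X.τ.re : ℂ) * X.raise₁ P + C (X.δ⁻¹ * X.τ.im : ℂ) * X.raise₂ P := by
  have hδ : (X.δ : ℂ) ≠ 0 := Complex.ofReal_ne_zero.2 X.δ_pos.ne'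
  have hτ : (X.τ.im : ℂ) ≠ 0 := Complex.ofReal_ne_zero.2 X.τ_im_pos.ne'
  have h1 : C (X.δ⁻¹ * X.τ.re : ℂ) * X.raise₁ P
      = C (2 * Real.pi * X.n * X.τ.re * Complex.I) * (Polynomial.X * P) := by
    rw [raise₁, ← mul_assoc, ← C_mul]
    congr 2
    push_cast
    field_simp
  have h2 : C (X.δ⁻¹ * X.τ.im : ℂ) * X.raise₂ P
      = derivative P - C (X.kap : ℂ) * (Polynomial.X * P) := by
    rw [raise₂, ← mul_assoc, ← C_mul]
    have : (X.δ⁻¹ * X.τ.im * (X.δ / X.τ.im) : ℂ) = 1 := by push_cast; field_simp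
    rw [this, C_1, one_mul]
  have h3 : C (2 * X.gaussExp) = C (X.kap : ℂ) - C (2 * Real.pi * X.n * X.τ.re * Complex.I) := by
    rw [← C_sub]
    congr 1
    simp only [gaussExp, kap]
    push_cast
    ring
  rw [h1, h2, h3]
  ring

/-- The harmonic oscillator. Since `(2πnδ)² = (δ / τ.im)² κ²`, the quadratic terms in `X` cancel,
leaving `(δ / τ.im)²` times `P'' - 2κ X P' - κ P`. On the `k`-th Hermite polynomial this is `-(2k +
1) κ P` by `hermiteC_ode`, and `(δ / τ.im)² κ = b`. -/
theorem raise_raise {k : ℕ} :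
    X.raise₁ (X.raise₁ (hermiteC X.kap k)) + X.raise₂ (X.raise₂ (hermiteC X.kap k))
      = C (-((2 * k + 1) * X.b : ℝ) : ℂ) * hermiteC X.kap k := by
  have hδ : (X.δ : ℂ) ≠ 0 := Complex.ofReal_ne_zero.2 X.δ_pos.ne'
  have hτ : (X.τ.im : ℂ) ≠ 0 := Complex.ofReal_ne_zero.2 X.τ_im_pos.ne'
  have h := hermiteC_ode X.kap_pos.le k
  have h0 : (C 2 : ℂ[X]) = 2 := map_ofNat C 2
  have h1 : C (2 * Real.pi * X.n * X.δ * Complex.I) * C (2 * Real.pi * X.n * X.δ * Complex.I)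
      = -(C (X.δ / X.τ.im : ℂ) * C (X.δ / X.τ.im : ℂ) * C (X.kap : ℂ) * C (X.kap : ℂ)) := by
    rw [← C_mul, ← C_mul, ← C_mul, ← C_mul, ← C_neg]
    congr 1
    simp only [kap]
    push_cast
    field_simp
    rw [Complex.I_sq, mul_neg_one]
  have h2 : C (-((2 * k + 1) * X.b : ℝ) : ℂ)
      = -((2 * k + 1 : ℂ[X]) * C (X.δ / X.τ.im : ℂ) * C (X.δ / X.τ.im : ℂ) * C (X.kap : ℂ)) := by
    have h3 : (2 * k + 1 : ℂ[X]) = C (2 * k + 1 : ℂ) := by simp [h0]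
    rw [h3, ← C_mul, ← C_mul, ← C_mul, ← C_neg]
    congr 1
    simp only [kap, b, area]
    push_cast
    field_simp
  have h4 : C (2 * X.kap * k : ℂ) = 2 * (k : ℂ[X]) * C (X.kap : ℂ) := by
    have : (2 * (k : ℂ[X])) = C (2 * k : ℂ) := by simp [h0]
    rw [this, ← C_mul]
    congr 1
    ring
  have h5 : C (2 * X.kap : ℂ) = 2 * C (X.kap : ℂ) := by simp [h0]
  rw [h4, h5] at h
  rw [h2]
  simp only [raise₁, raise₂, derivative_mul, derivative_sub, derivative_C, derivative_X, zero_mul,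
    zero_add, one_mul]
  linear_combination (Polynomial.X * (Polynomial.X * hermiteC X.kap k)) * h1
    + C (X.δ / X.τ.im : ℂ) * C (X.δ / X.τ.im : ℂ) * h

theorem pairing_C_mul (j : ℕ) (a : ℂ) (P : ℂ[X]) (φ : ℝ × ℝ → ℂ) :
    X.pairing j (C a * P) φ = conj a * X.pairing j P φ := by
  simp only [pairing, wave_C_mul, map_mul, mul_assoc]
  exact integral_const_mul _ _

variable {X}

theorem Equivariant.decays {φ : ℝ × ℝ → ℂ} (h : X.Equivariant φ) (hc : Continuous φ) (j : ℕ)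
    (P : ℂ[X]) : Decays fun p => conj (X.wave j P p) * φ (X.coord p) := by
  obtain ⟨K, hK⟩ := h.exists_norm_le hc
  exact (X.decays_wave j P).conj_mul hK

theorem continuous_conj_wave_mul {φ : ℝ × ℝ → ℂ} (hc : Continuous φ) (j : ℕ)
    (P : ℂ[X]) : Continuous fun p => conj (X.wave j P p) * φ (X.coord p) := by
  have h1 := X.continuous_wave j P
  have h2 := hc.comp X.continuous_coord
  exact (Complex.continuous_conj.comp h1).mul h2

theorem Equivariant.integrable {φ : ℝ × ℝ → ℂ} (h : X.Equivariant φ) (hc : Continuous φ) (j : ℕ)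
    (P : ℂ[X]) : Integrable (fun p => conj (X.wave j P p) * φ (X.coord p)) stripVol :=
  (h.decays hc j P).integrable_strip (continuous_conj_wave_mul hc j P)

theorem Equivariant.pairing_add {φ : ℝ × ℝ → ℂ} (h : X.Equivariant φ) (hc : Continuous φ) (j : ℕ)
    (P Q : ℂ[X]) : X.pairing j (P + Q) φ = X.pairing j P φ + X.pairing j Q φ := by
  rw [pairing, pairing, pairing, ← integral_add (h.integrable hc j P) (h.integrable hc j Q)]
  simp only [wave_add, map_add, add_mul]

theorem HasDerivAt.conj_comp {f : ℝ → ℂ} {f' : ℂ} {x : ℝ} (h : HasDerivAt f f' x) :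
    HasDerivAt (fun y => conj (f y)) (conj f') x :=
  Complex.conjCLE.hasFDerivAt.comp_hasDerivAt x h

/-- Integration by parts in `s`: the product of conjugated wave and `φ` is periodic, and its
derivative is the sum of the two integrands. -/
theorem Equivariant.pairing_D₁ {φ : ℝ × ℝ → ℂ} (h : X.Equivariant φ) (hφ : ContDiff ℝ ∞ φ) (j : ℕ)
    (P : ℂ[X]) : X.pairing j P (X.D₁ φ) = -X.pairing j (X.raise₁ P) φ := by
  have hd : Differentiable ℝ φ := hφ.differentiable (by simp)
  have hc' := (contDiff_D₁ (X := X) hφ).continuous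
  have he' := h.D₁ hd
  have hδ := X.δ_pos.ne'
  have hn := X.n_cast_pos.ne'
  have h0 := integral_strip_fst_deriv
    (W := fun p => conj (X.wave j P p) * φ (X.coord p))
    (W' := fun p => (X.δ⁻¹ : ℝ) * (conj (X.wave j P p) * X.D₁ φ (X.coord p)
      + conj (X.wave j (X.raise₁ P) p) * φ (X.coord p)))
    (continuous_const.mul ((continuous_conj_wave_mul hc' j P).add
      (continuous_conj_wave_mul hφ.continuous j _)))
    (((he'.decays hc' j P).add (h.decays hφ.continuous j _)).const_mul _)
    (fun s t => ?_) (fun s t => ?_)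
  · rw [integral_const_mul, mul_eq_zero, integral_add (he'.integrable hc' j P)
      (h.integrable hφ.continuous j _)] at h0
    exact eq_neg_of_add_eq_zero_left (h0.resolve_left (by simpa using hδ))
  · refine ((HasDerivAt.conj_comp (X.hasDerivAt_wave_fst j P s t)).mul
      (hasDerivAt_coord_fst hd s t)).congr_deriv ?_
    -- The Gaussian is centered where frequency and vector potential compensate, so the covariant
    -- derivative is multiplication by a multiple of `t + center j`, the variable of the polynomial.
    have h1 : Real.pi * X.n * t + X.c 1 0 + 2 * Real.pi * j
        = 2 * Real.pi * X.n * (t + X.center j) - Real.pi * X.n * t := by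
      rw [center]
      field_simp
      ring
    rw [h1, raise₁, wave_C_mul, wave_X_mul]
    simp only [map_mul, Complex.conj_ofReal, Complex.conj_I, map_ofNat, map_natCast]
    have hδ' : (X.δ : ℂ) ≠ 0 := Complex.ofReal_ne_zero.2 hδ
    push_cast
    field_simp
    ring
  · rw [wave_period, h.apply_period, map_mul, mul_mul_mul_comm, ← Complex.exp_conj,
      ← Complex.exp_add]
    simp

/-- Integration by parts in `t` produces a combination of the identities for `D₁` and `D₂`. The
first is known, and the coefficient `δ⁻¹ τ.im` of the second is nonzero. -/
theorem Equivariant.pairing_D₂ {φ : ℝ × ℝ → ℂ} (h : X.Equivariant φ) (hφ : ContDiff ℝ ∞ φ) (j : ℕ)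
    (P : ℂ[X]) : X.pairing j P (X.D₂ φ) = -X.pairing j (X.raise₂ P) φ := by
  have hd : Differentiable ℝ φ := hφ.differentiable (by simp)
  have hc := hφ.continuous
  have hc₁ := (contDiff_D₁ (X := X) hφ).continuous
  have hc₂ := (contDiff_D₂ (X := X) hφ).continuous
  have he₁ := h.D₁ hd
  have he₂ := h.D₂ hd
  have hδ := X.δ_pos.ne'
  have h0 := integral_strip_snd_deriv
    (W := fun p => conj (X.wave j P p) * φ (X.coord p))
    (W' := fun p => (X.δ⁻¹ * X.τ.re : ℝ) * (conj (X.wave j P p) * X.D₁ φ (X.coord p)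
      + conj (X.wave j (X.raise₁ P) p) * φ (X.coord p)) + (X.δ⁻¹ * X.τ.im : ℝ) *
      (conj (X.wave j P p) * X.D₂ φ (X.coord p)
      + conj (X.wave j (X.raise₂ P) p) * φ (X.coord p)))
    (continuous_conj_wave_mul hc j P) (h.decays hc j P)
    ((continuous_const.mul ((continuous_conj_wave_mul hc₁ j P).add
      (continuous_conj_wave_mul hc j _))).add
      (continuous_const.mul ((continuous_conj_wave_mul hc₂ j P).add
      (continuous_conj_wave_mul hc j _))))
    ((((he₁.decays hc₁ j P).add (h.decays hc j _)).const_mul _).add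
      (((he₂.decays hc₂ j P).add (h.decays hc j _)).const_mul _))
    (fun s t => ?_)
  · have i₁ : Integrable (fun p => conj (X.wave j P p) * X.D₁ φ (X.coord p)
        + conj (X.wave j (X.raise₁ P) p) * φ (X.coord p)) stripVol := (he₁.integrable hc₁ j P).add (h.integrable hc j (X.raise₁ P))
    have i₂ : Integrable (fun p => conj (X.wave j P p) * X.D₂ φ (X.coord p)
        + conj (X.wave j (X.raise₂ P) p) * φ (X.coord p)) stripVol := (he₂.integrable hc₂ j P).add (h.integrable hc j (X.raise₂ P))
    have e₁ : ∫ p, (conj (X.wave j P p) * X.D₁ φ (X.coord p)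
        + conj (X.wave j (X.raise₁ P) p) * φ (X.coord p)) ∂stripVol = 0 := by
      rw [integral_add (he₁.integrable hc₁ j P) (h.integrable hc j _)]
      have := h.pairing_D₁ hφ j P
      rw [pairing, pairing] at this
      rw [this, neg_add_cancel]
    rw [integral_add (i₁.const_mul _) (i₂.const_mul _)] at h0
    rw [integral_const_mul, integral_const_mul, e₁, mul_zero, zero_add, mul_eq_zero,
      integral_add (he₂.integrable hc₂ j P) (h.integrable hc j _)] at h0
    refine eq_neg_of_add_eq_zero_left (h0.resolve_left ?_)
    exact Complex.ofReal_ne_zero.2 (mul_ne_zero (inv_ne_zero hδ) X.τ_im_pos.ne')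
  · refine ((HasDerivAt.conj_comp (X.hasDerivAt_wave_snd j P s t)).mul
      (hasDerivAt_coord_snd hd s t)).congr_deriv ?_
    rw [derivative_sub_eq_raise, wave_add, wave_C_mul, wave_C_mul]
    simp only [map_mul, map_add, Complex.conj_ofReal, Complex.conj_I]
    push_cast
    ring

theorem Equivariant.pairing_magLap {φ : ℝ × ℝ → ℂ} (h : X.Equivariant φ) (hφ : ContDiff ℝ ∞ φ)
    (j k : ℕ) : X.pairing j (hermiteC X.kap k) (X.magLap φ)
      = ((2 * k + 1) * X.b : ℝ) * X.pairing j (hermiteC X.kap k) φ := by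
  have hd : Differentiable ℝ φ := hφ.differentiable (by simp)
  have h₁ := contDiff_D₁ (X := X) hφ
  have h₂ := contDiff_D₂ (X := X) hφ
  have e₁ := h.D₁ hd
  have e₂ := h.D₂ hd
  have e₁₁ := e₁.D₁ (h₁.differentiable (by simp))
  have e₂₂ := e₂.D₂ (h₂.differentiable (by simp))
  have h1 : X.pairing j (hermiteC X.kap k) (X.magLap φ)
      = -(X.pairing j (hermiteC X.kap k) (X.D₁ (X.D₁ φ))
        + X.pairing j (hermiteC X.kap k) (X.D₂ (X.D₂ φ))) := by
    rw [pairing, pairing, pairing,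
      ← integral_add (e₁₁.integrable (contDiff_D₁ h₁).continuous j _)
        (e₂₂.integrable (contDiff_D₂ h₂).continuous j _), ← integral_neg]
    simp only [magLap]
    congr 1
    ext p
    ring
  rw [h1, e₁.pairing_D₁ h₁, h.pairing_D₁ hφ, e₂.pairing_D₂ h₂, h.pairing_D₂ hφ, neg_neg, neg_neg,
    ← h.pairing_add hφ.continuous, raise_raise, pairing_C_mul]
  rw [map_neg, Complex.conj_ofReal]
  ring

variable (X)

/-! ### Landau functions -/

/-- The function on the plane obtained by summing the translates of a wave. -/
noncomputable def landauFun (j : ℕ) (P : ℂ[X]) (x : ℝ × ℝ) : ℂ :=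
  X.periodize (X.wave j P) (X.coord.symm x)

theorem landauFun_coord (j : ℕ) (P : ℂ[X]) (p : ℝ × ℝ) :
    X.landauFun j P (X.coord p) = X.periodize (X.wave j P) p := by
  rw [landauFun, LinearEquiv.symm_apply_apply]

theorem memLp_landauFun (j : ℕ) (P : ℂ[X]) : MemLp (X.landauFun j P) 2 X.vol := by
  rw [memLp_vol_iff]
  simp only [landauFun_coord]
  exact memLp_periodize (X.continuous_wave j P) (X.decays_wave j P) 2

/-- The periodized waves as elements of the one-particle space. -/
noncomputable def landau (j : ℕ) (P : ℂ[X]) : X.H := (X.memLp_landauFun j P).toLp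

theorem inner_landau (j : ℕ) (P : ℂ[X]) (f : X.H) :
    ⟪X.landau j P, f⟫_ℂ
      = X.area * ∫ p, conj (X.periodize (X.wave j P) p) * f (X.coord p) ∂sqVol := by
  rw [inner_eq_integral]
  have : (fun x => conj ((X.landau j P : X.H) x) * f x) =ᵐ[X.vol]
      fun x => conj (X.landauFun j P x) * f x := by
    filter_upwards [(X.memLp_landauFun j P).coeFn_toLp] with x hx
    rw [landau, hx]
  rw [integral_congr_ae this, integral_vol]
  simp only [landauFun_coord, Complex.real_smul]

variable {X}

theorem Equivariant.inner_landau {φ : ℝ × ℝ → ℂ} (h : X.Equivariant φ) (hc : Continuous φ)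
    (j : ℕ) (P : ℂ[X]) {f : X.H} (hf : f =ᵐ[X.vol] φ) :
    ⟪X.landau j P, f⟫_ℂ = X.area * X.pairing j P φ := by
  rw [Cell.inner_landau, pairing]
  obtain ⟨K, hK⟩ := h.exists_norm_le hc
  have hi : Integrable (fun p => φ (X.coord p)) sqVol :=
    Integrable.of_bound (hc.comp X.continuous_coord).aestronglyMeasurable K (ae_of_all _ hK)
  rw [← integral_conj_periodize_mul (F := fun p => φ (X.coord p)) (X.continuous_wave j P)
    (X.decays_wave j P) hi fun p _ m => h.apply_shift m p.1 p.2]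
  congr 1
  refine integral_congr_ae ?_
  filter_upwards [X.ae_vol_iff.1 hf] with p hp
  rw [hp]

variable (X)

/-- Membership is a weak statement, tested against smooth equivariant functions; unfolding reduces
it to `pairing_magLap`, and no regularity of the periodized sum has to be proved. -/
theorem landau_hermiteC_mem_eigenspace (j k : ℕ) :
    X.landau j (hermiteC X.kap k) ∈ X.eigenspace ((2 * k + 1) * X.b) := by
  rw [Submodule.mem_orthogonal']
  intro u hu
  refine Submodule.span_induction (p := fun u _ => ⟪X.landau j (hermiteC X.kap k), u⟫_ℂ = 0)
    ?_ (inner_zero_right _) (fun u v _ _ hu hv => by rw [inner_add_right, hu, hv, add_zero])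
    (fun a u _ hu => by rw [inner_smul_right, hu, mul_zero]) hu
  rintro f ⟨φ, hφ, he, hf⟩
  have h₁ := contDiff_D₁ (X := X) hφ
  have h₂ := contDiff_D₂ (X := X) hφ
  have hd : Differentiable ℝ φ := hφ.differentiable (by simp)
  have e₁ := (he.D₁ hd).D₁ (h₁.differentiable (by simp))
  have e₂ := (he.D₂ hd).D₂ (h₂.differentiable (by simp))
  have c₁ := (contDiff_D₁ (X := X) h₁).continuous
  have c₂ := (contDiff_D₂ (X := X) h₂).continuous
  have cm : Continuous (X.magLap φ) := (c₁.add c₂).neg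
  have em : X.Equivariant (X.magLap φ) := fun m k x => by
    rw [magLap, magLap, mul_neg, mul_add, e₁ m k x, e₂ m k x]
  have eg : X.Equivariant fun x => X.magLap φ x - ((2 * k + 1) * X.b : ℝ) * φ x :=
    fun m k x => by
      rw [mul_sub, em m k x, mul_left_comm, he m k x]
  rw [eg.inner_landau (cm.sub (continuous_const.mul hφ.continuous)) _ _ hf, pairing]
  simp only [mul_sub]
  rw [integral_sub (em.integrable cm _ _)]
  · simp only [mul_left_comm _ (((2 * k + 1) * X.b : ℝ) : ℂ)]
    rw [integral_const_mul]
    have := he.pairing_magLap hφ j k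
    rw [pairing, pairing] at this
    rw [this, sub_self, mul_zero]
  · simp only [mul_left_comm _ (((2 * k + 1) * X.b : ℝ) : ℂ)]
    exact (he.integrable hφ.continuous _ _).const_mul _

end Cell

end BdG

/-! ### Partial Fourier coefficients on the strip -/

namespace BdG

open Polynomial Filter Topology

namespace Cell

variable (X : Cell)

/-- The extension of a function on the cell to the strip, in coordinates. -/
noncomputable def ext (f : ℝ × ℝ → ℂ) (p : ℝ × ℝ) : ℂ :=
  X.phase ⌊p.2⌋ p.1 * f (p.1, Int.fract p.2)

theorem ext_shift (f : ℝ × ℝ → ℂ) (p : ℝ × ℝ) (hp : p.2 ∈ Set.Ico (0 : ℝ) 1) (m : ℤ) :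
    X.ext f (p.1, p.2 + m) = X.phase m p.1 * f p := by
  have h1 : ⌊p.2 + m⌋ = m := by
    rw [Int.floor_add_intCast, Int.floor_eq_zero_iff.2 hp, zero_add]
  have h2 : Int.fract (p.2 + m) = p.2 := by
    rw [Int.fract_add_intCast, Int.fract_eq_self.2 hp]
  rw [ext, h1, h2]

theorem measurable_ext {f : ℝ × ℝ → ℂ} (hf : Measurable f) : Measurable (X.ext f) := by
  have h1 : Measurable fun p : ℝ × ℝ => X.phase ⌊p.2⌋ p.1 := by
    unfold phase
    have h2 : Measurable fun p : ℝ × ℝ => X.c 0 ⌊p.2⌋ :=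
      (measurable_from_top (f := fun m : ℤ => X.c 0 m)).comp (Int.measurable_floor.comp measurable_snd)
    have h3 : Measurable fun p : ℝ × ℝ => ((⌊p.2⌋ : ℤ) : ℝ) :=
      (measurable_from_top (f := fun m : ℤ => (m : ℝ))).comp
        (Int.measurable_floor.comp measurable_snd)
    fun_prop
  exact h1.mul (hf.comp (measurable_fst.prodMk (measurable_fract.comp measurable_snd)))

/-- The plane wave factor of a wave. -/
noncomputable def mode (j : ℕ) (p : ℝ × ℝ) : ℂ :=
  Complex.exp (Complex.I * (((Real.pi * X.n * p.2 + X.c 1 0 + 2 * Real.pi * j) * p.1 : ℝ) : ℂ))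

theorem norm_mode (j : ℕ) (p : ℝ × ℝ) : ‖X.mode j p‖ = 1 := by
  rw [mode, mul_comm Complex.I, Complex.norm_exp_ofReal_mul_I]

theorem continuous_mode (j : ℕ) : Continuous (X.mode j) := by
  unfold mode
  fun_prop

theorem wave_eq (j : ℕ) (P : ℂ[X]) (p : ℝ × ℝ) :
    X.wave j P p = X.mode j p * gaussPoly X.gaussExp P (p.2 + X.center j) := rfl

/-- The `j`-th partial Fourier coefficient on the strip. -/
noncomputable def coef (f : ℝ × ℝ → ℂ) (j : ℕ) (t : ℝ) : ℂ :=
  ∫ s, conj (X.mode j (s, t)) * X.ext f (s, t) ∂unitVol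

theorem integral_exp_two_pi (k : ℤ) :
    ∫ s : ℝ, Complex.exp (2 * Real.pi * Complex.I * k * s) ∂unitVol = if k = 0 then 1 else 0 := by
  split_ifs with h
  · simp [h]
  · have hc : (2 * Real.pi * Complex.I * k : ℂ) ≠ 0 := by
      simp [h, Real.pi_ne_zero]
    rw [unitVol, integral_Ico_eq_integral_Ioc, ← intervalIntegral.integral_of_le zero_le_one,
      integral_exp_mul_complex hc]
    have : (2 * Real.pi * Complex.I * k : ℂ) * ((1 : ℝ) : ℂ) = k * (2 * Real.pi * Complex.I) := by
      push_cast; ring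
    rw [this, Complex.exp_int_mul_two_pi_mul_I]
    simp

/-- Translating `t` by `m` turns the frequency `j` into `j + n m`. Thus the `n` functions `coef f
j`, `j < n`, evaluated along `t + ℤ`, contain all Fourier coefficients of the slice at `t`. -/
theorem conj_mode_mul_phase (j : ℕ) (m : ℤ) (s t : ℝ) :
    conj (X.mode j (s, t + m)) * X.phase m s = Complex.exp (Complex.I * ((X.c 0 m
      - (Real.pi * X.n * t + X.c 1 0) * s - 2 * Real.pi * (j + X.n * m) * s : ℝ) : ℂ)) := by
  rw [mode, phase, ← Complex.exp_conj, ← Complex.exp_add]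
  congr 1
  simp only [map_mul, Complex.conj_I, Complex.conj_ofReal]
  push_cast
  ring

theorem ofNat_add_mul_eq_iff {j j' n : ℕ} (hj : j < n) (hj' : j' < n) (l m : ℤ) :
    (j' : ℤ) + n * l - (j + n * m) = 0 ↔ j = j' ∧ l = m := by
  constructor
  · intro h
    have h1 : (j : ℤ) = j' := by
      have e : (j : ℤ) = j' + n * (l - m) := by linarith
      have a1 : (j : ℤ) % n = j := Int.emod_eq_of_lt (by positivity) (by exact_mod_cast hj)
      have a2 : (j' : ℤ) % n = j' := Int.emod_eq_of_lt (by positivity) (by exact_mod_cast hj')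
      rw [← a1, e, Int.add_mul_emod_self_left, a2]
    refine ⟨by exact_mod_cast h1, ?_⟩
    have hn : (n : ℤ) ≠ 0 := by
      have : 0 < n := by omega
      exact_mod_cast this.ne'
    have : (n : ℤ) * l = n * m := by linarith
    exact mul_left_cancel₀ hn this
  · rintro ⟨rfl, rfl⟩
    ring

theorem coef_periodize {j j' : ℕ} (hj : j < X.n) (hj' : j' < X.n) (Q : ℂ[X]) (t : ℝ) :
    X.coef (X.periodize (X.wave j' Q)) j t
      = if j = j' then gaussPoly X.gaussExp Q (t + X.center j) else 0 := by
  obtain ⟨m, t', ht', rfl⟩ : ∃ m : ℤ, ∃ t' ∈ Set.Ico (0 : ℝ) 1, t = t' + m :=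
    ⟨⌊t⌋, Int.fract t, ⟨Int.fract_nonneg _, Int.fract_lt_one _⟩, (Int.fract_add_floor t).symm⟩
  have h1 : ∀ s : ℝ, conj (X.mode j (s, t' + m)) *
      X.ext (X.periodize (X.wave j' Q)) (s, t' + m)
      = ∑' l : ℤ, Complex.exp (Complex.I * ((X.c 0 m - X.c 0 l : ℝ) : ℂ))
        * gaussPoly X.gaussExp Q (t' + l + X.center j')
        * Complex.exp (2 * Real.pi * Complex.I * ((j' + X.n * l - (j + X.n * m) : ℤ) : ℂ) * s) := by
    intro s
    rw [X.ext_shift _ (s, t') ht', ← mul_assoc, conj_mode_mul_phase, periodize, ← tsum_mul_left]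
    congr 1
    ext l
    have h2 := X.conj_mode_mul_phase j' l s t'
    have h3 : conj (X.phase l s) * X.mode j' (s, t' + l) = conj (Complex.exp (Complex.I *
        ((X.c 0 l - (Real.pi * X.n * t' + X.c 1 0) * s - 2 * Real.pi * (j' + X.n * l) * s : ℝ)
          : ℂ))) := by
      rw [← h2, map_mul, Complex.conj_conj, mul_comm]
    rw [wave_eq, ← mul_assoc (conj (X.phase l s)), h3, ← Complex.exp_conj, ← mul_assoc,
      ← Complex.exp_add, mul_right_comm (Complex.exp (Complex.I * ((X.c 0 m - X.c 0 l : ℝ) : ℂ))),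
      ← Complex.exp_add]
    congr 2
    simp only [map_mul, Complex.conj_I, Complex.conj_ofReal]
    push_cast
    ring
  obtain ⟨C, hC, hd⟩ := X.decays_wave j' Q
  have hb : ∀ (l : ℤ) (s : ℝ), ‖Complex.exp (Complex.I * ((X.c 0 m - X.c 0 l : ℝ) : ℂ))
        * gaussPoly X.gaussExp Q (t' + l + X.center j')
        * Complex.exp (2 * Real.pi * Complex.I * ((j' + X.n * l - (j + X.n * m) : ℤ) : ℂ) * s)‖
      ≤ C * (Real.exp 1 * Real.exp (-|(l : ℝ)|)) := by
    intro l s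
    have e1 : (2 * Real.pi * Complex.I * ((j' + X.n * l - (j + X.n * m) : ℤ) : ℂ) * s)
      = ((2 * Real.pi * ((j' + X.n * l - (j + X.n * m) : ℤ) : ℝ) * s : ℝ) : ℂ) * Complex.I := by
      push_cast; ring
    rw [norm_mul, norm_mul, e1, mul_comm Complex.I, Complex.norm_exp_ofReal_mul_I,
      Complex.norm_exp_ofReal_mul_I, one_mul, mul_one]
    have := Decays.norm_shift_le hC hd (p := (s, t')) ht' l
    rwa [norm_wave] at this
  have hi : ∀ l : ℤ, Integrable (fun s : ℝ =>
      Complex.exp (Complex.I * ((X.c 0 m - X.c 0 l : ℝ) : ℂ))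
        * gaussPoly X.gaussExp Q (t' + l + X.center j')
        * Complex.exp (2 * Real.pi * Complex.I * ((j' + X.n * l - (j + X.n * m) : ℤ) : ℂ) * s))
      unitVol := fun l => Integrable.of_bound
    (Continuous.aestronglyMeasurable (by fun_prop)) _ (ae_of_all _ (hb l))
  have hs := hasSum_integral_of_summable_integral_norm hi
    (Summable.of_nonneg_of_le (fun l => integral_nonneg fun _ => norm_nonneg _)
      (fun l => (integral_mono (hi l).norm (integrable_const _) (hb l)).trans_eq (by simp))
      (summable_majorant C))
  rw [coef]
  simp only [h1]
  rw [← hs.tsum_eq]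
  -- The `l`-th translate has frequency `j' + n l`, tested against `j + n m`. By uniqueness of
  -- division with remainder only `j = j'`, `l = m` contributes.
  simp only [integral_const_mul, integral_exp_two_pi, ofNat_add_mul_eq_iff hj hj']
  by_cases hjj : j = j'
  · subst hjj
    simp only [true_and, if_true]
    rw [tsum_eq_single m]
    · simp
    · intro l hl
      simp [hl]
  · simp [hjj]

theorem integral_conj_wave_mul_ext {f : ℝ × ℝ → ℂ} (hf : Integrable f sqVol) (j : ℕ) (P : ℂ[X]) :
    ∫ p, conj (X.periodize (X.wave j P) p) * f p ∂sqVol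
      = ∫ t, conj (gaussPoly X.gaussExp P (t + X.center j)) * X.coef f j t := by
  have hi := integrable_unfold (F := X.ext f) (X.continuous_wave j P) (X.decays_wave j P) hf
    fun p hp m => X.ext_shift f p hp m
  rw [integral_conj_periodize_mul (F := X.ext f) (X.continuous_wave j P) (X.decays_wave j P) hf
    fun p hp m => X.ext_shift f p hp m]
  rw [stripVol] at hi ⊢
  rw [integral_prod_symm _ hi]
  congr 1
  ext t
  rw [coef, ← integral_const_mul]
  congr 1
  ext s
  rw [wave_eq, map_mul]
  ring

theorem inner_landau_landau {j j' : ℕ} (hj : j < X.n) (hj' : j' < X.n) (P Q : ℂ[X]) :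
    ⟪X.landau j P, X.landau j' Q⟫_ℂ = if j = j' then
      X.area * ∫ y, conj (gaussPoly X.gaussExp P y) * gaussPoly X.gaussExp Q y else 0 := by
  have hi : Integrable (X.periodize (X.wave j' Q)) sqVol :=
    (memLp_periodize (X.continuous_wave j' Q) (X.decays_wave j' Q) 1).integrable le_rfl
  have h1 : ⟪X.landau j P, X.landau j' Q⟫_ℂ = X.area * ∫ p, conj (X.periodize (X.wave j P) p)
      * X.periodize (X.wave j' Q) p ∂sqVol := by
    rw [inner_landau]
    congr 1
    refine integral_congr_ae ?_
    filter_upwards [X.ae_vol_iff.1 (X.memLp_landauFun j' Q).coeFn_toLp] with p hp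
    rw [landau, hp, landauFun_coord]
  rw [h1, integral_conj_wave_mul_ext _ hi]
  simp only [coef_periodize _ hj hj']
  split_ifs with h
  · congr 1
    exact integral_add_right_eq_self (fun y => conj (gaussPoly X.gaussExp P y)
      * gaussPoly X.gaussExp Q y) (X.center j)
  · simp

/-! ### Completeness -/

theorem measurable_coef_aux {f : ℝ × ℝ → ℂ} (hf : Measurable f) (j : ℕ) :
    AEStronglyMeasurable (X.coef f j) volume := by
  have h1 : Measurable fun p : ℝ × ℝ => conj (X.mode j p) * X.ext f p :=
    (Complex.continuous_conj.comp (X.continuous_mode j)).measurable.mul (X.measurable_ext hf)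
  have h2 : AEStronglyMeasurable (fun p : ℝ × ℝ => conj (X.mode j p.swap) * X.ext f p.swap)
      ((volume : Measure ℝ).prod unitVol) := (h1.comp measurable_swap).aestronglyMeasurable
  exact h2.integral_prod_right'

/-- By unfolding and Fubini the hypothesis says that the coefficient is orthogonal to all
polynomials times a Gaussian, centered at `-center j`; these are total. -/
theorem coef_ae_eq_zero {f : ℝ × ℝ → ℂ} (hm : Measurable f) (hf : Integrable f sqVol) (j : ℕ)
    (h : ∀ P : ℂ[X], ∫ p, conj (X.periodize (X.wave j P) p) * f p ∂sqVol = 0) :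
    ∀ᵐ t, X.coef f j t = 0 := by
  set F : ℝ → ℂ := fun y => X.coef f j (y - X.center j) with hF
  have hmp : MeasurePreserving (fun y : ℝ => y - X.center j) volume volume :=
    measurePreserving_sub_right _ _
  have hFm : AEStronglyMeasurable F volume :=
    (X.measurable_coef_aux hm j).comp_measurePreserving hmp
  have hFi : Integrable fun y => Real.exp (-|y|) • F y := by
    have h1 : Integrable fun t => Real.exp (-|t + X.center j|) • X.coef f j t := by
      have hc := X.continuous_mode j
      -- The integrability against `exp (-|y|)` is unfolding once more, with a bare exponential in
      -- place of the Gaussian.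
      have h2 := integrable_unfold (F := X.ext f)
        (e := fun p => X.mode j p * (Real.exp (-|p.2 + X.center j|) : ℝ)) (by fun_prop)
        ⟨Real.exp |X.center j|, (Real.exp_nonneg _), fun p => by
          rw [norm_mul, norm_mode, one_mul, Complex.norm_real,
            Real.norm_of_nonneg (Real.exp_nonneg _), ← Real.exp_add]
          refine Real.exp_le_exp.2 ?_
          have := abs_sub_abs_le_abs_sub p.2 (-X.center j)
          rw [abs_neg, sub_neg_eq_add] at this
          linarith⟩ hf fun p hp m => X.ext_shift f p hp m
      rw [stripVol] at h2
      refine h2.integral_prod_right.congr (ae_of_all _ fun t => ?_)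
      simp only [coef]
      rw [Complex.real_smul, ← integral_const_mul]
      congr 1
      ext s
      rw [map_mul, Complex.conj_ofReal]
      ring
    have h3 := hmp.integrable_comp_of_integrable h1
    simpa [Function.comp_def, hF] using h3
  have hF0 : F =ᵐ[volume] 0 := by
    refine ae_eq_zero_of_integral_conj_gaussPoly_mul_eq_zero X.gaussExp_re_pos hFm hFi fun P => ?_
    have h1 := h P
    rw [integral_conj_wave_mul_ext _ hf] at h1
    rw [← h1, ← integral_add_right_eq_self _ (X.center j)]
    simp [hF]
  have h2 := (measurePreserving_add_right volume (X.center j)).quasiMeasurePreserving.ae hF0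
  filter_upwards [h2] with t ht
  simpa [hF] using ht

theorem ae_eq_zero_of_fourierCoeffOn {h : ℝ → ℂ} (hm : MemLp h 2 unitVol)
    (h0 : ∀ k : ℤ, ∫ s, Complex.exp (-(2 * Real.pi * Complex.I * k * s)) * h s ∂unitVol = 0) :
    ∫ s, ‖h s‖ ^ 2 ∂unitVol = 0 := by
  have hU : unitVol = volume.restrict (Set.Ioc 0 1) := restrict_Ico_eq_restrict_Ioc
  rw [hU] at hm h0 ⊢
  have h1 := tsum_sq_fourierCoeffOn (zero_lt_one (α := ℝ)) hm
  have h2 : ∀ k, fourierCoeffOn (zero_lt_one (α := ℝ)) h k = 0 := by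
    intro k
    rw [fourierCoeffOn_eq_integral, intervalIntegral.integral_of_le zero_le_one]
    have : ∀ s : ℝ, (fourier (-k) (s : AddCircle ((1 : ℝ) - 0))) • h s
        = Complex.exp (-(2 * Real.pi * Complex.I * k * s)) * h s := by
      intro s
      rw [fourier_coe_apply, smul_eq_mul]
      congr 2
      push_cast
      ring
    simp only [this, h0 k, smul_zero]
  simp only [h2, norm_zero, ne_eq, OfNat.ofNat_ne_zero, not_false_eq_true, zero_pow, tsum_zero,
    sub_zero, inv_one, one_smul] at h1
  rw [← intervalIntegral.integral_of_le zero_le_one, ← h1]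

/-- For almost every `t` all coefficients vanish at every `t + m`, so every Fourier coefficient of
the slice, twisted by a phase, vanishes; Parseval gives a zero slice. -/
theorem ae_eq_zero_of_integral_periodize {f : ℝ × ℝ → ℂ} (hm : Measurable f)
    (hf : MemLp f 2 sqVol) (h : ∀ j < X.n, ∀ P : ℂ[X],
      ∫ p, conj (X.periodize (X.wave j P) p) * f p ∂sqVol = 0) : ∀ᵐ p ∂sqVol, f p = 0 := by
  have hf1 : Integrable f sqVol := hf.integrable (by norm_num)
  have hsq : Integrable (fun p => ‖f p‖ ^ 2) sqVol :=
    (memLp_two_iff_integrable_sq_norm hm.aestronglyMeasurable).1 hf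
  have h1 : ∀ᵐ t ∂unitVol, ∀ m : ℤ, ∀ j < X.n, X.coef f j (t + m) = 0 := by
    have h2 : ∀ᵐ t, ∀ j < X.n, X.coef f j t = 0 := by
      rw [ae_all_iff]
      intro j
      by_cases hj : j < X.n
      · filter_upwards [X.coef_ae_eq_zero hm hf1 j (h j hj)] with t ht _
        exact ht
      · exact ae_of_all _ fun t hj' => absurd hj' hj
    rw [volume_eq_sum_map_unitVol, Measure.ae_sum_iff] at h2
    rw [ae_all_iff]
    intro m
    exact ae_of_ae_map (measurable_add_const (m : ℝ)).aemeasurable (h2 m)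
  have h3 : ∀ᵐ t ∂unitVol, t ∈ Set.Ico (0 : ℝ) 1 := ae_restrict_mem measurableSet_Ico
  have hsq' := hsq
  rw [sqVol] at hsq'
  have h4 : ∫ p, ‖f p‖ ^ 2 ∂sqVol = 0 := by
    rw [sqVol, integral_prod_symm _ hsq']
    refine integral_eq_zero_of_ae ?_
    filter_upwards [h1, h3, hsq'.prod_left_ae] with t ht1 ht2 ht3
    set g : ℝ → ℂ := fun s =>
      Complex.exp (Complex.I * ((-(Real.pi * X.n * t + X.c 1 0) * s : ℝ) : ℂ)) * f (s, t) with hg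
    have hgm : Measurable g := by
      have : Measurable fun s => f (s, t) := hm.comp (measurable_id.prodMk measurable_const)
      exact (Continuous.measurable (by fun_prop)).mul this
    have hgn : ∀ s, ‖g s‖ = ‖f (s, t)‖ := by
      intro s
      rw [hg, norm_mul, mul_comm Complex.I, Complex.norm_exp_ofReal_mul_I, one_mul]
    have hg2 : MemLp g 2 unitVol := by
      rw [memLp_two_iff_integrable_sq_norm hgm.aestronglyMeasurable]
      simpa only [hgn] using ht3
    have := ae_eq_zero_of_fourierCoeffOn hg2 fun k => ?_
    · simp only [hgn] at this
      exact this
    -- Division with remainder, `k = j + n m`: the `k`-th Fourier coefficient of the slice is, up to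
    -- a phase, `coef f j (t + m)`.
    · have hn : (0 : ℤ) < X.n := by exact_mod_cast X.n_pos
      obtain ⟨j, hj⟩ : ∃ j : ℕ, (j : ℤ) = k % X.n :=
        ⟨(k % X.n).toNat, Int.toNat_of_nonneg (Int.emod_nonneg _ hn.ne')⟩
      have hjn : j < X.n := by
        have := Int.emod_lt_of_pos k hn
        rw [← hj] at this
        exact_mod_cast this
      have hk : (k : ℝ) = j + X.n * ((k / X.n : ℤ) : ℝ) := by
        have := Int.emod_add_mul_ediv k X.n
        rw [← hj] at this
        exact_mod_cast this.symm
      have h5 := ht1 (k / X.n) j hjn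
      rw [coef] at h5
      have h6 : ∀ s, conj (X.mode j (s, t + (k / X.n : ℤ))) * X.ext f (s, t + (k / X.n : ℤ))
          = Complex.exp (Complex.I * (X.c 0 (k / X.n) : ℂ)) *
            (Complex.exp (-(2 * Real.pi * Complex.I * k * s)) * g s) := by
        intro s
        rw [X.ext_shift f (s, t) ht2, ← mul_assoc, conj_mode_mul_phase, ← hk, hg, ← mul_assoc,
          ← mul_assoc, ← Complex.exp_add, ← Complex.exp_add]
        congr 2
        push_cast
        ring
      simp only [h6] at h5
      rw [integral_const_mul, mul_eq_zero] at h5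
      exact h5.resolve_left (Complex.exp_ne_zero _)
  rw [integral_eq_zero_iff_of_nonneg (fun p => by positivity) hsq] at h4
  filter_upwards [h4] with p hp
  simpa using hp

end Cell

end BdG

/-! ### The Landau basis -/

namespace BdG

open Polynomial Filter Topology

/-- The sequence of rescaled Hermite polynomials. -/
noncomputable def hermiteSeq {κ : ℝ} (hκ : 0 < κ) : Polynomial.Sequence ℂ where
  elems' := hermiteC κ
  degree_eq' k := by
    rw [degree_eq_natDegree (hermiteC_ne_zero hκ k), natDegree_hermiteC hκ]

theorem span_hermiteC {κ : ℝ} (hκ : 0 < κ) :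
    Submodule.span ℂ (Set.range (hermiteC κ)) = ⊤ := by
  refine (hermiteSeq hκ).span fun k => ?_
  rw [isUnit_iff_ne_zero, leadingCoeff_ne_zero]
  exact hermiteC_ne_zero hκ k

namespace Cell

variable (X : Cell)

theorem periodize_wave_add (j : ℕ) (P Q : ℂ[X]) {p : ℝ × ℝ} (hp : p.2 ∈ Set.Ico (0 : ℝ) 1) :
    X.periodize (X.wave j (P + Q)) p = X.periodize (X.wave j P) p + X.periodize (X.wave j Q) p := by
  simp only [periodize, wave_add, mul_add]
  exact ((X.decays_wave j P).summable hp).tsum_add ((X.decays_wave j Q).summable hp)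

theorem periodize_wave_C_mul (j : ℕ) (a : ℂ) (P : ℂ[X]) (p : ℝ × ℝ) :
    X.periodize (X.wave j (C a * P)) p = a * X.periodize (X.wave j P) p := by
  simp only [periodize, wave_C_mul, ← tsum_mul_left]
  congr 1
  ext m
  ring

theorem landau_add (j : ℕ) (P Q : ℂ[X]) :
    X.landau j (P + Q) = X.landau j P + X.landau j Q := by
  rw [landau, landau, landau, ← MemLp.toLp_add, MemLp.toLp_eq_toLp_iff]
  refine X.ae_vol_iff.2 ?_
  filter_upwards [ae_sqVol_mem] with p hp
  simp only [Pi.add_apply, landauFun_coord]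
  exact X.periodize_wave_add j P Q hp.2

theorem landau_smul (j : ℕ) (a : ℂ) (P : ℂ[X]) : X.landau j (a • P) = a • X.landau j P := by
  rw [landau, landau, ← MemLp.toLp_const_smul, MemLp.toLp_eq_toLp_iff]
  refine ae_of_all _ fun x => ?_
  rw [smul_eq_C_mul]
  exact X.periodize_wave_C_mul j a P _

/-- The Hermite polynomials have exact degrees `0, 1, 2, …` and so span all polynomials; by
linearity of `landau` the completeness statement for arbitrary polynomials applies. -/
theorem orthogonal_landau_hermiteC {f : X.H}
    (h : ∀ k, ∀ j < X.n, ⟪X.landau j (hermiteC X.kap k), f⟫_ℂ = 0) : f = 0 := by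
  have h1 : ∀ j < X.n, ∀ P, ⟪X.landau j P, f⟫_ℂ = 0 := by
    intro j hj P
    have hP : P ∈ Submodule.span ℂ (Set.range (hermiteC X.kap)) := by
      rw [span_hermiteC X.kap_pos]; trivial
    refine Submodule.span_induction (p := fun P _ => ⟪X.landau j P, f⟫_ℂ = 0) ?_ ?_
      (fun P Q _ _ hP hQ => by rw [landau_add, inner_add_left, hP, hQ, add_zero])
      (fun a P _ hP => by rw [landau_smul, inner_smul_left, hP, mul_zero]) hP
    · rintro _ ⟨k, rfl⟩
      exact h k j hj
    · have := X.landau_smul j 0 0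
      rw [zero_smul, zero_smul] at this
      rw [this, inner_zero_left]
  have hm : Measurable fun p => f (X.coord p) :=
    (Lp.stronglyMeasurable f).measurable.comp X.continuous_coord.measurable
  have h2 := X.ae_eq_zero_of_integral_periodize hm (X.memLp_vol_iff.1 (Lp.memLp f))
    fun j hj P => by
      have := h1 j hj P
      rw [inner_landau, mul_eq_zero] at this
      exact this.resolve_left (Complex.ofReal_ne_zero.2 X.area_pos.ne')
  rw [Lp.eq_zero_iff_ae_eq_zero]
  exact X.ae_vol_iff.2 h2

theorem landau_hermiteC_ne_zero {j : ℕ} (hj : j < X.n) (k : ℕ) :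
    X.landau j (hermiteC X.kap k) ≠ 0 := by
  obtain ⟨N, hN, h⟩ := integral_conj_gaussPoly_hermiteC_self_pos X.kap_pos X.two_mul_gaussExp_re k
  rw [← inner_self_ne_zero (𝕜 := ℂ), inner_landau_landau _ hj hj, if_pos rfl, h]
  exact mul_ne_zero (Complex.ofReal_ne_zero.2 X.area_pos.ne') (Complex.ofReal_ne_zero.2 hN.ne')

/-- The Landau levels: `𝔥` has an orthonormal basis of eigenvectors of the magnetic Laplacian, with
`n` vectors for each of the eigenvalues `(2 k + 1) b`. -/
theorem exists_landau_basis : ∃ B : HilbertBasis (ℕ × Fin X.n) ℂ X.H,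
    ∀ i, B i ∈ X.eigenspace ((2 * i.1 + 1) * X.b) := by
  set v : ℕ × Fin X.n → X.H := fun i => X.landau i.2 (hermiteC X.kap i.1) with hv
  have hv0 : ∀ i, v i ≠ 0 := fun i => X.landau_hermiteC_ne_zero i.2.2 i.1
  have hort : ∀ i i', i ≠ i' → ⟪v i, v i'⟫_ℂ = 0 := by
    intro i i' hne
    rw [hv, inner_landau_landau _ i.2.2 i'.2.2]
    split_ifs with h
    · rw [integral_conj_gaussPoly_hermiteC_mul X.kap_pos X.two_mul_gaussExp_re, mul_zero]
      exact fun hk => hne (Prod.ext hk (Fin.ext h))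
    · rfl
  set w : ℕ × Fin X.n → X.H := fun i => ((‖v i‖⁻¹ : ℝ) : ℂ) • v i with hw
  have hw0 : Orthonormal ℂ w := by
    refine ⟨fun i => ?_, fun i i' hne => ?_⟩
    · rw [hw, norm_smul, Complex.norm_real, norm_inv, norm_norm,
        inv_mul_cancel₀ (norm_ne_zero_iff.2 (hv0 i))]
    · change ⟪((‖v i‖⁻¹ : ℝ) : ℂ) • v i, ((‖v i'‖⁻¹ : ℝ) : ℂ) • v i'⟫_ℂ = 0
      rw [inner_smul_left, inner_smul_right, hort i i' hne, mul_zero, mul_zero]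
  have hsp : (Submodule.span ℂ (Set.range w))ᗮ = ⊥ := by
    rw [Submodule.eq_bot_iff]
    intro f hf
    refine X.orthogonal_landau_hermiteC fun k j hj => ?_
    have h1 := Submodule.inner_right_of_mem_orthogonal
      (Submodule.subset_span (Set.mem_range_self ((k, ⟨j, hj⟩) : ℕ × Fin X.n))) hf
    rw [hw, inner_smul_left, mul_eq_zero] at h1
    refine h1.resolve_left ?_
    simpa using hv0 (k, ⟨j, hj⟩)
  refine ⟨HilbertBasis.mkOfOrthogonalEqBot hw0 hsp, fun i => ?_⟩
  rw [HilbertBasis.coe_mkOfOrthogonalEqBot]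
  exact Submodule.smul_mem _ _ (X.landau_hermiteC_mem_eigenspace i.2 i.1)

end Cell

end BdG

namespace BdG

/-! ### Traces of positive operators -/

section Trace

variable {E F : Type*} [NormedAddCommGroup E] [InnerProductSpace ℂ E]
  [NormedAddCommGroup F] [InnerProductSpace ℂ F]

theorem hasSum_norm_inner_sq {ι : Type*} (B : HilbertBasis ι ℂ E) (x : E) :
    HasSum (fun i => ‖⟪B i, x⟫_ℂ‖ ^ 2) (‖x‖ ^ 2) := by
  have h := Complex.hasSum_re (B.hasSum_inner_mul_inner x x)
  have h1 : ∀ i, (⟪x, B i⟫_ℂ * ⟪B i, x⟫_ℂ).re = ‖⟪B i, x⟫_ℂ‖ ^ 2 := by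
    intro i
    rw [← inner_conj_symm, mul_comm, Complex.mul_conj, Complex.ofReal_re,
      Complex.normSq_eq_norm_sq]
  have h2 : (⟪x, x⟫_ℂ).re = ‖x‖ ^ 2 := (norm_sq_eq_re_inner (𝕜 := ℂ) x).symm
  simpa only [h1, h2] using h

theorem tsum_ofReal_norm_inner_sq {ι : Type*} (B : HilbertBasis ι ℂ E) (x : E) :
    ∑' i, ENNReal.ofReal (‖⟪B i, x⟫_ℂ‖ ^ 2) = ENNReal.ofReal (‖x‖ ^ 2) := by
  have h := hasSum_norm_inner_sq B x
  rw [← ENNReal.ofReal_tsum_of_nonneg (fun _ => by positivity) h.summable, h.tsum_eq]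

theorem re_inner_mono {A A' : E →L[ℂ] E} (h : A ≤ A') (e : E) :
    (⟪e, A e⟫_ℂ).re ≤ (⟪e, A' e⟫_ℂ).re := by
  have := ((ContinuousLinearMap.le_def _ _).1 h).re_inner_nonneg_right e
  rw [sub_apply, inner_sub_right] at this
  simpa using this

variable [CompleteSpace E] [CompleteSpace F]

/-- Both sides are the double sum of squared matrix elements of `S`, by Parseval. In `[0, ∞]` the
order of summation is free. -/
theorem tsum_ofReal_norm_sq_eq_adjoint {ι ι' : Type*} (B : HilbertBasis ι ℂ E)
    (B' : HilbertBasis ι' ℂ F) (S : E →L[ℂ] F) :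
    ∑' i, ENNReal.ofReal (‖S (B i)‖ ^ 2) = ∑' j, ENNReal.ofReal (‖S.adjoint (B' j)‖ ^ 2) := by
  simp only [← tsum_ofReal_norm_inner_sq B', ← tsum_ofReal_norm_inner_sq B]
  rw [ENNReal.tsum_comm]
  congr 1
  ext j
  congr 1
  ext i
  rw [ContinuousLinearMap.adjoint_inner_right, norm_inner_symm]

/-- The trace of a positive operator does not depend on the basis. -/
theorem trace_eq_tsum {ι : Type*} (B : HilbertBasis ι ℂ E) {A : E →L[ℂ] E} (hA : 0 ≤ A) :
    trace A = ∑' i, ENNReal.ofReal (⟪B i, A (B i)⟫_ℂ).re := by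
  -- With `A = S* S` the trace is a Hilbert-Schmidt norm; passing to `S*` and back changes the
  -- basis.
  obtain ⟨S, rfl⟩ := CStarAlgebra.nonneg_iff_eq_star_mul_self.mp hA
  have h : ∀ x : E, (⟪x, (star S * S) x⟫_ℂ).re = ‖S x‖ ^ 2 := by
    intro x
    rw [mul_apply_eq_comp, ContinuousLinearMap.star_eq_adjoint,
      ContinuousLinearMap.adjoint_inner_right]
    exact (norm_sq_eq_re_inner (𝕜 := ℂ) (S x)).symm
  obtain ⟨b, hb⟩ := (exists_hilbertBasis ℂ E).choose_spec
  have h1 : trace (star S * S) = ∑' i, ENNReal.ofReal (‖S (b i)‖ ^ 2) := by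
    rw [trace]
    simp only [h, hb]
    rfl
  rw [h1, tsum_ofReal_norm_sq_eq_adjoint b B S, ← tsum_ofReal_norm_sq_eq_adjoint B B S]
  simp only [h]

/-! ### Convexity bounds for the functional calculus -/

theorem spectrum_subset_unit {G : E →L[ℂ] E} (h0 : 0 ≤ G) (h1 : G ≤ 1) :
    ∀ p ∈ spectrum ℝ G, 0 ≤ p ∧ p ≤ 1 := by
  intro p hp
  refine ⟨spectrum_nonneg_of_nonneg h0 hp, ?_⟩
  have h2 : G ≤ algebraMap ℝ (E →L[ℂ] E) 1 := by simpa using h1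
  exact (le_algebraMap_iff_spectrum_le (h0.isSelfAdjoint)).1 h2 p hp

open Polynomial in
theorem cfc_quadratic {G : E →L[ℂ] E} (h0 : 0 ≤ G) (a s c q : ℝ) :
    cfc (fun p : ℝ => a + s * (p - q) - c * (p - q) ^ 2) G
      = (a : ℂ) • 1 + (s : ℂ) • (G - (q : ℂ) • 1) - (c : ℂ) • (G - (q : ℂ) • 1) ^ 2 := by
  have h1 : (fun p : ℝ => a + s * (p - q) - c * (p - q) ^ 2)
      = (C a + C s * (X - C q) - C c * (X - C q) ^ 2 : ℝ[X]).eval := by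
    ext p
    simp
  have h2 : ∀ (r : ℝ) (A : E →L[ℂ] E), algebraMap ℝ (E →L[ℂ] E) r * A = (r : ℂ) • A := by
    intro r A
    rw [← Algebra.smul_def]
    rfl
  have h3 : ∀ r : ℝ, algebraMap ℝ (E →L[ℂ] E) r = (r : ℂ) • 1 := by
    intro r
    rw [← h2, mul_one]
  rw [h1, cfc_polynomial _ G h0.isSelfAdjoint]
  simp only [map_add, map_sub, map_mul, map_pow, aeval_C, aeval_X, h3, smul_mul_assoc,
    one_mul]

theorem re_inner_quadratic {G : E →L[ℂ] E} (h0 : 0 ≤ G) (a s c q : ℝ) (e : E) :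
    (⟪e, ((a : ℂ) • 1 + (s : ℂ) • (G - (q : ℂ) • 1) - (c : ℂ) • (G - (q : ℂ) • 1) ^ 2 :
      E →L[ℂ] E) e⟫_ℂ).re
      = a * ‖e‖ ^ 2 + s * (⟪e, G e - (q : ℂ) • e⟫_ℂ).re - c * ‖G e - (q : ℂ) • e‖ ^ 2 := by
  have hsa : IsSelfAdjoint (G - (q : ℂ) • (1 : E →L[ℂ] E)) := by
    refine h0.isSelfAdjoint.sub ?_
    rw [IsSelfAdjoint, star_smul, star_one, RCLike.star_def, Complex.conj_ofReal]
  have h1 : ∀ x : E, (G - (q : ℂ) • (1 : E →L[ℂ] E)) x = G x - (q : ℂ) • x := fun x => by simp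
  have h2 : ⟪e, ((G - (q : ℂ) • (1 : E →L[ℂ] E)) ^ 2) e⟫_ℂ
      = ⟪G e - (q : ℂ) • e, G e - (q : ℂ) • e⟫_ℂ := by
    rw [pow_two, mul_apply_eq_comp, ← h1 e,
      ← ContinuousLinearMap.adjoint_inner_left, ← ContinuousLinearMap.star_eq_adjoint, hsa.star_eq]
  rw [sub_apply, add_apply, smul_apply, smul_apply, smul_apply, inner_sub_right, inner_add_right,
    inner_smul_right, inner_smul_right, inner_smul_right, h2, h1, Complex.sub_re, Complex.add_re,
    Complex.re_ofReal_mul, Complex.re_ofReal_mul, Complex.re_ofReal_mul,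
    one_apply_eq_self]
  have h3 : ∀ x : E, (⟪x, x⟫_ℂ).re = ‖x‖ ^ 2 := fun x => (norm_sq_eq_re_inner (𝕜 := ℂ) x).symm
  rw [h3, h3]

/-- A Klein inequality one vector at a time. The scalar parabola bound holds on the spectrum of `G`,
and a quadratic polynomial of `G` has an explicit quadratic form. When `e` is an eigenvector of the
reference state, `G e - q e` is the off-diagonal part of the perturbation. -/
theorem re_inner_cfc_le {G : E →L[ℂ] E} (h0 : 0 ≤ G) (h1 : G ≤ 1) {f : ℝ → ℝ}
    (hf : Continuous f) {a s c q : ℝ}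
    (h : ∀ p, 0 ≤ p → p ≤ 1 → f p ≤ a + s * (p - q) - c * (p - q) ^ 2) (e : E) :
    (⟪e, cfc f G e⟫_ℂ).re
      ≤ a * ‖e‖ ^ 2 + s * (⟪e, G e - (q : ℂ) • e⟫_ℂ).re - c * ‖G e - (q : ℂ) • e‖ ^ 2 := by
  rw [← re_inner_quadratic h0, ← cfc_quadratic h0]
  refine re_inner_mono (cfc_mono (fun p hp => ?_) hf.continuousOn ?_) e
  · have := spectrum_subset_unit h0 h1 p hp
    exact h p this.1 this.2
  · exact Continuous.continuousOn (by fun_prop)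

theorem le_re_inner_cfc {G : E →L[ℂ] E} (h0 : 0 ≤ G) (h1 : G ≤ 1) {f : ℝ → ℝ}
    (hf : Continuous f) {a s c q : ℝ}
    (h : ∀ p, 0 ≤ p → p ≤ 1 → a + s * (p - q) - c * (p - q) ^ 2 ≤ f p) (e : E) :
    a * ‖e‖ ^ 2 + s * (⟪e, G e - (q : ℂ) • e⟫_ℂ).re - c * ‖G e - (q : ℂ) • e‖ ^ 2
      ≤ (⟪e, cfc f G e⟫_ℂ).re := by
  rw [← re_inner_quadratic h0, ← cfc_quadratic h0]
  refine re_inner_mono (cfc_mono (fun p hp => ?_) ?_ hf.continuousOn) e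
  · have := spectrum_subset_unit h0 h1 p hp
    exact h p this.1 this.2
  · exact Continuous.continuousOn (by fun_prop)

end Trace

/-! ### Convexity bounds for the entropy function -/

theorem negMulLog_lower {p q : ℝ} (hp : 0 ≤ p) (hq : 0 < q) :
    Real.negMulLog q + (-Real.log q - 1) * (p - q) - q⁻¹ * (p - q) ^ 2 ≤ Real.negMulLog p := by
  rcases hp.eq_or_lt with rfl | hp
  · simp only [Real.negMulLog, neg_zero, zero_mul]
    have : q⁻¹ * (0 - q) ^ 2 = q := by field_simp; ring
    rw [this]
    linarith
  have h := Real.log_le_sub_one_of_pos (div_pos hp hq)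
  rw [Real.log_div hp.ne' hq.ne'] at h
  have h2 := mul_le_mul_of_nonneg_left h hp.le
  have h3 : p * (p / q - 1) = q⁻¹ * (p - q) ^ 2 + (p - q) := by field_simp; ring
  rw [h3] at h2
  simp only [Real.negMulLog]
  nlinarith

/-- This is `log x ≤ x - 1` at `x = √q / √p`, multiplied by `2p`: the relative entropy dominates the
Hellinger distance. -/
theorem sq_sqrt_sub_le_klein {p q : ℝ} (hp : 0 ≤ p) (hq : 0 < q) :
    (√p - √q) ^ 2 ≤ p * Real.log p - p * Real.log q - p + q := by
  rcases hp.eq_or_lt with rfl | hp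
  · simp [Real.sq_sqrt hq.le]
  have h := Real.log_le_sub_one_of_pos (div_pos (Real.sqrt_pos.2 hq) (Real.sqrt_pos.2 hp))
  rw [Real.log_div (Real.sqrt_pos.2 hq).ne' (Real.sqrt_pos.2 hp).ne', Real.log_sqrt hq.le,
    Real.log_sqrt hp.le] at h
  have h2 := mul_le_mul_of_nonneg_left h hp.le
  have h3 : p * (√q / √p - 1) = √p * √q - p := by
    have h4 : √p ≠ 0 := (Real.sqrt_pos.2 hp).ne'
    have h5 : p = √p * √p := (Real.mul_self_sqrt hp.le).symm
    rw [mul_sub, mul_one]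
    congr 1
    nth_rewrite 1 [h5]
    field_simp
  rw [h3] at h2
  rw [sub_sq, Real.sq_sqrt hp.le, Real.sq_sqrt hq.le]
  nlinarith

/-- The constant `1 / 4` comes from `(p - q)² = (√p - √q)² (√p + √q)²` and `(√p + √q)² ≤ 4`. -/
theorem negMulLog_upper {p q : ℝ} (hp : 0 ≤ p) (hp1 : p ≤ 1) (hq : 0 < q) (hq1 : q ≤ 1) :
    Real.negMulLog p ≤ Real.negMulLog q + (-Real.log q - 1) * (p - q) - 1 / 4 * (p - q) ^ 2 := by
  have h := sq_sqrt_sub_le_klein hp hq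
  have h1 : (p - q) ^ 2 = (√p - √q) ^ 2 * (√p + √q) ^ 2 := by
    rw [← mul_pow]
    congr 1
    rw [mul_comm, ← sq_sub_sq, Real.sq_sqrt hp, Real.sq_sqrt hq.le]
  have h2 : (√p + √q) ^ 2 ≤ 4 := by
    have a1 : √p ≤ 1 := Real.sqrt_le_one.2 hp1
    have a2 : √q ≤ 1 := Real.sqrt_le_one.2 hq1
    nlinarith [Real.sqrt_nonneg p, Real.sqrt_nonneg q]
  have h3 : (p - q) ^ 2 ≤ (√p - √q) ^ 2 * 4 := by
    rw [h1]
    exact mul_le_mul_of_nonneg_left h2 (sq_nonneg _)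
  simp only [Real.negMulLog]
  linarith

/-- Klein's inequality with a constant that grows as the reference state is depleted. -/
theorem negMulLog_upper_of_small {p q : ℝ} (hp : 0 ≤ p) (hp1 : p ≤ 1) (hq : 0 < q)
    (hL : 8 / 3 ≤ -Real.log q) :
    Real.negMulLog p ≤ Real.negMulLog q + (-Real.log q - 1) * (p - q)
      - (-Real.log q / 8) * (p - q) ^ 2 := by
  have hq1 : q ≤ 1 := by
    by_contra hlt
    have := Real.log_pos (not_le.1 hlt)
    linarith
  have hsq : 0 < √q := Real.sqrt_pos.2 hq
  have key : -Real.log q / 8 * (p - q) ^ 2 ≤ p * Real.log p - p * Real.log q - p + q := by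
    -- Put `L = -log q`. If `p ≥ √q`, then `log p ≥ -L / 2` and the right side is at least `p (L / 2
    -- - 1)`, while `(p - q)² ≤ p`; the comparison `L / 2 - 1 ≥ L / 8` is exactly `L ≥ 8 / 3`. If `p
    -- < √q`, the factor `(√p + √q)²` is at most `2 (p + q) ≤ 4 √q`, and `√q L ≤ 2`.
    rcases le_or_gt (√q) p with hpq | hpq
    · have hp0 : 0 < p := hsq.trans_le hpq
      have h1 : Real.log q / 2 ≤ Real.log p := by
        rw [← Real.log_sqrt hq.le]
        exact Real.log_le_log hsq hpq
      have h2 : q ≤ √q := by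
        rw [Real.le_sqrt hq.le hq.le]
        nlinarith
      have h3 : (p - q) ^ 2 ≤ p := by nlinarith
      have h4 := mul_le_mul_of_nonneg_left h1 hp
      have h5 : -Real.log q / 8 * (p - q) ^ 2 ≤ -Real.log q / 8 * p :=
        mul_le_mul_of_nonneg_left h3 (by linarith)
      have h6 : 0 ≤ p * (-Real.log q - 8 / 3) := mul_nonneg hp (by linarith)
      nlinarith
    · have h := sq_sqrt_sub_le_klein hp hq
      have h1 : (p - q) ^ 2 = (√p - √q) ^ 2 * (√p + √q) ^ 2 := by
        rw [← mul_pow]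
        congr 1
        rw [mul_comm, ← sq_sub_sq, Real.sq_sqrt hp, Real.sq_sqrt hq.le]
      have h2 : (√p + √q) ^ 2 ≤ 4 * √q := by
        have a1 : √p * √p = p := Real.mul_self_sqrt hp
        have a2 : √q * √q = q := Real.mul_self_sqrt hq.le
        have a3 : √q ≤ 1 := Real.sqrt_le_one.2 hq1
        nlinarith [sq_nonneg (√p - √q)]
      have h3 : -Real.log q / 2 ≤ (√q)⁻¹ - 1 := by
        have := Real.log_le_sub_one_of_pos (inv_pos.2 hsq)
        rw [Real.log_inv, Real.log_sqrt hq.le] at this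
        linarith
      have h4 : -Real.log q / 8 * (4 * √q) ≤ 1 := by
        have := mul_le_mul_of_nonneg_right h3 hsq.le
        rw [sub_mul, inv_mul_cancel₀ hsq.ne'] at this
        nlinarith
      calc -Real.log q / 8 * (p - q) ^ 2
          = (√p - √q) ^ 2 * (-Real.log q / 8 * (√p + √q) ^ 2) := by rw [h1]; ring
        _ ≤ (√p - √q) ^ 2 * 1 := by
          refine mul_le_mul_of_nonneg_left (le_trans ?_ h4) (sq_nonneg _)
          exact mul_le_mul_of_nonneg_left h2 (by linarith)
        _ ≤ _ := by rw [mul_one]; exact h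
  simp only [Real.negMulLog]
  linarith

end BdG

namespace BdG

/-! ### Product bases and integral kernels -/

section Tensor

variable {Ω : Type*} [MeasurableSpace Ω] {μ : Measure Ω}

theorem integral_norm_sq_eq (f : Lp ℂ 2 μ) : ∫ x, ‖f x‖ ^ 2 ∂μ = ‖f‖ ^ 2 := by
  have h := L2.inner_def (𝕜 := ℂ) f f
  have h1 : ∀ x, ⟪f x, f x⟫_ℂ = ((‖f x‖ ^ 2 : ℝ) : ℂ) := fun x => by
    rw [inner_self_eq_norm_sq_to_K]; simp
  simp only [h1] at h
  rw [integral_complex_ofReal, inner_self_eq_norm_sq_to_K] at h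
  exact Complex.ofReal_injective (h.symm.trans (Complex.ofReal_pow _ _).symm)

theorem integrable_norm_sq (f : Lp ℂ 2 μ) : Integrable (fun x => ‖f x‖ ^ 2) μ :=
  (memLp_two_iff_integrable_sq_norm (Lp.aestronglyMeasurable f)).1 (Lp.memLp f)

theorem norm_toLp_sq {f : Ω → ℂ} (hf : MemLp f 2 μ) : ‖hf.toLp f‖ ^ 2 = ∫ y, ‖f y‖ ^ 2 ∂μ := by
  rw [← integral_norm_sq_eq]
  refine integral_congr_ae ?_
  filter_upwards [hf.coeFn_toLp] with y hy
  rw [hy]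

theorem inner_toLp_right {f : Ω → ℂ} (hf : MemLp f 2 μ) (g : Lp ℂ 2 μ) :
    ⟪g, hf.toLp f⟫_ℂ = ∫ y, conj (g y) * f y ∂μ := by
  rw [L2.inner_def]
  refine integral_congr_ae ?_
  filter_upwards [hf.coeFn_toLp] with y hy
  rw [hy, RCLike.inner_apply']

theorem coeFn_star_ae (f : Lp ℂ 2 μ) : (star f : Lp ℂ 2 μ) =ᵐ[μ] fun x => conj (f x) :=
  Lp.coeFn_star f

theorem inner_star_star (f g : Lp ℂ 2 μ) : ⟪star f, star g⟫_ℂ = ⟪g, f⟫_ℂ := by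
  rw [L2.inner_def, L2.inner_def]
  refine integral_congr_ae ?_
  filter_upwards [coeFn_star_ae f, coeFn_star_ae g] with x h1 h2
  rw [h1, h2, RCLike.inner_apply', RCLike.inner_apply', Complex.conj_conj, mul_comm]

theorem star_smul_Lp (a : ℂ) (f : Lp ℂ 2 μ) : star (a • f) = conj a • star f := by
  apply Lp.ext
  filter_upwards [coeFn_star_ae (a • f), Lp.coeFn_smul a f,
    Lp.coeFn_smul (conj a) (star f), coeFn_star_ae f] with x h1 h2 h3 h4
  simp [h1, h2, h3, h4]

theorem norm_star_Lp (f : Lp ℂ 2 μ) : ‖star f‖ = ‖f‖ := by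
  have h : ⟪star f, star f⟫_ℂ = ⟪f, f⟫_ℂ := inner_star_star f f
  rw [inner_self_eq_norm_sq_to_K, inner_self_eq_norm_sq_to_K] at h
  have h' : ‖star f‖ ^ 2 = ‖f‖ ^ 2 := by exact_mod_cast h
  exact (pow_left_inj₀ (norm_nonneg _) (norm_nonneg _) two_ne_zero).1 h'

/-- The complex conjugates of the elements of a basis. -/
theorem exists_star_basis {ι : Type*} (B : HilbertBasis ι ℂ (Lp ℂ 2 μ)) :
    ∃ B' : HilbertBasis ι ℂ (Lp ℂ 2 μ), ∀ i, B' i = star (B i) := by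
  classical
  have ho : Orthonormal ℂ fun i => star (B i) := by
    rw [orthonormal_iff_ite]
    intro i j
    rw [inner_star_star, orthonormal_iff_ite.1 B.orthonormal]
    simp [eq_comm]
  have hs : (Submodule.span ℂ (Set.range fun i => star (B i)))ᗮ = ⊥ := by
    rw [Submodule.eq_bot_iff]
    intro f hf
    have h1 := hasSum_norm_inner_sq B (star f)
    have h2 : ∀ i, ⟪B i, star f⟫_ℂ = 0 := fun i => by
      have h3 := Submodule.inner_right_of_mem_orthogonal
        (Submodule.subset_span (Set.mem_range_self i)) hf
      rw [← inner_star_star, star_star, ← inner_conj_symm, h3, map_zero]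
    simp only [h2, norm_zero, ne_eq, OfNat.ofNat_ne_zero, not_false_eq_true, zero_pow] at h1
    have h4 := h1.unique hasSum_zero
    rw [norm_star_Lp] at h4
    simpa using h4
  exact ⟨HilbertBasis.mkOfOrthogonalEqBot ho hs, fun i => by
    rw [HilbertBasis.coe_mkOfOrthogonalEqBot]⟩

theorem memLp_tensor (f g : Lp ℂ 2 μ) :
    MemLp (fun z : Ω × Ω => f z.1 * g z.2) 2 (μ.prod μ) := by
  have hm : AEStronglyMeasurable (fun z : Ω × Ω => f z.1 * g z.2) (μ.prod μ) :=
    (Lp.aestronglyMeasurable f).comp_fst.mul (Lp.aestronglyMeasurable g).comp_snd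
  rw [memLp_two_iff_integrable_sq_norm hm]
  simp only [norm_mul, mul_pow]
  exact (integrable_norm_sq f).mul_prod (integrable_norm_sq g)

/-- The kernel `f(x) g(y)`. -/
noncomputable def tensor (f g : Lp ℂ 2 μ) : Lp ℂ 2 (μ.prod μ) := (memLp_tensor f g).toLp

theorem inner_tensor (f g : Lp ℂ 2 μ) (α : Lp ℂ 2 (μ.prod μ)) :
    ⟪tensor f g, α⟫_ℂ = ∫ z, conj (f z.1 * g z.2) * α z ∂(μ.prod μ) := by
  rw [L2.inner_def]
  refine integral_congr_ae ?_
  filter_upwards [(memLp_tensor f g).coeFn_toLp] with z hz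
  rw [tensor, hz, RCLike.inner_apply']

variable [SigmaFinite μ]

theorem inner_tensor_tensor (f g f' g' : Lp ℂ 2 μ) :
    ⟪tensor f g, tensor f' g'⟫_ℂ = ⟪f, f'⟫_ℂ * ⟪g, g'⟫_ℂ := by
  rw [inner_tensor, L2.inner_def, L2.inner_def, ← integral_prod_mul]
  refine integral_congr_ae ?_
  filter_upwards [(memLp_tensor f' g').coeFn_toLp] with z hz
  rw [tensor, hz, RCLike.inner_apply', RCLike.inner_apply', map_mul]
  ring

theorem inner_tensor_eq_iterated (f g : Lp ℂ 2 μ) (α : Lp ℂ 2 (μ.prod μ)) :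
    ⟪tensor f g, α⟫_ℂ = ∫ x, conj (f x) * ∫ y, conj (g y) * α (x, y) ∂μ ∂μ := by
  have hi : Integrable (fun z : Ω × Ω => conj (f z.1 * g z.2) * α z) (μ.prod μ) := by
    refine (L2.integrable_inner (𝕜 := ℂ) (tensor f g) α).congr ?_
    filter_upwards [(memLp_tensor f g).coeFn_toLp] with z hz
    rw [tensor, hz, RCLike.inner_apply']
  rw [inner_tensor, integral_prod _ hi]
  congr 1
  ext x
  rw [← integral_const_mul]
  congr 1
  ext y
  rw [map_mul, mul_assoc]

theorem ae_memLp_slice (α : Lp ℂ 2 (μ.prod μ)) : ∀ᵐ x ∂μ, MemLp (fun y => α (x, y)) 2 μ := by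
  filter_upwards [(integrable_norm_sq α).prod_right_ae,
    (Lp.aestronglyMeasurable α).prodMk_left] with x h1 h2
  exact (memLp_two_iff_integrable_sq_norm h2).2 h1

/-- For fixed `j`, the function `x ↦ ⟨B j, α(x, ·)⟩` is in `L²` by Cauchy-Schwarz and has vanishing
coefficients. Countability lets the exceptional null sets be united, so almost every slice vanishes.
-/
theorem eq_zero_of_inner_tensor {ι : Type*} [Countable ι] (B : HilbertBasis ι ℂ (Lp ℂ 2 μ))
    (α : Lp ℂ 2 (μ.prod μ)) (h : ∀ i j, ⟪tensor (B i) (B j), α⟫_ℂ = 0) : α = 0 := by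
  have hG : ∀ j, ∀ᵐ x ∂μ, ∫ y, conj (B j y) * α (x, y) ∂μ = 0 := by
    intro j
    set G : Ω → ℂ := fun x => ∫ y, conj (B j y) * α (x, y) ∂μ with hGd
    have hGm : AEStronglyMeasurable G μ := by
      have h1 : AEStronglyMeasurable (fun z : Ω × Ω => conj (B j z.2) * α z) (μ.prod μ) :=
        (Complex.continuous_conj.comp_aestronglyMeasurable
          (Lp.aestronglyMeasurable (B j)).comp_snd).mul (Lp.aestronglyMeasurable α)
      exact h1.integral_prod_right'
    have hG2 : MemLp G 2 μ := by
      rw [memLp_two_iff_integrable_sq_norm hGm]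
      refine (integrable_norm_sq α).integral_prod_left.mono' (hGm.norm.pow 2) ?_
      filter_upwards [ae_memLp_slice α] with x hx
      have h1 : G x = ⟪B j, hx.toLp⟫_ℂ := (inner_toLp_right hx _).symm
      have h2 : ‖G x‖ ≤ ‖hx.toLp‖ := by
        rw [h1]
        simpa [B.orthonormal.1 j] using norm_inner_le_norm (𝕜 := ℂ) (B j) hx.toLp
      rw [Real.norm_of_nonneg (by positivity), ← norm_toLp_sq hx]
      gcongr
    have h0 : hG2.toLp = 0 := by
      have h1 := hasSum_norm_inner_sq B hG2.toLp
      have h2 : ∀ i, ⟪B i, hG2.toLp⟫_ℂ = 0 := fun i => by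
        rw [inner_toLp_right, ← inner_tensor_eq_iterated, h]
      simp only [h2, norm_zero, ne_eq, OfNat.ofNat_ne_zero, not_false_eq_true, zero_pow] at h1
      exact norm_eq_zero.1 (pow_eq_zero_iff two_ne_zero |>.1 (h1.unique hasSum_zero))
    have h3 := hG2.coeFn_toLp
    rw [h0] at h3
    filter_upwards [h3, Lp.coeFn_zero ℂ 2 μ] with x h4 h5
    exact h4.symm.trans h5
  have h1 : ∀ᵐ x ∂μ, ∫ y, ‖α (x, y)‖ ^ 2 ∂μ = 0 := by
    filter_upwards [ae_all_iff.2 hG, ae_memLp_slice α] with x h2 hx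
    have h3 := hasSum_norm_inner_sq B hx.toLp
    have h4 : ∀ i, ⟪B i, hx.toLp⟫_ℂ = 0 := fun i => by rw [inner_toLp_right, h2]
    simp only [h4, norm_zero, ne_eq, OfNat.ofNat_ne_zero, not_false_eq_true, zero_pow] at h3
    rw [← norm_toLp_sq hx]
    exact h3.unique hasSum_zero
  have h2 : ‖α‖ ^ 2 = 0 := by
    rw [← integral_norm_sq_eq, integral_prod _ (integrable_norm_sq α)]
    exact integral_eq_zero_of_ae h1
  simpa using h2

/-- The products of the elements of a basis. -/
theorem exists_tensor_basis {ι : Type*} [Countable ι] (B : HilbertBasis ι ℂ (Lp ℂ 2 μ)) :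
    ∃ T : HilbertBasis (ι × ι) ℂ (Lp ℂ 2 (μ.prod μ)), ∀ p, T p = tensor (B p.1) (B p.2) := by
  classical
  have ho : Orthonormal ℂ fun p : ι × ι => tensor (B p.1) (B p.2) := by
    rw [orthonormal_iff_ite]
    intro p p'
    rw [inner_tensor_tensor, orthonormal_iff_ite.1 B.orthonormal,
      orthonormal_iff_ite.1 B.orthonormal]
    by_cases h1 : p.1 = p'.1 <;> by_cases h2 : p.2 = p'.2 <;> simp [h1, h2, Prod.ext_iff]
  have hs : (Submodule.span ℂ (Set.range fun p : ι × ι => tensor (B p.1) (B p.2)))ᗮ = ⊥ := by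
    rw [Submodule.eq_bot_iff]
    intro α hα
    refine eq_zero_of_inner_tensor B α fun i j => ?_
    exact Submodule.inner_right_of_mem_orthogonal
      (Submodule.subset_span (Set.mem_range_self ((i, j) : ι × ι))) hα
  exact ⟨HilbertBasis.mkOfOrthogonalEqBot ho hs, fun p => by
    rw [HilbertBasis.coe_mkOfOrthogonalEqBot]⟩

end Tensor

namespace Cell

variable {X : Cell}

/-- The kernel acts on functions in `𝔥*`, the conjugates of elements of `𝔥`, hence the `star` on the
argument. -/
theorem HasKernel.inner_star {A : X.H →L[ℂ] X.H} {α : X.HS} (h : HasKernel A α) (f g : X.H) :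
    ⟪f, A (star g)⟫_ℂ = ⟪tensor f g, α⟫_ℂ := by
  rw [inner_tensor_eq_iterated, inner_eq_integral]
  refine integral_congr_ae ?_
  filter_upwards [h (star g)] with x hx
  rw [hx]
  congr 1
  refine integral_congr_ae ?_
  filter_upwards [coeFn_star_ae g] with y hy
  rw [hy, mul_comm]

/-- The Hilbert-Schmidt norm of an operator is the `L²` norm of its kernel. -/
theorem HasKernel.tsum_norm_sq {ι : Type*} [Countable ι] (B : HilbertBasis ι ℂ X.H)
    {A : X.H →L[ℂ] X.H} {α : X.HS} (h : HasKernel A α) :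
    ∑' i, ENNReal.ofReal (‖A.adjoint (B i)‖ ^ 2) = ENNReal.ofReal (‖α‖ ^ 2) := by
  obtain ⟨T, hT⟩ := exists_tensor_basis B
  obtain ⟨B', hB'⟩ := exists_star_basis B
  rw [← tsum_ofReal_norm_inner_sq T, ENNReal.tsum_prod']
  congr 1
  ext i
  rw [← tsum_ofReal_norm_inner_sq B']
  congr 1
  ext j
  rw [ContinuousLinearMap.adjoint_inner_right, hB', norm_inner_symm, h.inner_star, hT]

end Cell

end BdG

namespace BdG

/-! ### Diagonal operators -/

section Diagonal

variable {E ι : Type*} [NormedAddCommGroup E] [InnerProductSpace ℂ E]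
  (B : HilbertBasis ι ℂ E) {D D' : E →L[ℂ] E} {d d' : ι → ℝ}

theorem HilbertBasis.ext_inner {x y : E} (h : ∀ i, ⟪B i, x⟫_ℂ = ⟪B i, y⟫_ℂ) : x = y := by
  apply B.repr.injective
  ext i
  rw [B.repr_apply_apply, B.repr_apply_apply, h]

/-- Continuity lets `D` act termwise on the expansion of `x`. Self-adjointness is not assumed: it is
deduced from this in `adjoint_diagonal`, since the `d i` are real. -/
theorem inner_diagonal (hD : ∀ i, D (B i) = (d i : ℂ) • B i) (x : E) (i : ι) :
    ⟪B i, D x⟫_ℂ = d i * ⟪B i, x⟫_ℂ := by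
  classical
  have h1 := ((B.hasSum_repr x).mapL D).mapL (innerSL ℂ (B i))
  have h2 : ∀ j, innerSL ℂ (B i) (D (B.repr x j • B j))
      = if j = i then d i * ⟪B i, x⟫_ℂ else 0 := by
    intro j
    rw [innerSL_apply_apply, map_smul, hD, inner_smul_right, inner_smul_right,
      orthonormal_iff_ite.1 B.orthonormal, B.repr_apply_apply]
    by_cases h : j = i
    · subst h
      simp [mul_comm]
    · simp [h, Ne.symm h]
  simp only [h2] at h1
  exact h1.unique (by simpa using hasSum_ite_eq i (d i * ⟪B i, x⟫_ℂ))

theorem hasSum_re_inner_diagonal (hD : ∀ i, D (B i) = (d i : ℂ) • B i) (x : E) :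
    HasSum (fun i => d i * ‖⟪B i, x⟫_ℂ‖ ^ 2) (⟪x, D x⟫_ℂ).re := by
  have h := Complex.hasSum_re (B.hasSum_inner_mul_inner x (D x))
  have h1 : ∀ i, (⟪x, B i⟫_ℂ * ⟪B i, D x⟫_ℂ).re = d i * ‖⟪B i, x⟫_ℂ‖ ^ 2 := by
    intro i
    rw [inner_diagonal B hD, mul_left_comm, ← inner_conj_symm, mul_comm (conj _), Complex.mul_conj,
      Complex.re_ofReal_mul, Complex.ofReal_re, Complex.normSq_eq_norm_sq]
  simpa only [h1] using h

theorem re_inner_diagonal_mono (hD : ∀ i, D (B i) = (d i : ℂ) • B i)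
    (hD' : ∀ i, D' (B i) = (d' i : ℂ) • B i) (h : ∀ i, d i ≤ d' i) (x : E) :
    (⟪x, D x⟫_ℂ).re ≤ (⟪x, D' x⟫_ℂ).re :=
  hasSum_le (fun i => mul_le_mul_of_nonneg_right (h i) (by positivity))
    (hasSum_re_inner_diagonal B hD x) (hasSum_re_inner_diagonal B hD' x)

theorem adjoint_diagonal [CompleteSpace E] (hD : ∀ i, D (B i) = (d i : ℂ) • B i) :
    D.adjoint = D := by
  ext x
  refine HilbertBasis.ext_inner B fun i => ?_
  rw [ContinuousLinearMap.adjoint_inner_right, hD, inner_smul_left, Complex.conj_ofReal,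
    inner_diagonal B hD]

theorem diagonal_nonneg [CompleteSpace E] (hD : ∀ i, D (B i) = (d i : ℂ) • B i)
    (h : ∀ i, 0 ≤ d i) : 0 ≤ D := by
  rw [ContinuousLinearMap.nonneg_iff_isPositive, ContinuousLinearMap.isPositive_def']
  refine ⟨adjoint_diagonal B hD, fun x => ?_⟩
  rw [ContinuousLinearMap.reApplyInnerSelf_apply, ← ContinuousLinearMap.adjoint_inner_right,
    adjoint_diagonal B hD]
  exact (hasSum_re_inner_diagonal B hD x).nonneg fun i => mul_nonneg (h i) (by positivity)

end Diagonal

/-! ### The symbols -/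

namespace Cell

theorem fermi_pos (x : ℝ) : 0 < fermi x := inv_pos.2 (by positivity)

theorem fermi_lt_one (x : ℝ) : fermi x < 1 :=
  inv_lt_one_of_one_lt₀ (by linarith [Real.exp_pos (2 * x)])

theorem fermi_le_exp (x : ℝ) : fermi x ≤ Real.exp (-(2 * x)) := by
  rw [fermi, Real.exp_neg]
  exact inv_anti₀ (Real.exp_pos _) (by linarith)

theorem fermi_strictAnti : StrictAnti fermi := by
  intro x y h
  exact inv_strictAnti₀ (by positivity) (by gcongr)

theorem sinh_le_mul_cosh {r : ℝ} (hr : 0 ≤ r) : Real.sinh r ≤ r * Real.cosh r := by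
  have hd : ∀ x : ℝ, HasDerivAt (fun x => x * Real.cosh x - Real.sinh x) (x * Real.sinh x) x := by
    intro x
    refine (((hasDerivAt_id x).mul (Real.hasDerivAt_cosh x)).sub
      (Real.hasDerivAt_sinh x)).congr_deriv ?_
    simp
  have hm : MonotoneOn (fun x => x * Real.cosh x - Real.sinh x) (Set.Ici 0) := by
    refine monotoneOn_of_deriv_nonneg (convex_Ici 0)
      (fun x _ => (hd x).continuousAt.continuousWithinAt)
      (fun x _ => (hd x).differentiableAt.differentiableWithinAt) fun x hx => ?_
    rw [interior_Ici] at hx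
    rw [(hd x).deriv]
    exact mul_nonneg (le_of_lt hx) (Real.sinh_nonneg_iff.2 (le_of_lt hx))
  have := hm (Set.mem_Ici.2 le_rfl) (Set.mem_Ici.2 hr) hr
  simp at this
  linarith

theorem tanh_add_tanh (u v : ℝ) :
    Real.tanh u + Real.tanh v = Real.sinh (u + v) / (Real.cosh u * Real.cosh v) := by
  have h1 := (Real.cosh_pos u).ne'
  have h2 := (Real.cosh_pos v).ne'
  rw [Real.tanh_eq_sinh_div_cosh, Real.tanh_eq_sinh_div_cosh, Real.sinh_add]
  field_simp

/-- With `r = (u + v) / 2` and `d = (u - v) / 2`: `sinh (2r) = 2 sinh r cosh r ≤ 2r cosh² r`, and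
`cosh u cosh v = cosh² r + sinh² d ≥ cosh² r`. -/
theorem sinh_le_mul_cosh_mul_cosh {u v : ℝ} (h : 0 ≤ u + v) :
    Real.sinh (u + v) ≤ (u + v) * (Real.cosh u * Real.cosh v) := by
  set r := (u + v) / 2 with hr
  have h1 := sinh_le_mul_cosh (r := r) (by positivity)
  have h2 : Real.sinh (u + v) = 2 * Real.sinh r * Real.cosh r := by
    rw [← Real.sinh_two_mul, hr]; ring_nf
  have h3 : Real.cosh r ^ 2 ≤ Real.cosh u * Real.cosh v := by
    have e1 : Real.cosh u = Real.cosh (r + (u - v) / 2) := by rw [hr]; ring_nf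
    have e2 : Real.cosh v = Real.cosh (r - (u - v) / 2) := by rw [hr]; ring_nf
    have a1 := Real.cosh_sq r
    have a2 := Real.cosh_sq ((u - v) / 2)
    rw [e1, e2, Real.cosh_add, Real.cosh_sub]
    nlinarith [sq_nonneg (Real.sinh ((u - v) / 2)), sq_nonneg (Real.sinh r)]
  have h4 : u + v = 2 * r := by rw [hr]; ring
  have h5 := Real.cosh_pos r
  have h6 : 0 ≤ r := by positivity
  calc Real.sinh (u + v) = 2 * Real.sinh r * Real.cosh r := h2
    _ ≤ 2 * (r * Real.cosh r) * Real.cosh r := by gcongr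
    _ = 2 * r * Real.cosh r ^ 2 := by ring
    _ ≤ 2 * r * (Real.cosh u * Real.cosh v) := by gcongr
    _ = _ := by rw [h4]

/-- In the variables `u = x / T`, `v = y / T` the quotient is `T (u + v) cosh u cosh v / sinh (u +
v)`, so the claim is the preceding inequality. A negative sum reduces to a positive one by changing
both signs. -/
theorem le_kSymbol {T : ℝ} (hT : 0 < T) (x y : ℝ) : T ≤ kSymbol T x y := by
  rw [kSymbol]
  split_ifs with h
  · exact le_mul_of_one_le_right hT.le (one_le_pow₀ (Real.one_le_cosh _))
  have key : ∀ u v : ℝ, 0 < u + v → 1 ≤ (u + v) / (Real.tanh u + Real.tanh v) := by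
    intro u v huv
    have hc : 0 < Real.cosh u * Real.cosh v := mul_pos (Real.cosh_pos u) (Real.cosh_pos v)
    have hs : 0 < Real.sinh (u + v) := Real.sinh_pos_iff.2 huv
    rw [tanh_add_tanh, div_div_eq_mul_div, le_div_iff₀ hs, one_mul]
    exact sinh_le_mul_cosh_mul_cosh huv.le
  have h1 : 1 ≤ (x / T + y / T) / (Real.tanh (x / T) + Real.tanh (y / T)) := by
    rcases lt_or_gt_of_ne h with hlt | hgt
    · have h2 := key (-(x / T)) (-(y / T)) (by
        rw [← neg_add, ← add_div]
        exact neg_pos.2 (div_neg_of_neg_of_pos hlt hT))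
      rwa [Real.tanh_neg, Real.tanh_neg, ← neg_add, ← neg_add, neg_div_neg_eq] at h2
    · exact key _ _ (by rw [← add_div]; exact div_pos hgt hT)
  rw [← add_div, div_right_comm, le_div_iff₀ hT, one_mul] at h1
  exact h1

/-- The numerator is at least `2 H`, and the denominator is below `2` because `tanh < 1`. The bound
survives as `T` tends to zero. -/
theorem le_kSymbol_of_le {T H x y : ℝ} (hT : 0 < T) (hH : 0 < H) (hx : H ≤ x) (hy : H ≤ y) :
    H ≤ kSymbol T x y := by
  rw [kSymbol, if_neg (by linarith)]
  have h0 : 0 < Real.tanh (x / T) + Real.tanh (y / T) := by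
    rw [tanh_add_tanh]
    have : 0 < x / T + y / T := by rw [← add_div]; exact div_pos (by linarith) hT
    exact div_pos (Real.sinh_pos_iff.2 this) (mul_pos (Real.cosh_pos _) (Real.cosh_pos _))
  have h1 := Real.tanh_lt_one (x / T)
  have h2 := Real.tanh_lt_one (y / T)
  rw [le_div_iff₀ h0]
  nlinarith

/-! ### Normal states -/

variable {X : Cell} {v : ℝ × ℝ → ℝ} {μ T ξ : ℝ} {γ : X.H →L[ℂ] X.H}

/-- The eigenvalues of the one-particle Hamiltonian. -/
noncomputable def level (X : Cell) (μ ξ : ℝ) (k : ℕ) : ℝ := (2 * k + 1) * X.b - μ + ξ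

theorem IsNormalState.apply_basis (h : IsNormalState v μ T ξ γ)
    {B : HilbertBasis (ℕ × Fin X.n) ℂ X.H} (hB : ∀ i, B i ∈ X.eigenspace ((2 * i.1 + 1) * X.b))
    (i : ℕ × Fin X.n) : γ (B i) = (fermi (X.level μ ξ i.1 / T) : ℂ) • B i :=
  h.fixed_point _ _ (hB i)

theorem IsNormalState.trace_eq (h : IsNormalState v μ T ξ γ) :
    trace γ = X.n * ∑' k : ℕ, ENNReal.ofReal (fermi (X.level μ ξ k / T)) := by
  obtain ⟨B, hB⟩ := X.exists_landau_basis
  have hd := h.apply_basis hB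
  rw [trace_eq_tsum B (diagonal_nonneg B hd fun i => (fermi_pos _).le), ENNReal.tsum_prod',
    ← ENNReal.tsum_mul_left]
  congr 1
  ext k
  have h1 : ∀ j, (⟪B (k, j), γ (B (k, j))⟫_ℂ).re = fermi (X.level μ ξ k / T) := by
    intro j
    rw [hd, inner_smul_right, inner_self_eq_norm_sq_to_K, B.orthonormal.1]
    simp
  simp [h1]

theorem fermi_le_half_pow {x : ℝ} {m : ℕ} (h : m ≤ x) : fermi x ≤ (1 / 2) ^ m := by
  refine (fermi_le_exp _).trans ?_
  have hm : (0 : ℝ) ≤ m := Nat.cast_nonneg m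
  calc Real.exp (-(2 * x)) ≤ Real.exp (-m) := Real.exp_le_exp.2 (by linarith)
    _ = Real.exp (-1) ^ m := by rw [← Real.exp_nat_mul]; ring_nf
    _ ≤ (1 / 2) ^ m := by
      refine pow_le_pow_left₀ (Real.exp_nonneg _) ?_ m
      rw [Real.exp_neg, one_div]
      exact inv_anti₀ (by norm_num) (by linarith [Real.add_one_le_exp (1 : ℝ)])

theorem natCast_le_level_div {s : ℝ} {N : ℕ} (hN : s / 2 ≤ N) (hT : 0 < T) (hTb : T ≤ X.b)
    (hμ : μ ≤ X.b) (hξ : -(s * X.b) ≤ ξ) (m : ℕ) : (m : ℝ) ≤ X.level μ ξ (m + N) / T := by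
  rw [le_div_iff₀ hT, level, Nat.cast_add]
  have hm : (0 : ℝ) ≤ m := Nat.cast_nonneg m
  have a1 : (m : ℝ) * T ≤ m * X.b := mul_le_mul_of_nonneg_left hTb hm
  have a2 : s / 2 * X.b ≤ N * X.b := mul_le_mul_of_nonneg_right hN X.b_pos.le
  have a3 : 0 ≤ m * X.b := mul_nonneg hm X.b_pos.le
  linarith

theorem tsum_le_of_le_half_pow {f : ℕ → ℝ≥0∞} {N : ℕ} (h0 : ∀ k, f k ≤ 1)
    (h1 : ∀ m, f (m + N) ≤ (1 / 2 : ℝ≥0∞) ^ m) : ∑' k, f k ≤ N + 2 := by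
  rw [← Summable.sum_add_tsum_nat_add' (f := f) (k := N) ENNReal.summable]
  refine add_le_add ((Finset.sum_le_sum fun k _ => h0 k).trans (by simp)) ?_
  refine (ENNReal.tsum_le_tsum h1).trans ?_
  rw [ENNReal.tsum_geometric]
  simp

/-- A potential `ξ ≥ -s b` can bring at most about `s / 2` levels below the Fermi energy, as they
are `2b` apart. The first `⌈s / 2⌉` levels count at most one each, the others form a geometric
series of sum `2`, and rounding up costs the last unit. -/
theorem tsum_fermi_level_le {s : ℝ} (hs : 0 ≤ s) (hT : 0 < T) (hTb : T ≤ X.b) (hμ : μ ≤ X.b)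
    (hξ : -(s * X.b) ≤ ξ) :
    ∑' k : ℕ, ENNReal.ofReal (fermi (X.level μ ξ k / T)) ≤ ENNReal.ofReal (s / 2 + 3) := by
  have hN1 : s / 2 ≤ (⌈s / 2⌉₊ : ℝ) := Nat.le_ceil _
  have hN2 : (⌈s / 2⌉₊ : ℝ) < s / 2 + 1 := Nat.ceil_lt_add_one (by positivity)
  generalize ⌈s / 2⌉₊ = N at hN1 hN2
  have h1 : ∀ m : ℕ, ENNReal.ofReal (fermi (X.level μ ξ (m + N) / T)) ≤ (1 / 2 : ℝ≥0∞) ^ m := by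
    intro m
    refine (ENNReal.ofReal_le_ofReal
      (fermi_le_half_pow (natCast_le_level_div hN1 hT hTb hμ hξ m))).trans ?_
    rw [ENNReal.ofReal_pow (by norm_num), ENNReal.ofReal_div_of_pos (by norm_num)]
    simp
  have h2 : ∀ k : ℕ, ENNReal.ofReal (fermi (X.level μ ξ k / T)) ≤ 1 := fun k => by
    rw [← ENNReal.ofReal_one]
    exact ENNReal.ofReal_le_ofReal (fermi_lt_one _).le
  have h3 : (N : ℝ≥0∞) + 2 = ENNReal.ofReal (N + 2) := by
    rw [ENNReal.ofReal_add (by positivity) (by norm_num)]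
    simp
  refine (tsum_le_of_le_half_pow h2 h1).trans ?_
  rw [h3]
  exact ENNReal.ofReal_le_ofReal (by linarith)

/-- A bound on the self-interaction potential of the normal state. -/
theorem IsNormalState.neg_mul_le_potential (h : IsNormalState v μ T ξ γ)
    (hv : |∫ y, v y ∂X.vol| ≤ 1) (hT : 0 < T) (hTb : T ≤ X.b) (hμ : μ ≤ X.b) :
    -(2 / 3 * X.b) ≤ ξ := by
  by_contra hlt
  rw [not_le] at hlt
  have hb := X.b_pos
  have hA := X.area_pos
  have hn := X.n_cast_pos
  -- The depth of the potential in units of `b`. The filling bound in terms of `s`, inserted into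
  -- the self-consistency equation, bounds `s` itself.
  set s := -ξ / X.b with hs
  have hs0 : 0 ≤ s := div_nonneg (by nlinarith) hb.le
  have hsb : s * X.b = -ξ := by rw [hs]; field_simp
  have h1 := tsum_fermi_level_le (ξ := ξ) hs0 hT hTb hμ (by rw [hsb]; linarith)
  have h2 : (trace γ).toReal ≤ X.n * (s / 2 + 3) := by
    rw [h.trace_eq]
    refine ENNReal.toReal_le_of_le_ofReal (by positivity) ?_
    rw [ENNReal.ofReal_mul hn.le, ENNReal.ofReal_natCast]
    gcongr
  have h3 : |ξ| ≤ X.n * (s / 2 + 3) / X.area := by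
    rw [h.potential, abs_mul, abs_of_nonneg (div_nonneg ENNReal.toReal_nonneg hA.le)]
    calc _ ≤ 1 * ((trace γ).toReal / X.area) := by gcongr
      _ ≤ _ := by rw [one_mul]; gcongr
  have h4 : X.b = 2 * Real.pi * (X.n / X.area) := by rw [b]; ring
  -- The degeneracy per unit area is `b / (2π)`, and `π > 3`. The resulting inequality `s ≤ (s / 2 +
  -- 3) / 6` gives `s ≤ 6 / 11`, contradicting `s > 2 / 3`.
  have h5 : X.n / X.area ≤ X.b / 6 := by
    have : 0 < X.n / X.area := by positivity
    nlinarith [Real.pi_gt_three]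
  have h6 : -ξ ≤ X.b / 6 * (s / 2 + 3) := by
    refine ((neg_le_abs ξ).trans h3).trans ?_
    rw [mul_div_right_comm]
    gcongr
  nlinarith

/-! ### Positivity of `L` -/

theorem integral_potential_mul_norm_sq_ge {M : ℝ} (hv : IsPairPotential X M v) (α : X.HS) :
    -(M * ‖α‖ ^ 2) ≤ ∫ z, v (z.1 - z.2) * ‖α z‖ ^ 2 ∂(X.vol.prod X.vol) := by
  have hi := integrable_norm_sq α
  rw [← integral_norm_sq_eq, ← integral_const_mul, ← integral_neg]
  have hm : AEStronglyMeasurable (fun z : (ℝ × ℝ) × ℝ × ℝ => v (z.1 - z.2))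
      (X.vol.prod X.vol) := (hv.measurable.comp measurable_sub).aestronglyMeasurable
  refine integral_mono (hi.const_mul M).neg (hi.bdd_mul hm (ae_of_all _ fun z => hv.bound _))
    fun z => ?_
  have := (abs_le.1 (hv.bound (z.1 - z.2))).1
  have h2 := mul_le_mul_of_nonneg_right this (sq_nonneg ‖α z‖)
  simp only
  linarith

theorem _root_.BdG.IsPairPotential.bound_nonneg {M : ℝ} (hv : IsPairPotential X M v) : 0 ≤ M :=
  (abs_nonneg _).trans (hv.bound 0)

/-- `IsK` prescribes coefficients against products of eigenfunctions only. The products of Landau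
functions form a basis, so Parseval gives the form of `K_{Tb}`, and `v♯` costs at most `M`. -/
theorem lPos_of_le_kSymbol {M K : ℝ} (hv : IsPairPotential X M v) (hMK : M < K)
    (hK : ∀ k k' : ℕ, K ≤ kSymbol T (X.level μ ξ k) (X.level μ ξ k')) : LPos X v μ T ξ := by
  obtain ⟨B, hB⟩ := X.exists_landau_basis
  obtain ⟨S, hS⟩ := exists_tensor_basis B
  refine ⟨K - M, sub_pos.2 hMK, fun α β ⟨κ, hκ, hβ⟩ => ?_⟩
  have h1 : K * ‖α‖ ^ 2 ≤ (⟪α, κ⟫_ℂ).re := by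
    refine hasSum_le (fun p => ?_) ((hasSum_norm_inner_sq S α).mul_left K)
      (Complex.hasSum_re (S.hasSum_inner_mul_inner α κ))
    have h2 := hκ _ _ _ (hB p.1) _ (hB p.2)
    rw [← inner_tensor, ← inner_tensor, ← hS] at h2
    rw [h2, mul_left_comm, ← inner_conj_symm α (S p), mul_comm (conj _), Complex.mul_conj,
      Complex.re_ofReal_mul, Complex.ofReal_re, Complex.normSq_eq_norm_sq]
    exact mul_le_mul_of_nonneg_right (hK _ _) (by positivity)
  have h3 : (⟪α, β - κ⟫_ℂ).re = ∫ z, v (z.1 - z.2) * ‖α z‖ ^ 2 ∂(X.vol.prod X.vol) := by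
    have h4 : ⟪α, β - κ⟫_ℂ
        = ∫ z, ((v (z.1 - z.2) * ‖α z‖ ^ 2 : ℝ) : ℂ) ∂(X.vol.prod X.vol) := by
      rw [L2.inner_def]
      refine integral_congr_ae ?_
      filter_upwards [hβ, Lp.coeFn_sub β κ] with z h5 h6
      rw [h6, Pi.sub_apply, h5, add_sub_cancel_left, RCLike.inner_apply', mul_left_comm,
        mul_comm (conj _), Complex.mul_conj, Complex.normSq_eq_norm_sq, ← Complex.ofReal_mul]
    rw [h4, integral_complex_ofReal, Complex.ofReal_re]
  have h7 := integral_potential_mul_norm_sq_ge hv α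
  have h8 : (⟪α, β⟫_ℂ).re = (⟪α, κ⟫_ℂ).re + (⟪α, β - κ⟫_ℂ).re := by
    rw [inner_sub_right, Complex.sub_re]
    ring
  rw [h8, h3]
  linarith

end Cell

end BdG

namespace BdG

/-! ### Orthonormal bases of a direct sum -/

section Prod

variable {E F ι ι' : Type*} [NormedAddCommGroup E] [InnerProductSpace ℂ E] [CompleteSpace E]
  [NormedAddCommGroup F] [InnerProductSpace ℂ F] [CompleteSpace F]

theorem exists_prod_basis (B : HilbertBasis ι ℂ E) (B' : HilbertBasis ι' ℂ F) :
    ∃ W : HilbertBasis (ι ⊕ ι') ℂ (WithLp 2 (E × F)),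
      (∀ i, W (Sum.inl i) = WithLp.toLp 2 (B i, 0)) ∧
        ∀ j, W (Sum.inr j) = WithLp.toLp 2 (0, B' j) := by
  classical
  set w : ι ⊕ ι' → WithLp 2 (E × F) :=
    Sum.elim (fun i => WithLp.toLp 2 (B i, 0)) fun j => WithLp.toLp 2 (0, B' j) with hw
  have ho : Orthonormal ℂ w := by
    rw [orthonormal_iff_ite]
    rintro (i | i) (j | j)
    · simpa [hw, WithLp.prod_inner_apply] using orthonormal_iff_ite.1 B.orthonormal i j
    · simp [hw, WithLp.prod_inner_apply]
    · simp [hw, WithLp.prod_inner_apply]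
    · simpa [hw, WithLp.prod_inner_apply] using orthonormal_iff_ite.1 B'.orthonormal i j
  have hc : (Submodule.span ℂ (Set.range w))ᗮ = ⊥ := by
    rw [Submodule.eq_bot_iff]
    intro z hz
    have h : ∀ a, ⟪w a, z⟫_ℂ = 0 := fun a =>
      (Submodule.mem_orthogonal _ _).1 hz _ (Submodule.subset_span ⟨a, rfl⟩)
    have h1 : z.fst = 0 := HilbertBasis.ext_inner B fun i => by
      simpa [hw, WithLp.prod_inner_apply] using h (Sum.inl i)
    have h2 : z.snd = 0 := HilbertBasis.ext_inner B' fun i => by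
      simpa [hw, WithLp.prod_inner_apply] using h (Sum.inr i)
    exact WithLp.ofLp_injective 2 (Prod.ext h1 h2)
  refine ⟨HilbertBasis.mkOfOrthogonalEqBot ho hc, fun i => ?_, fun j => ?_⟩
  · rw [HilbertBasis.coe_mkOfOrthogonalEqBot]; rfl
  · rw [HilbertBasis.coe_mkOfOrthogonalEqBot]; rfl

end Prod

/-! ### The operator matrix -/

namespace Cell

variable {X : Cell}

theorem conjOp_apply (A : X.H →L[ℂ] X.H) (f : X.H) : conjOp A f = star (A (star f)) := rfl

theorem conjOp_star (A : X.H →L[ℂ] X.H) (f : X.H) : conjOp A (star f) = star (A f) := by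
  rw [conjOp_apply, star_star]

theorem inner_conjOp (A : X.H →L[ℂ] X.H) (f g : X.H) :
    ⟪f, conjOp A g⟫_ℂ = ⟪A (star g), star f⟫_ℂ := by
  rw [conjOp_apply, ← inner_star_star, star_star]

theorem conjOp_diagonal {ι : Type*} {B : HilbertBasis ι ℂ X.H} {γ : X.H →L[ℂ] X.H} {q : ι → ℝ}
    (h : ∀ i, γ (B i) = (q i : ℂ) • B i) (i : ι) :
    conjOp γ (star (B i)) = (q i : ℂ) • star (B i) := by
  rw [conjOp_star, h, star_smul_Lp, Complex.conj_ofReal]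

theorem Gam_apply (γ A : X.H →L[ℂ] X.H) (z : WithLp 2 (X.H × X.H)) :
    Gam γ A z = WithLp.toLp 2
      (γ z.fst + A z.snd, A.adjoint z.fst + (z.snd - conjOp γ z.snd)) := rfl

theorem inner_Gam (γ A : X.H →L[ℂ] X.H) (z w : WithLp 2 (X.H × X.H)) :
    ⟪z, Gam γ A w⟫_ℂ = ⟪z.fst, γ w.fst⟫_ℂ + ⟪A.adjoint z.fst, w.snd⟫_ℂ
      + (⟪z.snd, A.adjoint w.fst⟫_ℂ + (⟪z.snd, w.snd⟫_ℂ - ⟪z.snd, conjOp γ w.snd⟫_ℂ)) := by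
  rw [Gam_apply, WithLp.prod_inner_apply]
  simp [inner_add_right, inner_sub_right, ContinuousLinearMap.adjoint_inner_left]

section Diagonal

variable {ι : Type*} {B : HilbertBasis ι ℂ X.H} {γ A : X.H →L[ℂ] X.H} {q : ι → ℝ}

theorem adjoint_Gam (h : γ.adjoint = γ) : (Gam γ A).adjoint = Gam γ A := by
  symm
  rw [ContinuousLinearMap.eq_adjoint_iff]
  intro z w
  rw [← inner_conj_symm, inner_Gam, inner_Gam, inner_conjOp, inner_conjOp]
  simp only [map_add, map_sub, inner_conj_symm]
  have h1 : ⟪γ z.fst, w.fst⟫_ℂ = ⟪z.fst, γ w.fst⟫_ℂ := by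
    rw [← ContinuousLinearMap.adjoint_inner_right, h]
  have h2 : ⟪star w.snd, γ (star z.snd)⟫_ℂ = ⟪γ (star w.snd), star z.snd⟫_ℂ := by
    rw [← ContinuousLinearMap.adjoint_inner_left, h]
  rw [h1, h2]
  ring

theorem re_inner_Gam (γ A : X.H →L[ℂ] X.H) (z : WithLp 2 (X.H × X.H)) :
    (⟪z, Gam γ A z⟫_ℂ).re = (⟪z.fst, γ z.fst⟫_ℂ).re + 2 * (⟪A.adjoint z.fst, z.snd⟫_ℂ).re
      + (‖z.snd‖ ^ 2 - (⟪star z.snd, γ (star z.snd)⟫_ℂ).re) := by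
  have h1 : (⟪z.snd, A.adjoint z.fst⟫_ℂ).re = (⟪A.adjoint z.fst, z.snd⟫_ℂ).re := by
    rw [← inner_conj_symm, Complex.conj_re]
  have h2 : (⟪z.snd, conjOp γ z.snd⟫_ℂ).re = (⟪star z.snd, γ (star z.snd)⟫_ℂ).re := by
    rw [inner_conjOp, ← inner_conj_symm, Complex.conj_re]
  have h3 : (⟪z.snd, z.snd⟫_ℂ).re = ‖z.snd‖ ^ 2 := by
    rw [inner_self_eq_norm_sq_to_K]
    norm_cast
  rw [inner_Gam]
  simp only [Complex.add_re, Complex.sub_re]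
  rw [h1, h2, h3]
  ring

theorem two_mul_abs_re_inner_le {x y : X.H} {c s : ℝ} (hc : 0 < c) (h : ‖x‖ ^ 2 ≤ c * s) :
    2 * |(⟪x, y⟫_ℂ).re| ≤ s + c * ‖y‖ ^ 2 := by
  have h1 : |(⟪x, y⟫_ℂ).re| ≤ ‖x‖ * ‖y‖ := (Complex.abs_re_le_norm _).trans (norm_inner_le_norm x y)
  have h2 : c * (2 * (‖x‖ * ‖y‖)) ≤ c * (s + c * ‖y‖ ^ 2) := by
    nlinarith [sq_nonneg (‖x‖ - c * ‖y‖)]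
  linarith [le_of_mul_le_mul_left h2 hc]

theorem re_inner_diagonal_le (hγ : ∀ i, γ (B i) = (q i : ℂ) • B i) {c : ℝ}
    (hq : ∀ i, q i ≤ 1 - c) (x : X.H) : (⟪x, γ x⟫_ℂ).re ≤ (1 - c) * ‖x‖ ^ 2 :=
  hasSum_le (fun i => mul_le_mul_of_nonneg_right (hq i) (by positivity))
    (hasSum_re_inner_diagonal B hγ x) ((hasSum_norm_inner_sq B x).mul_left (1 - c))

variable (hγ : ∀ i, γ (B i) = (q i : ℂ) • B i) {c : ℝ} (hc : 0 < c)
  (hq : ∀ i, q i ≤ 1 - c) (hA : ∀ x, ‖A.adjoint x‖ ^ 2 ≤ c * (⟪x, γ x⟫_ℂ).re)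

include hγ hc hq hA in
-- The cross term is absorbed by Cauchy-Schwarz with weight `c`: the part in `𝔥` by `γ`, through the
-- domination of `A.adjoint`, and the part in `𝔥*` by `1 - γ̄ ≥ c`.
theorem Gam_nonneg : 0 ≤ Gam γ A := by
  rw [ContinuousLinearMap.nonneg_iff_isPositive, ContinuousLinearMap.isPositive_def']
  have hadj := adjoint_Gam (A := A) (adjoint_diagonal B hγ)
  refine ⟨hadj, fun z => ?_⟩
  rw [ContinuousLinearMap.reApplyInnerSelf_apply, ← ContinuousLinearMap.adjoint_inner_right, hadj]
  change 0 ≤ (⟪z, Gam γ A z⟫_ℂ).re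
  rw [re_inner_Gam]
  have h1 := re_inner_diagonal_le hγ hq (star z.snd)
  rw [norm_star_Lp] at h1
  have h2 := two_mul_abs_re_inner_le (y := z.snd) hc (hA z.fst)
  have h3 := neg_abs_le (⟪A.adjoint z.fst, z.snd⟫_ℂ).re
  linarith

include hγ hc hq hA in
-- The same argument with particles and holes exchanged; the symmetry `α* = ᾱ` converts the bound on
-- `A.adjoint` into one on `A`, with `γ̄` in place of `γ`.
theorem Gam_le_one (hs : A.adjoint = conjOp A) : Gam γ A ≤ 1 := by
  have hadj := adjoint_Gam (A := A) (adjoint_diagonal B hγ)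
  have hadj' : (1 - Gam γ A).adjoint = 1 - Gam γ A := by
    rw [map_sub, hadj]
    congr 1
    exact star_one _
  rw [ContinuousLinearMap.le_def, ContinuousLinearMap.isPositive_def']
  refine ⟨hadj', fun z => ?_⟩
  rw [ContinuousLinearMap.reApplyInnerSelf_apply, ← ContinuousLinearMap.adjoint_inner_right,
    hadj']
  change 0 ≤ (⟪z, z - Gam γ A z⟫_ℂ).re
  have h0 : (⟪z, z⟫_ℂ).re = ‖z.fst‖ ^ 2 + ‖z.snd‖ ^ 2 := by
    rw [WithLp.prod_inner_apply, inner_self_eq_norm_sq_to_K, inner_self_eq_norm_sq_to_K]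
    norm_cast
  rw [inner_sub_right, Complex.sub_re, h0, re_inner_Gam]
  have h1 := re_inner_diagonal_le hγ hq z.fst
  have h4 : ‖A z.snd‖ ^ 2 ≤ c * (⟪star z.snd, γ (star z.snd)⟫_ℂ).re := by
    have := hA (star z.snd)
    rwa [hs, conjOp_star, norm_star_Lp] at this
  have h2 := two_mul_abs_re_inner_le (y := z.fst) hc h4
  have h5 : (⟪A.adjoint z.fst, z.snd⟫_ℂ).re = (⟪A z.snd, z.fst⟫_ℂ).re := by
    rw [ContinuousLinearMap.adjoint_inner_left, ← inner_conj_symm, Complex.conj_re]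
  rw [h5]
  have h3 := le_abs_self (⟪A z.snd, z.fst⟫_ℂ).re
  linarith

/-! ### Entropy -/

theorem opFun_negMulLog_nonneg {E : Type*} [NormedAddCommGroup E] [InnerProductSpace ℂ E]
    [CompleteSpace E] {G : E →L[ℂ] E} (h0 : 0 ≤ G) (h1 : G ≤ 1) :
    0 ≤ opFun Real.negMulLog G :=
  cfc_nonneg fun p hp =>
    Real.negMulLog_nonneg (spectrum_subset_unit h0 h1 p hp).1 (spectrum_subset_unit h0 h1 p hp).2

theorem entropy_eq {B' : HilbertBasis ι ℂ X.H} {W : HilbertBasis (ι ⊕ ι) ℂ (WithLp 2 (X.H × X.H))}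
    (hl : ∀ i, W (Sum.inl i) = WithLp.toLp 2 (B i, 0))
    (hr : ∀ i, W (Sum.inr i) = WithLp.toLp 2 (0, B' i)) (h0 : 0 ≤ Gam γ A) (h1 : Gam γ A ≤ 1) :
    entropy γ A = (∑' i, ENNReal.ofReal (⟪WithLp.toLp 2 (B i, 0),
        opFun Real.negMulLog (Gam γ A) (WithLp.toLp 2 (B i, 0))⟫_ℂ).re)
      + ∑' i, ENNReal.ofReal (⟪WithLp.toLp 2 (0, B' i),
        opFun Real.negMulLog (Gam γ A) (WithLp.toLp 2 (0, B' i))⟫_ℂ).re := by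
  rw [entropy, trace_eq_tsum W (opFun_negMulLog_nonneg h0 h1),
    Summable.tsum_sum ENNReal.summable ENNReal.summable]
  simp only [hl, hr]

include hγ in
-- An eigenvector of the normal state misses being one of the perturbed state by a vector in the
-- other summand. The defect is orthogonal to it, so the linear term of the convexity bounds
-- vanishes.
theorem Gam_particle (i : ι) :
    Gam γ A (WithLp.toLp 2 (B i, 0)) - (q i : ℂ) • WithLp.toLp 2 (B i, (0 : X.H))
      = WithLp.toLp 2 (0, A.adjoint (B i)) := by
  apply WithLp.ofLp_injective 2
  ext1 <;> simp [Gam_apply, hγ, -Complex.coe_smul]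

include hγ in
theorem Gam_hole (i : ι) :
    Gam γ A (WithLp.toLp 2 (0, star (B i)))
        - ((1 - q i : ℝ) : ℂ) • WithLp.toLp 2 ((0 : X.H), star (B i))
      = WithLp.toLp 2 (A (star (B i)), 0) := by
  apply WithLp.ofLp_injective 2
  ext1 <;> simp [Gam_apply, conjOp_diagonal hγ, sub_smul, -Complex.coe_smul]

include hγ hc hq hA in
/-- The entropy of a perturbed state. -/
theorem entropy_add_le (hq0 : ∀ i, 0 < q i) (hs : A.adjoint = conjOp A) {r : ℝ} (hr : 0 ≤ r)
    (hent : ∀ i p, 0 ≤ p → p ≤ 1 → Real.negMulLog p ≤ Real.negMulLog (q i)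
      + (-Real.log (q i) - 1) * (p - q i) - r * (p - q i) ^ 2) :
    entropy γ A + ENNReal.ofReal r * ∑' i, ENNReal.ofReal (‖A.adjoint (B i)‖ ^ 2)
      ≤ (∑' i, ENNReal.ofReal (Real.negMulLog (q i)))
      + ∑' i, ENNReal.ofReal (Real.negMulLog (1 - q i)) := by
  have h0 := Gam_nonneg hγ hc hq hA
  have h1 := Gam_le_one hγ hc hq hA hs
  obtain ⟨B', hB'⟩ := exists_star_basis B
  obtain ⟨W, hl, hr'⟩ := exists_prod_basis B B'
  rw [entropy_eq hl hr' h0 h1, add_right_comm, ← ENNReal.tsum_mul_left, ← ENNReal.tsum_add]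
  have hpos := (ContinuousLinearMap.nonneg_iff_isPositive _).1 (opFun_negMulLog_nonneg h0 h1)
  refine add_le_add (ENNReal.tsum_le_tsum fun i => ?_) (ENNReal.tsum_le_tsum fun i => ?_)
  · have hp : 0 ≤ (⟪WithLp.toLp 2 (B i, 0),
        opFun Real.negMulLog (Gam γ A) (WithLp.toLp 2 (B i, 0))⟫_ℂ).re :=
      hpos.re_inner_nonneg_right _
    rw [← ENNReal.ofReal_mul hr, ← ENNReal.ofReal_add hp (by positivity)]
    refine ENNReal.ofReal_le_ofReal ?_
    have h := re_inner_cfc_le h0 h1 Real.continuous_negMulLog (hent i) (WithLp.toLp 2 (B i, 0))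
    rw [Gam_particle hγ] at h
    simp [WithLp.prod_inner_apply, B.orthonormal.1] at h
    rw [opFun]
    simp
    linarith
  · refine ENNReal.ofReal_le_ofReal ?_
    -- Holes may have occupation close to one, where only the universal constant is available. Their
    -- quadratic gain is discarded; the particle sector already gives the full Hilbert-Schmidt norm.
    have h := re_inner_cfc_le h0 h1 Real.continuous_negMulLog
      (fun p hp hp1 => negMulLog_upper hp hp1 (q := 1 - q i) (by linarith [hq i])
        (by linarith [hq0 i])) (WithLp.toLp 2 (0, star (B i)))
    rw [Gam_hole hγ] at h
    simp [WithLp.prod_inner_apply, norm_star_Lp,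
      B.orthonormal.1] at h
    rw [opFun, hB']
    simp
    nlinarith

include hγ hc hq in
/-- The entropy of the normal state. -/
theorem entropy_zero (hq0 : ∀ i, 0 < q i) :
    entropy γ 0 = (∑' i, ENNReal.ofReal (Real.negMulLog (q i)))
      + ∑' i, ENNReal.ofReal (Real.negMulLog (1 - q i)) := by
  have hA : ∀ x, ‖(0 : X.H →L[ℂ] X.H).adjoint x‖ ^ 2 ≤ c * (⟪x, γ x⟫_ℂ).re := by
    intro x
    have := (hasSum_re_inner_diagonal B hγ x).nonneg fun i => mul_nonneg (hq0 i).le (by positivity)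
    simpa using mul_nonneg hc.le this
  have hs : (0 : X.H →L[ℂ] X.H).adjoint = conjOp 0 := by
    ext1 x
    have h0 : star (0 : X.H) = 0 := by rw [← norm_eq_zero, norm_star_Lp, norm_zero]
    rw [conjOp_apply, zero_apply, map_zero, zero_apply, h0]
  refine le_antisymm ?_ ?_
  · refine le_trans le_self_add (entropy_add_le hγ hc hq hA hq0 hs (r := 1 / 4) (by norm_num)
      fun i p hp hp1 => negMulLog_upper hp hp1 (hq0 i) (by linarith [hq i]))
  -- For the reverse inequality a parabola touching from below is enough: the off-diagonal part is
  -- zero, so its linear and quadratic terms both vanish on the basis.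
  have h0 := Gam_nonneg hγ hc hq hA
  have h1 := Gam_le_one hγ hc hq hA hs
  obtain ⟨B', hB'⟩ := exists_star_basis B
  obtain ⟨W, hl, hr'⟩ := exists_prod_basis B B'
  rw [entropy_eq hl hr' h0 h1]
  refine add_le_add (ENNReal.tsum_le_tsum fun i => ?_) (ENNReal.tsum_le_tsum fun i => ?_)
  · refine ENNReal.ofReal_le_ofReal ?_
    have h := le_re_inner_cfc h0 h1 Real.continuous_negMulLog
      (fun p hp _ => negMulLog_lower hp (hq0 i)) (WithLp.toLp 2 (B i, 0))
    rw [Gam_particle hγ] at h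
    simpa [opFun, WithLp.prod_inner_apply, WithLp.prod_norm_sq_eq_of_L2, B.orthonormal.1] using h
  · refine ENNReal.ofReal_le_ofReal ?_
    have h := le_re_inner_cfc h0 h1 Real.continuous_negMulLog
      (fun p hp _ => negMulLog_lower hp (q := 1 - q i) (by linarith [hq i]))
      (WithLp.toLp 2 (0, star (B i)))
    rw [Gam_hole hγ] at h
    rw [hB']
    simpa [opFun, WithLp.prod_inner_apply, WithLp.prod_norm_sq_eq_of_L2, norm_star_Lp,
      B.orthonormal.1] using h

end Diagonal

end Cell

end BdG

namespace BdG

namespace Cell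

variable {X : Cell} {v : ℝ × ℝ → ℝ} {μ T ξ : ℝ} {γ : X.H →L[ℂ] X.H}

/-! ### Finiteness of the free energy of the normal state -/

theorem fermi_le_one_sub (X : Cell) (μ ξ : ℝ) (hT : 0 < T) (k : ℕ) :
    fermi (X.level μ ξ k / T) ≤ 1 - (1 - fermi (X.level μ ξ 0 / T)) := by
  rw [sub_sub_cancel]
  refine fermi_strictAnti.antitone (div_le_div_of_nonneg_right ?_ hT.le)
  have : 0 ≤ k * X.b := mul_nonneg (Nat.cast_nonneg k) X.b_pos.le
  simp only [level, Nat.cast_zero]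
  linarith

/-- Apply `1 + x ≤ exp x` at `x = -log √q`. A square root of the Fermi factor still decays
exponentially, so `(2k + 1) √q` is one summable majorant for both kinetic energy and entropy. -/
theorem negMulLog_le_two_mul_sqrt {q : ℝ} (hq : 0 < q) : Real.negMulLog q ≤ 2 * √q := by
  have hs := Real.sqrt_pos.2 hq
  have h1 := Real.add_one_le_exp (-Real.log (√q))
  rw [Real.exp_neg, Real.exp_log hs] at h1
  have h2 : Real.log q = 2 * Real.log (√q) := by rw [Real.log_sqrt hq.le]; ring
  have h3 : q * (√q)⁻¹ = √q := by
    rw [← div_eq_mul_inv, Real.div_sqrt]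
  have h4 := mul_le_mul_of_nonneg_left h1 hq.le
  rw [h3] at h4
  rw [Real.negMulLog, h2]
  nlinarith

theorem negMulLog_one_sub_le {q : ℝ} (hq : q < 1) : Real.negMulLog (1 - q) ≤ q := by
  have hp : 0 < 1 - q := by linarith
  have h1 := Real.one_sub_inv_le_log_of_pos hp
  have h2 := mul_le_mul_of_nonneg_left h1 hp.le
  rw [mul_sub, mul_inv_cancel₀ hp.ne'] at h2
  rw [Real.negMulLog]
  linarith

theorem sqrt_fermi_le (x : ℝ) : √(fermi x) ≤ Real.exp (-x) := by
  rw [Real.sqrt_le_left (Real.exp_nonneg _), ← Real.exp_nat_mul]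
  refine (fermi_le_exp x).trans (le_of_eq ?_)
  push_cast
  ring_nf

theorem summable_mul_sqrt_fermi (X : Cell) (μ ξ : ℝ) (hT : 0 < T) :
    Summable fun k : ℕ => (2 * k + 1 : ℝ) * √(fermi (X.level μ ξ k / T)) := by
  have hb := X.b_pos
  set r := Real.exp (-(2 * X.b / T)) with hr
  have hr1 : ‖r‖ < 1 := by
    rw [Real.norm_eq_abs, abs_of_pos (Real.exp_pos _), Real.exp_lt_one_iff]
    exact neg_neg_of_pos (by positivity)
  have h1 := (summable_pow_mul_geometric_of_norm_lt_one 1 hr1).mul_left 2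
  have h2 := h1.add (summable_geometric_of_norm_lt_one hr1)
  refine (h2.mul_left (Real.exp (-((X.b - μ + ξ) / T)))).of_nonneg_of_le
    (fun k => by positivity) fun k => ?_
  have h3 : Real.exp (-(X.level μ ξ k / T)) = Real.exp (-((X.b - μ + ξ) / T)) * r ^ k := by
    rw [hr, ← Real.exp_nat_mul, ← Real.exp_add, level]
    congr 1
    ring
  calc (2 * k + 1 : ℝ) * √(fermi (X.level μ ξ k / T))
      ≤ (2 * k + 1) * Real.exp (-(X.level μ ξ k / T)) :=
        mul_le_mul_of_nonneg_left (sqrt_fermi_le _) (by positivity)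
    _ = _ := by rw [h3]; ring

theorem tsum_levels_lt_top (hT : 0 < T) {f : ℕ → ℝ} {K : ℝ}
    (hf : ∀ k, f k ≤ K * ((2 * k + 1) * √(fermi (X.level μ ξ k / T)))) :
    ∑' i : ℕ × Fin X.n, ENNReal.ofReal (f i.1) < ⊤ := by
  have hs := (summable_mul_sqrt_fermi X μ ξ hT).mul_left K
  have h1 : ∑' i : ℕ × Fin X.n, ENNReal.ofReal (f i.1) = X.n * ∑' k, ENNReal.ofReal (f k) := by
    rw [ENNReal.tsum_prod', ← ENNReal.tsum_mul_left]
    simp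
  rw [h1]
  refine ENNReal.mul_lt_top (ENNReal.natCast_lt_top _) ?_
  refine lt_of_le_of_lt (ENNReal.tsum_le_tsum fun k => ENNReal.ofReal_le_ofReal (hf k)) ?_
  exact hs.tsum_ofReal_lt_top

theorem fermi_le_sqrt (x : ℝ) : fermi x ≤ √(fermi x) :=
  Real.le_sqrt_of_sq_le (by nlinarith [fermi_pos x, fermi_lt_one x])

/-- Orthogonality of distinct weak eigenspaces is read off from the bounded self-adjoint `γ`: it is
a strictly monotone function of the eigenvalue, so it separates them. -/
theorem inner_eigenvector_eq_zero (h : IsNormalState v μ T ξ γ) (hT : 0 < T)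
    (hsa : γ.adjoint = γ) {lam lam' : ℝ} (hne : lam ≠ lam') {u w : X.H} (hu : u ∈ X.eigenspace lam)
    (hw : w ∈ X.eigenspace lam') : ⟪u, w⟫_ℂ = 0 := by
  have h1 : ⟪γ u, w⟫_ℂ = ⟪u, γ w⟫_ℂ := by
    rw [← ContinuousLinearMap.adjoint_inner_right, hsa]
  rw [h.fixed_point _ _ hu, h.fixed_point _ _ hw, inner_smul_left, inner_smul_right,
    Complex.conj_ofReal] at h1
  by_contra h0
  refine hne ?_
  have h2 := fermi_strictAnti.injective (Complex.ofReal_injective (mul_right_cancel₀ h0 h1))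
  have h3 := (div_left_inj' hT.ne').1 h2
  linarith

theorem IsNormalState.kinetic_lt_top (h : IsNormalState v μ T ξ γ) (hT : 0 < T) :
    kinetic γ < ⊤ := by
  obtain ⟨B, hB⟩ := X.exists_landau_basis
  have hd := h.apply_basis hB
  have hsa := adjoint_diagonal B hd
  have h0 := diagonal_nonneg B hd fun i => (fermi_pos _).le
  have hproj : ∀ (lam : ℝ) i, (X.eigenspace lam).starProjection (B i)
      = if lam = (2 * i.1 + 1) * X.b then B i else 0 := by
    intro lam i
    split_ifs with hl
    · rw [Submodule.starProjection_eq_self_iff, hl]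
      exact hB i
    · rw [Submodule.starProjection_apply_eq_zero_iff, Submodule.mem_orthogonal]
      exact fun u hu => inner_eigenvector_eq_zero h hT hsa hl hu (hB i)
  have hdiag : ∀ (lam : ℝ) i, (⟪B i, ((X.eigenspace lam).starProjection ∘L γ ∘L
      (X.eigenspace lam).starProjection) (B i)⟫_ℂ).re
      = if lam = (2 * i.1 + 1) * X.b then fermi (X.level μ ξ i.1 / T) else 0 := by
    intro lam i
    rw [ContinuousLinearMap.comp_apply, ContinuousLinearMap.comp_apply, hproj]
    split_ifs with hl
    · rw [hd, map_smul, hproj, if_pos hl, inner_smul_right, inner_self_eq_norm_sq_to_K,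
        B.orthonormal.1]
      simp
    · simp
  have hpos : ∀ lam : ℝ, 0 ≤ (X.eigenspace lam).starProjection ∘L γ ∘L
      (X.eigenspace lam).starProjection := by
    intro lam
    rw [ContinuousLinearMap.nonneg_iff_isPositive] at h0 ⊢
    have := h0.conj_adjoint (X.eigenspace lam).starProjection
    rwa [(isSelfAdjoint_starProjection (X.eigenspace lam)).adjoint_eq] at this
  have hk : kinetic γ = ∑' i : ℕ × Fin X.n,
      ENNReal.ofReal ((2 * i.1 + 1) * X.b * fermi (X.level μ ξ i.1 / T)) := by
    rw [kinetic]
    simp only [trace_eq_tsum B (hpos _), hdiag, ← ENNReal.tsum_mul_left]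
    -- Each Landau vector lies in exactly one eigenspace and is orthogonal to the others, so for
    -- each `i` the sum over all real `λ` has a single nonzero term.
    rw [ENNReal.tsum_comm]
    congr 1
    ext i
    rw [tsum_eq_single ((2 * i.1 + 1) * X.b) fun lam hl => by simp [hl], if_pos rfl,
      ← ENNReal.ofReal_mul (mul_nonneg (by positivity) X.b_pos.le)]
  rw [hk]
  refine tsum_levels_lt_top (μ := μ) (ξ := ξ) (f := fun k => (2 * k + 1) * X.b * fermi (X.level μ ξ k / T))
    (K := X.b) hT fun k => ?_
  have h1 := mul_le_mul_of_nonneg_left (fermi_le_sqrt (X.level μ ξ k / T))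
    (show 0 ≤ (2 * k + 1) * X.b from mul_nonneg (by positivity) X.b_pos.le)
  linarith

theorem tsum_entropy_particle_lt_top (X : Cell) (μ ξ : ℝ) (hT : 0 < T) :
    ∑' i : ℕ × Fin X.n, ENNReal.ofReal (Real.negMulLog (fermi (X.level μ ξ i.1 / T))) < ⊤ := by
  refine tsum_levels_lt_top (μ := μ) (ξ := ξ) (f := fun k => Real.negMulLog (fermi (X.level μ ξ k / T)))
    (K := 2) hT fun k => (negMulLog_le_two_mul_sqrt (fermi_pos _)).trans ?_
  have := mul_nonneg (Nat.cast_nonneg (α := ℝ) k) (Real.sqrt_nonneg (fermi (X.level μ ξ k / T)))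
  linarith

theorem tsum_entropy_hole_lt_top (X : Cell) (μ ξ : ℝ) (hT : 0 < T) :
    ∑' i : ℕ × Fin X.n, ENNReal.ofReal (Real.negMulLog (1 - fermi (X.level μ ξ i.1 / T)))
      < ⊤ := by
  refine tsum_levels_lt_top (μ := μ) (ξ := ξ) (f := fun k => Real.negMulLog (1 - fermi (X.level μ ξ k / T)))
    (K := 1) hT fun k => (negMulLog_one_sub_le (fermi_lt_one _)).trans
      ((fermi_le_sqrt _).trans ?_)
  have := mul_nonneg (Nat.cast_nonneg (α := ℝ) k) (Real.sqrt_nonneg (fermi (X.level μ ξ k / T)))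
  linarith

/-! ### Stability -/

/-- Only the weaker domination by `γ` is needed to keep the perturbed state between `0` and `1`; it
follows from `(q (1 - q))² ≤ q` on `[0, 1]`. -/
theorem IsPerturbation.norm_adjoint_sq_le {A : X.H →L[ℂ] X.H} {α : X.HS}
    (hA : IsPerturbation γ A α) {ι : Type*} {B : HilbertBasis ι ℂ X.H} {q : ι → ℝ}
    (hγ : ∀ i, γ (B i) = (q i : ℂ) • B i) (hq0 : ∀ i, 0 ≤ q i) (hq1 : ∀ i, q i ≤ 1) :
    ∃ C : ℝ, 0 ≤ C ∧ ∀ x, ‖A.adjoint x‖ ^ 2 ≤ C * (⟪x, γ x⟫_ℂ).re := by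
  obtain ⟨C, hC⟩ := hA.dominated
  refine ⟨|C|, abs_nonneg C, fun x => ?_⟩
  have h1 := re_inner_mono hC x
  have h2 : (⟪x, (A ∘L A.adjoint) x⟫_ℂ).re = ‖A.adjoint x‖ ^ 2 := by
    rw [ContinuousLinearMap.comp_apply, ← ContinuousLinearMap.adjoint_inner_left,
      inner_self_eq_norm_sq_to_K]
    norm_cast
  have h3 : ∀ i, (C • (γ * (1 - γ)) ^ 2 : X.H →L[ℂ] X.H) (B i) = ((C * (q i * (1 - q i)) ^ 2 : ℝ) : ℂ) • B i := by
    intro i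
    have h4 : (γ * (1 - γ)) (B i) = ((q i * (1 - q i) : ℝ) : ℂ) • B i := by
      change γ (B i - γ (B i)) = _
      rw [map_sub, hγ, map_smul, hγ, smul_smul, ← sub_smul]
      congr 1
      push_cast
      ring
    have h5 : ((γ * (1 - γ)) ^ 2 : X.H →L[ℂ] X.H) (B i) = (((q i * (1 - q i)) ^ 2 : ℝ) : ℂ) • B i := by
      rw [sq]
      change (γ * (1 - γ)) ((γ * (1 - γ)) (B i)) = _
      rw [h4, map_smul, h4, smul_smul]
      congr 1
      push_cast
      ring
    rw [_root_.smul_apply, h5]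
    refine (Complex.coe_smul C _).symm.trans ?_
    rw [smul_smul, ← Complex.ofReal_mul]
  have h6 : ∀ i, (((|C| : ℝ) : ℂ) • γ) (B i) = ((|C| * q i : ℝ) : ℂ) • B i := by
    intro i
    rw [_root_.smul_apply, hγ, smul_smul, ← Complex.ofReal_mul]
  have h7 := re_inner_diagonal_mono B h3 h6 (fun i => by
    have a1 : (q i * (1 - q i)) ^ 2 ≤ q i := by
      have b1 : 0 ≤ q i * (1 - q i) := mul_nonneg (hq0 i) (by linarith [hq1 i])
      nlinarith [hq0 i, hq1 i, mul_nonneg (hq0 i) (hq0 i)]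
    calc C * (q i * (1 - q i)) ^ 2 ≤ |C| * (q i * (1 - q i)) ^ 2 :=
          mul_le_mul_of_nonneg_right (le_abs_self C) (sq_nonneg _)
      _ ≤ |C| * q i := mul_le_mul_of_nonneg_left a1 (abs_nonneg C)) x
  have h8 : (⟪x, (((|C| : ℝ) : ℂ) • γ) x⟫_ℂ).re = |C| * (⟪x, γ x⟫_ℂ).re := by
    rw [_root_.smul_apply, inner_smul_right, Complex.re_ofReal_mul]
  rw [h8] at h7
  rw [h2] at h1
  exact h1.trans h7

theorem integral_potential_zero :
    ∫ z, v (z.1 - z.2) * ‖(0 : X.HS) z‖ ^ 2 ∂(X.vol.prod X.vol) = 0 := by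
  rw [integral_eq_zero_of_ae]
  filter_upwards [Lp.coeFn_zero ℂ 2 (X.vol.prod X.vol)] with z hz
  rw [hz]
  simp

theorem adjoint_real_smul (ε : ℝ) (A : X.H →L[ℂ] X.H) :
    ((ε : ℂ) • A).adjoint = (ε : ℂ) • A.adjoint := by
  rw [map_smulₛₗ, Complex.conj_ofReal]

theorem conjOp_real_smul (ε : ℝ) (A : X.H →L[ℂ] X.H) :
    conjOp ((ε : ℂ) • A) = (ε : ℂ) • conjOp A := by
  ext1 f
  rw [_root_.smul_apply, conjOp_apply, conjOp_apply, _root_.smul_apply,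
    star_smul_Lp, Complex.conj_ofReal]

theorem norm_real_smul_sq {E : Type*} [NormedAddCommGroup E] [NormedSpace ℂ E] (ε : ℝ) (x : E) :
    ‖(ε : ℂ) • x‖ ^ 2 = ε ^ 2 * ‖x‖ ^ 2 := by
  rw [norm_smul, Complex.norm_real, mul_pow, Real.norm_eq_abs, sq_abs]

/-- All terms depending on `γ` alone cancel in the difference of free energies. What remains is at
least `(T r - M / 2) ε² ‖α‖²`. -/
theorem IsNormalState.isEnergeticallyStable {M r : ℝ} (h : IsNormalState v μ T ξ γ) (hT : 0 < T)
    (hv : IsPairPotential X M v) (hr : M / 2 < T * r)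
    (hent : ∀ k p, 0 ≤ p → p ≤ 1 → Real.negMulLog p ≤ Real.negMulLog (fermi (X.level μ ξ k / T))
      + (-Real.log (fermi (X.level μ ξ k / T)) - 1) * (p - fermi (X.level μ ξ k / T))
      - r * (p - fermi (X.level μ ξ k / T)) ^ 2) :
    IsEnergeticallyStable v μ T γ := by
  intro A α hA hα
  obtain ⟨B, hB⟩ := X.exists_landau_basis
  have hd := h.apply_basis hB
  have hM := hv.bound_nonneg
  have hr0 : 0 ≤ r := by
    by_contra hlt
    nlinarith
  obtain ⟨C, hC0, hC⟩ := hA.norm_adjoint_sq_le hd (fun i => (fermi_pos _).le)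
    fun i => (fermi_lt_one _).le
  set c := 1 - fermi (X.level μ ξ 0 / T) with hc
  have hc0 : 0 < c := sub_pos.2 (fermi_lt_one _)
  have hq : ∀ i : ℕ × Fin X.n, fermi (X.level μ ξ i.1 / T) ≤ 1 - c :=
    fun i => fermi_le_one_sub X μ ξ hT i.1
  -- Chosen so that `ε² C ≤ c`, which makes the perturbed operator matrix an admissible state; `C +
  -- 1` covers `C = 0`.
  refine ⟨√(c / (C + 1)), Real.sqrt_pos.2 (by positivity), fun ε hε hεlt => ?_⟩
  have hε2 : ε ^ 2 * C ≤ c := by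
    have h1 : ε ^ 2 < c / (C + 1) := by
      rw [← sq_abs, ← Real.sq_sqrt (show 0 ≤ c / (C + 1) by positivity)]
      exact pow_lt_pow_left₀ hεlt (abs_nonneg _) two_ne_zero
    rw [lt_div_iff₀ (by positivity)] at h1
    nlinarith [sq_nonneg ε]
  have hA' : ∀ x, ‖((ε : ℂ) • A).adjoint x‖ ^ 2 ≤ c * (⟪x, γ x⟫_ℂ).re := by
    intro x
    have h0 : 0 ≤ (⟪x, γ x⟫_ℂ).re :=
      (hasSum_re_inner_diagonal B hd x).nonneg fun i => mul_nonneg (fermi_pos _).le (by positivity)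
    rw [adjoint_real_smul, _root_.smul_apply, norm_real_smul_sq]
    calc ε ^ 2 * ‖A.adjoint x‖ ^ 2 ≤ ε ^ 2 * (C * (⟪x, γ x⟫_ℂ).re) :=
          mul_le_mul_of_nonneg_left (hC x) (sq_nonneg ε)
      _ = ε ^ 2 * C * (⟪x, γ x⟫_ℂ).re := by ring
      _ ≤ _ := mul_le_mul_of_nonneg_right hε2 h0
  have hs' : ((ε : ℂ) • A).adjoint = conjOp ((ε : ℂ) • A) := by
    rw [adjoint_real_smul, conjOp_real_smul, hA.symm]
  have hS0 := entropy_zero hd hc0 hq fun i => fermi_pos _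
  have hS0top : entropy γ 0 < ⊤ := by
    rw [hS0]
    exact ENNReal.add_lt_top.2
      ⟨tsum_entropy_particle_lt_top X μ ξ hT, tsum_entropy_hole_lt_top X μ ξ hT⟩
  have hS := entropy_add_le hd hc0 hq hA' (fun i => fermi_pos _) hs' hr0 fun i => hent i.1
  rw [← hS0] at hS
  simp only [adjoint_real_smul, _root_.smul_apply, norm_real_smul_sq,
    ENNReal.ofReal_mul (sq_nonneg ε)] at hS
  rw [ENNReal.tsum_mul_left, hA.kernel.tsum_norm_sq B, ← ENNReal.ofReal_mul (sq_nonneg ε),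
    ← ENNReal.ofReal_mul hr0] at hS
  have hS1top : entropy γ ((ε : ℂ) • A) < ⊤ := (le_self_add.trans hS).trans_lt hS0top
  have hSreal : (entropy γ ((ε : ℂ) • A)).toReal + r * (ε ^ 2 * ‖α‖ ^ 2)
      ≤ (entropy γ 0).toReal := by
    have h1 := ENNReal.toReal_mono hS0top.ne hS
    rwa [ENNReal.toReal_add hS1top.ne ENNReal.ofReal_ne_top,
      ENNReal.toReal_ofReal (by positivity)] at h1
  have hI := integral_potential_mul_norm_sq_ge hv ((ε : ℂ) • α)
  rw [norm_real_smul_sq] at hI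
  have hkin := h.kinetic_lt_top hT
  rw [freeEnergy, freeEnergy, if_pos ⟨hkin, h.trace_lt_top, hS0top⟩,
    if_pos ⟨hkin, h.trace_lt_top, hS1top⟩, EReal.coe_lt_coe_iff, integral_potential_zero]
  have hpos : 0 < ε ^ 2 * ‖α‖ ^ 2 := by
    have := norm_pos_iff.2 hα
    positivity
  have h1 := mul_le_mul_of_nonneg_left hSreal hT.le
  have h2 := mul_lt_mul_of_pos_right hr hpos
  linarith

end Cell

end BdG

/-! ### High temperature and strong field -/

namespace BdG

namespace Cell

variable {X : Cell} {v : ℝ × ℝ → ℝ} {μ T ξ M : ℝ} {γ : X.H →L[ℂ] X.H}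

/-- Here `T` is the lower bound on the symbol, with `T > M`, and the universal concavity constant `r
= 1 / 4` gives `T / 4 > M / 2`. -/
theorem IsNormalState.stable_of_lt (h : IsNormalState v μ T ξ γ) (hv : IsPairPotential X M v)
    (hT : 2 * |M| + 1 < T) : LPos X v μ T ξ ∧ IsEnergeticallyStable v μ T γ := by
  have hM := le_abs_self M
  have hT0 : 0 < T := by linarith [abs_nonneg M]
  refine ⟨lPos_of_le_kSymbol hv (K := T) (by linarith [abs_nonneg M])
    fun k k' => le_kSymbol hT0 _ _,
    h.isEnergeticallyStable hT0 hv (r := 1 / 4) (by linarith) fun k p hp hp1 =>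
      negMulLog_upper hp hp1 (fermi_pos _) (fermi_lt_one _).le⟩

theorem two_mul_le_neg_log_fermi (x : ℝ) : 2 * x ≤ -Real.log (fermi x) := by
  have h := Real.log_le_log (fermi_pos x) (fermi_le_exp x)
  rw [Real.log_exp] at h
  linarith

/-- Put `H = 2 (2|M| + 1)`. Since `ξ ≥ -2b/3`, every level is at least `b / 3 - |μ| ≥ H`. The bound
on `T` gives `H / T ≥ 2`, hence `-log q ≥ 2H / T ≥ 4 > 8 / 3`. The concavity constant `-log q / 8`
is at least `r = H / (4T)`, and `T r = H / 4 > M / 2`. -/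
theorem IsNormalState.stable_of_field_lt (h : IsNormalState v μ T ξ γ)
    (hv : IsPairPotential X M v) (hint : |∫ y, v y ∂X.vol| ≤ 1) (hT0 : 0 < T)
    (hT : T ≤ 2 * |M| + 1) (hb : 3 * (|μ| + 2 * (2 * |M| + 1)) < X.b) :
    LPos X v μ T ξ ∧ IsEnergeticallyStable v μ T γ := by
  have hM := le_abs_self M
  have hM0 := abs_nonneg M
  have hμ0 := abs_nonneg μ
  have hμ := le_abs_self μ
  have hξ := h.neg_mul_le_potential hint hT0 (by linarith) (by linarith)
  have hlev : ∀ k, 2 * (2 * |M| + 1) ≤ X.level μ ξ k := by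
    intro k
    have : 0 ≤ k * X.b := mul_nonneg (Nat.cast_nonneg k) X.b_pos.le
    rw [level]
    linarith
  refine ⟨lPos_of_le_kSymbol hv (K := 2 * (2 * |M| + 1)) (by linarith)
    fun k k' => le_kSymbol_of_le hT0 (by linarith) (hlev k) (hlev k'),
    h.isEnergeticallyStable hT0 hv (r := (2 * |M| + 1) / 2 / T)
      (by rw [mul_div_cancel₀ _ hT0.ne']; linarith) fun k p hp hp1 => ?_⟩
  have h1 : 2 * (2 * |M| + 1) / T ≤ X.level μ ξ k / T :=
    div_le_div_of_nonneg_right (hlev k) hT0.le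
  have h2 := two_mul_le_neg_log_fermi (X.level μ ξ k / T)
  have h3 : 2 ≤ 2 * (2 * |M| + 1) / T := by
    rw [le_div_iff₀ hT0]
    linarith
  have h5 : 8 / 3 ≤ -Real.log (fermi (X.level μ ξ k / T)) := by linarith
  refine (negMulLog_upper_of_small hp hp1 (fermi_pos _) h5).trans ?_
  have h4 : (2 * |M| + 1) / 2 / T ≤ -Real.log (fermi (X.level μ ξ k / T)) / 8 := by
    have : (2 * |M| + 1) / 2 / T = 2 * (2 * |M| + 1) / T / 4 := by ring
    linarith
  exact sub_le_sub_left (mul_le_mul_of_nonneg_right h4 (sq_nonneg _)) _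

end Cell

end BdG

theorem mainTheorem7 :
    ∃ ε > (0 : ℝ), ∀ μ M : ℝ, ∃ T₀ b₀ : ℝ,
      ∀ (X : BdG.Cell) (v : ℝ × ℝ → ℝ), BdG.IsPairPotential X M v → |∫ y, v y ∂X.vol| ≤ ε →
      ∀ T : ℝ, 0 < T → (T₀ < T ∨ b₀ < X.b) →
      ∀ (ξ : ℝ) (γ : X.H →L[ℂ] X.H), BdG.Cell.IsNormalState v μ T ξ γ →
        BdG.Cell.LPos X v μ T ξ ∧ BdG.Cell.IsEnergeticallyStable v μ T γ := by
  -- The cases are split by temperature rather than by the hypothesis on `T` or `b`, because the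
  -- strong-field estimate relies on `T ≤ 2|M| + 1`.
  refine ⟨1, one_pos, fun μ M => ⟨2 * |M| + 1, 3 * (|μ| + 2 * (2 * |M| + 1)),
    fun X v hv hint T hT0 hTb ξ γ h => ?_⟩⟩
  rcases lt_or_ge (2 * |M| + 1) T with hT | hT
  · exact h.stable_of_lt hv hT
  · exact h.stable_of_field_lt hv hint hT0 hT (hTb.resolve_left (not_lt.2 hT))
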